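/- For integers $q\ge 1$ and a finite set $\mathcal D$ of positive integers put $$\mathfrak S(\mathcal D;q)=\Bigl(\frac{\varphi(q)}{q}\Bigr)^{-|\mathcal D|}\prod_{p\nmid q}\Bigl(1-\frac1p\Bigr)^{-|\mathcal D|}\Bigl(1-\frac{v_p(\mathcal D)}{p}\Bigr),\qquad v_p(\mathcal D)=|\{d \bmod p: d\in\mathcal D\}|,$$ the product being over the primes $p$ not dividing $q$. Assume the following uniform variant of the Hardy–Littlewood prime $k$-tuple conjecture: there is an absolute constant $0<\delta<1/2$ such that for all integers $k,q,N,D\ge 1$ and every set $\mathcal D\subseteq[1,D]$ of $k$ distinct multiples of $q$, $$\sum_{\substack{1\le n\le N\\(n,q)=1}}\ \prod_{d\in\mathcal D}\Lambda(n+d)=\mathfrak S(\mathcal D;q)\,\bigl|\{1\le n\le N:(n,q)=1\}\bigr|+O_{k,\delta}\bigl((N+D)^{1-\delta}\bigr),$$ where $\Lambda$ is the von Mangoldt function. **Theorem.** Let $k\ge 1$ be an integer and let $0<c_1\le c_2$ be real numbers. Then, as $N\to\infty$, uniformly for all positive integers $q$ with $c_1\frac{N}{\log N}\le\varphi(q)\le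 c_2\frac{N}{\log N}$, $$\frac{1}{\varphi(q)}\sum_{\substack{a \bmod q\\(a,q)=1}}\pi(N;q,a)^k=\Bigl(1+O\Bigl(\frac{\log\log N}{\log N}\Bigr)\Bigr)\sum_{j=1}^{k}S(k,j)\Bigl(\frac{N}{\varphi(q)\log N}\Bigr)^{j},$$ where $\pi(N;q,a)$ is the number of primes $p\le N$ with $p\equiv a\pmod q$ and $S(k,j)$ is the Stirling number of the second kind, i.e. the number of partitions of a set of $k$ objects into $j$ non-empty subsets. The implied constant depends only on $k$, $c_1$ and $c_2$. -/

import Mathlib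

/-- `v_p(𝒟)`: the number of residue classes modulo `p` occupied by the elements of `𝒟`. -/
def residueCount (p : ℕ) (𝒟 : Finset ℕ) : ℕ :=
  (𝒟.image (fun d => d % p)).card

/-- The singular series
`𝔖(𝒟; q) = (φ(q)/q)^{-k} ∏_{p ∤ q} (1 - 1/p)^{-k} (1 - v_p(𝒟)/p)` with `k = |𝒟|`.
For each `p` larger than all elements of `𝒟` and not dividing `q` the factor is
`(1 - 1/p)^{-k} (1 - k/p) = 1 + O_k(1/p²)`, so the infinite product is
absolutely convergent (it is `0` exactly when some factor vanishes). -/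
noncomputable def singularSeries (𝒟 : Finset ℕ) (q : ℕ) : ℝ :=
  (((Nat.totient q : ℝ) / (q : ℝ)) ^ 𝒟.card)⁻¹ *
    ∏' p : Nat.Primes,
      if (p : ℕ) ∣ q then (1 : ℝ)
      else ((1 - 1 / ((p : ℕ) : ℝ)) ^ 𝒟.card)⁻¹ *
        (1 - (residueCount (p : ℕ) 𝒟 : ℝ) / ((p : ℕ) : ℝ))

/-- The integers `1 ≤ n ≤ N` with `(n, q) = 1`. -/
def coprimesUpTo (N q : ℕ) : Finset ℕ :=
  (Finset.Icc 1 N).filter (fun n => Nat.Coprime n q)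

/-- The uniform variant of the Hardy–Littlewood prime `k`-tuple conjecture: there is an
absolute `0 < δ < 1/2` such that, for every `k ≥ 1`, uniformly in `q, N, D ≥ 1` and in sets
`𝒟 ⊆ [1, D]` of `k` distinct multiples of `q`,
`∑_{n ≤ N, (n,q)=1} ∏_{d ∈ 𝒟} Λ(n+d)
  = 𝔖(𝒟; q) |{n ≤ N : (n,q)=1}| + O_{k,δ}((N+D)^{1-δ})`. -/
def UniformHardyLittlewood : Prop :=
  ∃ δ : ℝ, 0 < δ ∧ δ < 1 / 2 ∧
    ∀ k : ℕ, 1 ≤ k → ∃ C : ℝ,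
      ∀ q N D : ℕ, 1 ≤ q → 1 ≤ N → 1 ≤ D →
        ∀ 𝒟 : Finset ℕ, 𝒟 ⊆ Finset.Icc 1 D → 𝒟.card = k → (∀ d ∈ 𝒟, q ∣ d) →
          |(∑ n ∈ coprimesUpTo N q, ∏ d ∈ 𝒟, ArithmeticFunction.vonMangoldt (n + d))
              - singularSeries 𝒟 q * ((coprimesUpTo N q).card : ℝ)|
            ≤ C * ((N : ℝ) + (D : ℝ)) ^ (1 - δ)

/-- `π(N; q, a)`: the number of primes `p ≤ N` with `p ≡ a (mod q)`. -/
def primeCountAP (N q a : ℕ) : ℕ :=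
  ((Finset.Icc 1 N).filter (fun p => Nat.Prime p ∧ p ≡ a [MOD q])).card

/-- The `k`-th moment `(1/φ(q)) ∑*_{a mod q} π(N; q, a)^k` over reduced residues `a` mod `q`,
represented by `0 ≤ a < q` with `(a, q) = 1`. -/
noncomputable def primeMoment (k N q : ℕ) : ℝ :=
  1 / (Nat.totient q : ℝ) *
    ∑ a ∈ (Finset.range q).filter (fun a => Nat.Coprime a q), (primeCountAP N q a : ℝ) ^ k

/-- The main term `∑_{j=1}^k S(k,j) (N / (φ(q) log N))^j`. -/
noncomputable def stirlingMainTerm (k N q : ℕ) : ℝ :=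
  ∑ j ∈ Finset.Icc 1 k,
    (Nat.stirlingSecond k j : ℝ) * ((N : ℝ) / ((Nat.totient q : ℝ) * Real.log (N : ℝ))) ^ j

/-! Put λ = N / (φ(q) log N). The main term is the k-th moment of a Poisson variable of mean λ.
Since x^k = Σ S(k,j) x(x-1)⋯(x-j+1), it is enough that the j-th factorial moment of π(N;q,a) is λ^j
up to a relative error O(log log N / log N).

Residue classes are represented by n + 1 with 1 ≤ n ≤ q, and their members by n + 1 + qm with m < M,
where M ≈ N/q. The factorial moment then counts, over all j-element sets A ⊆ [0, M), the n for which
every n + 1 + qm with m ∈ A is prime. For a fixed A the conjecture, used with modulus 1 and shifts 1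
+ qm, evaluates this count with von Mangoldt weights (`abs_mangoldtCount_sub_le`). Its error saves a
power of N, while the number of sets A is bounded by a power of log N. What remains is to average
the singular series over A (`sum_singularSeries`).

Let j = i + 1 and y = ⌊(log N)²⌋. In the singular series the primes dividing q contribute
(q/φ(q))^i. The other primes above y contribute 1 + O(1/y), because the elements of A are distinct
modulo them. The others contribute ρ^{-j} `sieveWeight s A`, where s is the set of these primes and
ρ = ∏ (1 - 1/p) over s. This weight is the probability that A survives when, independently for each
p ∈ s, a uniformly random class modulo p is removed. Summing over A gives the expectation of
binomial(Y, j), where Y is the number of survivors in [0, M) (`residueAvg_choose`). Now Y has mean μ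
= Mρ and variance at most μ (`residueAvg_card_sifted_sq_le`), and Selberg's sieve shows that Y never
exceeds a constant times μ (`card_sifted_le`). Hence E Y^j = μ^j + O(μ^{j-1})
(`sieveWeight_moment`), and the powers of ρ cancel. The relative error is about 1/μ, which is O(log
log N / log N) because q/φ(q) ≪ ρ log log N (`le_siftedDensity`).

Replacing the weights by counts of primes (`primeTotal_isBigO`) costs an admissible relative error:
prime powers and small n are negligible, and the remaining logarithms are all close to log N. The
choices M = ⌊(N-1)/q⌋ and M + 1 bracket the moment (`primeMoment_isBigO`). -/

/-! ### Chebyshev and Mertens estimates with explicit constants -/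

open Finset in
-- The product of the p^⌊n/p⌋ divides n! ≤ n^n; replacing the floors by n/p costs θ(n) ≤ n log 4 in
-- total.
theorem sum_log_div_primesLE_le (n : ℕ) (hn : 1 ≤ n) :
    ∑ p ∈ Nat.primesLE n, Real.log p / p ≤ Real.log n + Real.log 4 := by
  have hdvd : ∏ p ∈ Nat.primesLE n, p ^ (n / p) ∣ n.factorial := by
    refine Finset.prod_dvd_of_isRelPrime ?_ ?_
    · intro a ha b hb hab
      have ha' := Nat.prime_of_mem_primesLE ha
      have hb' := Nat.prime_of_mem_primesLE hb
      exact Nat.coprime_iff_isRelPrime.mp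
        (Nat.Coprime.pow _ _ ((Nat.coprime_primes ha' hb').mpr hab))
    · intro p hp
      have hp' := Nat.prime_of_mem_primesLE hp
      rw [hp'.pow_dvd_iff_le_factorization (Nat.factorial_ne_zero n),
        Nat.factorization_factorial hp' (Nat.lt_succ_self _)]
      have h1 : (1 : ℕ) ∈ Ico 1 (Nat.log p n).succ := by
        have : 0 < Nat.log p n := Nat.log_pos hp'.one_lt (Nat.le_of_mem_primesLE hp)
        rw [Finset.mem_Ico]; omega
      calc n / p = n / p ^ 1 := by simp
        _ ≤ _ := Finset.single_le_sum (f := fun i => n / p ^ i) (fun _ _ => Nat.zero_le _) h1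
  have hle : ∏ p ∈ Nat.primesLE n, p ^ (n / p) ≤ n ^ n :=
    (Nat.le_of_dvd (Nat.factorial_pos n) hdvd).trans (Nat.factorial_le_pow n)
  have hn0 : (0 : ℝ) < n := by exact_mod_cast hn
  have hlog : ∑ p ∈ Nat.primesLE n, ((n / p : ℕ) : ℝ) * Real.log p ≤ n * Real.log n := by
    have h := Real.log_le_log (x := ((∏ p ∈ Nat.primesLE n, p ^ (n / p) : ℕ) : ℝ))
      (by
        have : 0 < ∏ p ∈ Nat.primesLE n, p ^ (n / p) :=
          Finset.prod_pos fun p hp => pow_pos (Nat.prime_of_mem_primesLE hp).pos _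
        exact_mod_cast this) (Nat.cast_le.mpr hle)
    push_cast at h
    rw [Real.log_prod, Real.log_pow] at h
    · simpa [Real.log_pow] using h
    · intro p hp
      have := (Nat.prime_of_mem_primesLE hp).pos
      positivity
  have hθ : ∑ p ∈ Nat.primesLE n, Real.log p ≤ Real.log 4 * n := by
    rw [← Chebyshev.theta_eq_sum_primesLE_log]
    exact Chebyshev.theta_le_log4_mul_x hn0.le
  have hmul : n * ∑ p ∈ Nat.primesLE n, Real.log p / p ≤ n * (Real.log n + Real.log 4) := by
    calc n * ∑ p ∈ Nat.primesLE n, Real.log p / p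
        ≤ ∑ p ∈ Nat.primesLE n, (((n / p : ℕ) : ℝ) * Real.log p + Real.log p) := by
          rw [Finset.mul_sum]
          refine Finset.sum_le_sum fun p hp => ?_
          have hp' := Nat.prime_of_mem_primesLE hp
          have hl : 0 ≤ Real.log p := Real.log_natCast_nonneg p
          have : (n : ℝ) / p ≤ (n / p : ℕ) + 1 := by
            have := Nat.lt_floor_add_one ((n : ℝ) / p)
            rw [Nat.floor_div_eq_div] at this
            exact this.le
          calc (n : ℝ) * (Real.log p / p) = (n / p) * Real.log p := by ring
            _ ≤ ((n / p : ℕ) + 1) * Real.log p := by gcongr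
            _ = _ := by ring
      _ ≤ n * (Real.log n + Real.log 4) := by
          rw [Finset.sum_add_distrib]; linarith
  exact le_of_mul_le_mul_left hmul hn0

/-- Normalised by ∏ (1 + g i), the weights describe a random subset containing each i independently
with probability g i / (1 + g i). The identity computes the expectation of an additive function of
it. -/
theorem sum_powerset_sum_mul_prod {ι : Type*} [DecidableEq ι] (s : Finset ι) (l g : ι → ℝ)
    (hg : ∀ i ∈ s, 0 ≤ g i) :
    ∑ R ∈ s.powerset, (∑ i ∈ R, l i) * ∏ i ∈ R, g i
      = (∏ i ∈ s, (1 + g i)) * ∑ i ∈ s, l i * g i / (1 + g i) := by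
  induction s using Finset.induction_on with
  | empty => simp
  | insert a s ha ih =>
    have ih' := ih fun i hi => hg i (Finset.mem_insert_of_mem hi)
    have h0 : (1 + g a) ≠ 0 := by
      have := hg a (Finset.mem_insert_self _ _); positivity
    rw [Finset.sum_powerset_insert ha, ih', Finset.prod_insert ha, Finset.sum_insert ha]
    have : ∀ R ∈ s.powerset, (∑ i ∈ insert a R, l i) * ∏ i ∈ insert a R, g i
        = l a * g a * ∏ i ∈ R, g i + g a * ((∑ i ∈ R, l i) * ∏ i ∈ R, g i) := by
      intro R hR
      have haR : a ∉ R := fun h => ha (Finset.mem_powerset.mp hR h)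
      rw [Finset.sum_insert haR, Finset.prod_insert haR]; ring
    rw [Finset.sum_congr rfl this, Finset.sum_add_distrib, ← Finset.mul_sum, ← Finset.mul_sum, ih',
      ← Finset.prod_one_add]
    field_simp
    ring

/-- Markov's inequality for the multiplicative weights `∏ g`. -/
theorem half_prod_le_sum_powerset_filter {ι : Type*} [DecidableEq ι] (s : Finset ι) (l g : ι → ℝ)
    (hg : ∀ i ∈ s, 0 ≤ g i) (hl : ∀ i ∈ s, 0 ≤ l i) {T : ℝ} (hT : 0 < T)
    (h : ∑ i ∈ s, l i * g i / (1 + g i) ≤ T / 2) :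
    (∏ i ∈ s, (1 + g i)) / 2 ≤ ∑ R ∈ s.powerset with ∑ i ∈ R, l i ≤ T, ∏ i ∈ R, g i := by
  have hprod : ∀ R ∈ s.powerset, 0 ≤ ∏ i ∈ R, g i := fun R hR =>
    Finset.prod_nonneg fun i hi => hg i (Finset.mem_powerset.mp hR hi)
  have hP : 0 ≤ ∏ i ∈ s, (1 + g i) := Finset.prod_nonneg fun i hi => by
    have := hg i hi; positivity
  have hsplit := Finset.sum_filter_add_sum_filter_not s.powerset (fun R => ∑ i ∈ R, l i ≤ T)
    (fun R => ∏ i ∈ R, g i)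
  have htail : T * ∑ R ∈ s.powerset with ¬ ∑ i ∈ R, l i ≤ T, ∏ i ∈ R, g i
      ≤ (∏ i ∈ s, (1 + g i)) * (T / 2) := by
    calc T * ∑ R ∈ s.powerset with ¬ ∑ i ∈ R, l i ≤ T, ∏ i ∈ R, g i
        ≤ ∑ R ∈ s.powerset with ¬ ∑ i ∈ R, l i ≤ T, (∑ i ∈ R, l i) * ∏ i ∈ R, g i := by
          rw [Finset.mul_sum]
          refine Finset.sum_le_sum fun R hR => ?_
          rw [Finset.mem_filter] at hR
          exact mul_le_mul_of_nonneg_right (not_le.mp hR.2).le (hprod R hR.1)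
      _ ≤ ∑ R ∈ s.powerset, (∑ i ∈ R, l i) * ∏ i ∈ R, g i := by
          refine Finset.sum_le_sum_of_subset_of_nonneg (Finset.filter_subset _ _) ?_
          intro R hR _
          exact mul_nonneg (Finset.sum_nonneg fun i hi => hl i (Finset.mem_powerset.mp hR hi))
            (hprod R hR)
      _ = (∏ i ∈ s, (1 + g i)) * ∑ i ∈ s, l i * g i / (1 + g i) :=
          sum_powerset_sum_mul_prod s l g hg
      _ ≤ _ := by gcongr
  have htail' : ∑ R ∈ s.powerset with ¬ ∑ i ∈ R, l i ≤ T, ∏ i ∈ R, g i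
      ≤ (∏ i ∈ s, (1 + g i)) / 2 := by
    refine le_of_mul_le_mul_left (htail.trans_eq ?_) hT
    ring
  rw [← Finset.prod_one_add] at hsplit
  linarith

theorem log_prod_primes {R : Finset ℕ} (hR : ∀ p ∈ R, p.Prime) :
    Real.log ((∏ p ∈ R, p : ℕ) : ℝ) = ∑ p ∈ R, Real.log p := by
  rw [Nat.cast_prod, Real.log_prod]
  intro p hp
  exact_mod_cast (hR p hp).ne_zero

theorem prod_primes_injOn (s : Finset ℕ) (hs : ∀ p ∈ s, p.Prime) :
    Set.InjOn (fun R : Finset ℕ => ∏ p ∈ R, p) s.powerset := by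
  intro R hR R' hR' h
  have hR1 := Finset.mem_powerset.mp hR
  have hR2 := Finset.mem_powerset.mp hR'
  have e1 := Nat.primeFactors_prod (s := R) fun p hp => hs p (hR1 hp)
  have e2 := Nat.primeFactors_prod (s := R') fun p hp => hs p (hR2 hp)
  simp only at h
  rw [← e1, ← e2, h]

theorem sum_inv_Icc_le (n : ℕ) : ∑ m ∈ Finset.Icc 1 n, (m : ℝ)⁻¹ ≤ 1 + Real.log n := by
  have := harmonic_le_one_add_log n
  rw [harmonic_eq_sum_Icc] at this
  push_cast at this
  exact this

theorem log_le_sum_inv_Icc (n : ℕ) : Real.log (n + 1) ≤ ∑ m ∈ Finset.Icc 1 n, (m : ℝ)⁻¹ := by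
  have := log_add_one_le_harmonic n
  rw [harmonic_eq_sum_Icc] at this
  push_cast at this
  exact this

/-- By Markov's inequality at least half of the expanded product comes from squarefree integers up
to n^6, and their reciprocals are part of a harmonic sum. -/
theorem prod_one_add_inv_primesLE_le (n : ℕ) (hn : 2 ≤ n) :
    ∏ p ∈ Nat.primesLE n, (1 + (p : ℝ)⁻¹) ≤ 20 * Real.log n := by
  have hn' : (2 : ℝ) ≤ n := by exact_mod_cast hn
  have hlog2 : Real.log 2 ≤ Real.log n := Real.log_le_log (by norm_num) hn'
  have hl2 : 0.69 < Real.log 2 := by have := Real.log_two_gt_d9; linarith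
  have hl4 : Real.log 4 = 2 * Real.log 2 := by
    rw [show (4 : ℝ) = 2 ^ 2 by norm_num, Real.log_pow]; norm_num
  have hmark := half_prod_le_sum_powerset_filter (Nat.primesLE n) (fun p => Real.log p)
    (fun p => (p : ℝ)⁻¹) (fun p _ => by positivity) (fun p _ => Real.log_natCast_nonneg p)
    -- Half of this threshold, 3 log n, dominates the mean log n + log 4 because n ≥ 2.
    (T := 6 * Real.log n) (by linarith) (by
      calc ∑ p ∈ Nat.primesLE n, Real.log p * (p : ℝ)⁻¹ / (1 + (p : ℝ)⁻¹)
          ≤ ∑ p ∈ Nat.primesLE n, Real.log p / p := by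
            refine Finset.sum_le_sum fun p _ => ?_
            rw [← div_eq_mul_inv]
            refine div_le_self (div_nonneg (Real.log_natCast_nonneg p) (by positivity)) ?_
            have : (0 : ℝ) ≤ (p : ℝ)⁻¹ := by positivity
            linarith
        _ ≤ Real.log n + Real.log 4 := sum_log_div_primesLE_le n (by omega)
        _ ≤ _ := by linarith)
  have hprime : ∀ p ∈ Nat.primesLE n, p.Prime := fun p hp => Nat.prime_of_mem_primesLE hp
  have hsum : ∑ R ∈ (Nat.primesLE n).powerset with ∑ p ∈ R, Real.log (p : ℕ) ≤ 6 * Real.log n,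
      ∏ p ∈ R, ((p : ℕ) : ℝ)⁻¹ ≤ ∑ m ∈ Finset.Icc 1 (n ^ 6), (m : ℝ)⁻¹ := by
    have e : ∀ R : Finset ℕ, ∏ p ∈ R, (p : ℝ)⁻¹ = ((∏ p ∈ R, p : ℕ) : ℝ)⁻¹ := by
      intro R; rw [Nat.cast_prod, Finset.prod_inv_distrib]
    simp_rw [e]
    rw [← Finset.sum_image (f := fun m : ℕ => (m : ℝ)⁻¹) (g := fun R : Finset ℕ => ∏ p ∈ R, p)]
    · refine Finset.sum_le_sum_of_subset_of_nonneg ?_ (fun _ _ _ => by positivity)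
      intro m hm
      obtain ⟨R, hR, rfl⟩ := Finset.mem_image.mp hm
      rw [Finset.mem_filter] at hR
      have hRp : ∀ p ∈ R, p.Prime := fun p hp => hprime p (Finset.mem_powerset.mp hR.1 hp)
      have hpos : 0 < ∏ p ∈ R, p := Finset.prod_pos fun p hp => (hRp p hp).pos
      rw [Finset.mem_Icc]
      refine ⟨hpos, ?_⟩
      have h2 := hR.2
      rw [← log_prod_primes hRp] at h2
      have : Real.log ((∏ p ∈ R, p : ℕ) : ℝ) ≤ Real.log ((n ^ 6 : ℕ) : ℝ) := by
        push_cast [Real.log_pow] at h2 ⊢; exact h2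
      have := (Real.log_le_log_iff (by exact_mod_cast hpos) (by positivity)).mp this
      exact_mod_cast this
    · exact (prod_primes_injOn _ hprime).mono fun R hR => (Finset.mem_filter.mp hR).1
  have h3 := sum_inv_Icc_le (n ^ 6)
  push_cast [Real.log_pow] at h3
  linarith

/-- Extending the product to all integers from 2 up to a bound can only decrease it, and then it
telescopes. This converts an upper bound for ∏ (1 + 1/p) into a lower bound for ∏ (1 - 1/p). -/
theorem half_le_prod_one_sub_inv_sq (s : Finset ℕ) (hs : ∀ p ∈ s, 2 ≤ p) :
    (1 : ℝ) / 2 ≤ ∏ p ∈ s, (1 - ((p : ℝ)⁻¹) ^ 2) := by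
  have hle : ∀ n : ℕ, ∏ m ∈ Finset.Ico 2 (n + 2), (1 - (((m : ℕ) : ℝ)⁻¹) ^ 2)
      = ((n : ℝ) + 2) / (2 * ((n : ℝ) + 1)) := by
    intro n
    induction n with
    | zero => simp
    | succ n ih =>
      rw [Finset.prod_Ico_succ_top (by omega), ih]
      push_cast
      field_simp
      ring
  obtain ⟨n, hn⟩ := s.exists_nat_subset_range
  have hsub : s ⊆ Finset.Ico 2 (n + 2) := fun p hp => by
    have := Finset.mem_range.mp (hn hp); have := hs p hp; simp; omega
  calc (1 : ℝ) / 2 ≤ (n + 2) / (2 * (n + 1)) := by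
        rw [div_le_div_iff₀ (by norm_num) (by positivity)]; linarith
    _ = ∏ m ∈ Finset.Ico 2 (n + 2), (1 - ((m : ℝ)⁻¹) ^ 2) := (hle n).symm
    _ ≤ _ := by
      have hm : ∀ m ∈ Finset.Ico 2 (n + 2), ((m : ℝ)⁻¹) ^ 2 ≤ 1 := by
        intro m hm
        have h2 := (Finset.mem_Ico.mp hm).1
        have : (2 : ℝ) ≤ m := by exact_mod_cast h2
        exact pow_le_one₀ (by positivity) (inv_le_one_of_one_le₀ (by linarith))
      rw [← Finset.prod_sdiff hsub]
      refine mul_le_of_le_one_left (Finset.prod_nonneg fun m h => ?_)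
        (Finset.prod_le_one (fun m h => ?_) fun m h => ?_)
      · linarith [hm m (hsub h)]
      · linarith [hm m (Finset.mem_sdiff.mp h).1]
      · have : 0 ≤ ((m : ℝ)⁻¹) ^ 2 := by positivity
        linarith

theorem mertens_lower (n : ℕ) (hn : 2 ≤ n) :
    1 / (40 * Real.log n) ≤ ∏ p ∈ Nat.primesLE n, (1 - (p : ℝ)⁻¹) := by
  have h1 := prod_one_add_inv_primesLE_le n hn
  have h2 := half_le_prod_one_sub_inv_sq (Nat.primesLE n) fun p hp =>
    Nat.two_le_of_mem_primesLE hp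
  have hlog : 0 < Real.log n := Real.log_pos (by exact_mod_cast hn)
  have e : ∏ p ∈ Nat.primesLE n, (1 - ((p : ℝ)⁻¹) ^ 2)
      = (∏ p ∈ Nat.primesLE n, (1 - (p : ℝ)⁻¹)) * ∏ p ∈ Nat.primesLE n, (1 + (p : ℝ)⁻¹) := by
    rw [← Finset.prod_mul_distrib]; exact Finset.prod_congr rfl fun p _ => by ring
  have h0 : 0 ≤ ∏ p ∈ Nat.primesLE n, (1 - (p : ℝ)⁻¹) := Finset.prod_nonneg fun p hp => by
    have : (p : ℝ)⁻¹ ≤ 1 := inv_le_one_of_one_le₀ (by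
      exact_mod_cast (Nat.prime_of_mem_primesLE hp).one_le)
    linarith
  rw [e] at h2
  rw [div_le_iff₀ (by positivity)]
  nlinarith [mul_le_mul_of_nonneg_left h1 h0]

/-- The Euler product of the 1/(1 - 1/p) sums 1/m over all m without prime factors above n, and 1,
…, n are among these m. -/
theorem mertens_upper (n : ℕ) (hn : 2 ≤ n) :
    ∏ p ∈ Nat.primesLE n, (1 - (p : ℝ)⁻¹) ≤ 1 / Real.log n := by
  let f : ℕ →* ℝ :=
    { toFun := fun n => (n : ℝ)⁻¹
      map_one' := by simp
      map_mul' := fun a b => by push_cast; rw [mul_inv] }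
  have hf : ∀ {p : ℕ}, p.Prime → ‖f p‖ < 1 := by
    intro p hp
    change ‖(p : ℝ)⁻¹‖ < 1
    rw [norm_inv, Real.norm_natCast]
    exact inv_lt_one_of_one_lt₀ (by exact_mod_cast hp.one_lt)
  obtain ⟨-, hs⟩ :=
    EulerProduct.summable_and_hasSum_smoothNumbers_prod_primesBelow_geometric hf (n + 1)
  have hle : ∑ m ∈ Finset.Icc 1 n, (m : ℝ)⁻¹ ≤ ∏ p ∈ (n + 1).primesBelow, (1 - f p)⁻¹ := by
    have hmem : ∀ m ∈ Finset.Icc 1 n, m ∈ (n + 1).smoothNumbers := fun m hm => by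
      rw [Finset.mem_Icc] at hm
      exact Nat.mem_smoothNumbers_of_lt hm.1 (by omega)
    rw [← Finset.sum_subtype_of_mem (fun m : ℕ => (m : ℝ)⁻¹) hmem]
    exact sum_le_hasSum _ (fun m _ => by change 0 ≤ ((m : ℕ) : ℝ)⁻¹; positivity) hs
  have hl : Real.log n ≤ ∏ p ∈ (n + 1).primesBelow, (1 - f p)⁻¹ :=
    (Real.log_le_log (by positivity) (by linarith)).trans ((log_le_sum_inv_Icc n).trans hle)
  have hlog : 0 < Real.log n := Real.log_pos (by exact_mod_cast hn)
  rw [Finset.prod_inv_distrib] at hl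
  rw [le_one_div, one_div]
  · exact hl
  · exact Finset.prod_pos fun p hp => by
      have := hf (Nat.prime_of_mem_primesLE hp)
      change ‖(p : ℝ)⁻¹‖ < 1 at this
      rw [Real.norm_of_nonneg (by positivity)] at this
      linarith
  · exact hlog

/-! ### Selberg's sieve for one residue class per prime -/

open Finset in
-- By the Chinese remainder theorem the conditions amount to one class modulo ∏ p. The error is at
-- most 1 even when this modulus exceeds M.
theorem abs_card_residues_sub_le (s : Finset ℕ) (hs : ∀ p ∈ s, p.Prime) (x : ℕ → ℕ)
    (hx : ∀ p ∈ s, x p < p) (M : ℕ) :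
    |(#{m ∈ range M | ∀ p ∈ s, m % p = x p} : ℝ) - M * ∏ p ∈ s, (p : ℝ)⁻¹| ≤ 1 := by
  obtain ⟨v, hv⟩ := Nat.chineseRemainderOfFinset x (fun p => p) s
    (fun p hp => (hs p hp).ne_zero) (fun a ha b hb hab => by
      exact (Nat.coprime_primes (hs a ha) (hs b hb)).mpr hab)
  set d := ∏ p ∈ s, p with hd
  have hd0 : 0 < d := Finset.prod_pos fun p hp => (hs p hp).pos
  have hiff : ∀ m, (∀ p ∈ s, m % p = x p) ↔ m ≡ v [MOD d] := by
    intro m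
    have h1 : ∀ p ∈ s, (m % p = x p ↔ m ≡ v [MOD p]) := by
      intro p hp
      have := hv p hp
      unfold Nat.ModEq at this ⊢
      rw [this, Nat.mod_eq_of_lt (hx p hp)]
    constructor
    · intro h
      rw [Nat.modEq_iff_dvd, hd, Nat.cast_prod]
      refine Finset.prod_dvd_of_coprime ?_ fun p hp => ?_
      · intro a ha b hb hab
        exact Nat.isCoprime_iff_coprime.mpr ((Nat.coprime_primes (hs a ha) (hs b hb)).mpr hab)
      · exact Nat.modEq_iff_dvd.mp ((h1 p hp).mp (h p hp))
    · intro h p hp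
      exact (h1 p hp).mpr (h.of_dvd (Finset.dvd_prod_of_mem _ hp))
  have hcard : #{m ∈ range M | ∀ p ∈ s, m % p = x p} = M.count (· ≡ v [MOD d]) := by
    rw [Nat.count_eq_card_filter_range]
    exact congrArg card (filter_congr fun m _ => hiff m)
  rw [hcard, Nat.count_modEq_card M hd0]
  have hinv : ∏ p ∈ s, (p : ℝ)⁻¹ = (d : ℝ)⁻¹ := by rw [hd, Nat.cast_prod, Finset.prod_inv_distrib]
  rw [hinv, ← div_eq_mul_inv]
  have hf1 : ((M / d : ℕ) : ℝ) ≤ (M : ℝ) / d := Nat.cast_div_le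
  have hf2 : (M : ℝ) / d ≤ (M / d : ℕ) + 1 := by
    have := Nat.lt_floor_add_one ((M : ℝ) / d)
    rw [Nat.floor_div_eq_div] at this
    exact this.le
  have hdR : (0 : ℝ) < d := by exact_mod_cast hd0
  rw [abs_le]
  split_ifs with h
  · push_cast; constructor <;> linarith
  · push_cast; constructor <;> linarith

open Finset in
/-- Averages over an interval of products of local functions `α p + β p 1_{m ≡ x p}`. -/
theorem abs_sum_prod_local_sub_le (s : Finset ℕ) (hs : ∀ p ∈ s, p.Prime) (x : ℕ → ℕ)
    (hx : ∀ p ∈ s, x p < p) (M : ℕ) (α β : ℕ → ℝ) :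
    |∑ m ∈ range M, ∏ p ∈ s, (α p + β p * (if m % p = x p then 1 else 0))
        - M * ∏ p ∈ s, (α p + β p * (p : ℝ)⁻¹)|
      ≤ ∏ p ∈ s, (|α p| + |β p|) := by
  have h1 : ∀ m, ∏ p ∈ s, (α p + β p * (if m % p = x p then 1 else 0))
      = ∑ t ∈ s.powerset, ((∏ p ∈ t, β p) * ∏ p ∈ s \ t, α p) *
          (if ∀ p ∈ t, m % p = x p then 1 else 0) := by
    intro m
    simp_rw [add_comm (α _)]
    rw [Finset.prod_add]
    refine Finset.sum_congr rfl fun t _ => ?_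
    rw [Finset.prod_mul_distrib, Finset.prod_ite_zero]
    simp only [Finset.prod_const_one]
    ring
  have h2 : ∏ p ∈ s, (α p + β p * (p : ℝ)⁻¹)
      = ∑ t ∈ s.powerset, ((∏ p ∈ t, β p) * ∏ p ∈ s \ t, α p) * ∏ p ∈ t, (p : ℝ)⁻¹ := by
    simp_rw [add_comm (α _)]
    rw [Finset.prod_add]
    refine Finset.sum_congr rfl fun t _ => ?_
    rw [Finset.prod_mul_distrib]
    ring
  -- Each subset t contributes a counting error of at most 1, so the total error is the sum of the
  -- absolute coefficients, which is this product.
  have h3 : ∏ p ∈ s, (|α p| + |β p|)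
      = ∑ t ∈ s.powerset, |(∏ p ∈ t, β p) * ∏ p ∈ s \ t, α p| := by
    simp_rw [add_comm (|α _|)]
    rw [Finset.prod_add]
    refine Finset.sum_congr rfl fun t _ => ?_
    rw [abs_mul, Finset.abs_prod, Finset.abs_prod]
  simp_rw [h1]
  rw [Finset.sum_comm, h2, h3, Finset.mul_sum, ← Finset.sum_sub_distrib]
  refine (Finset.abs_sum_le_sum_abs _ _).trans (Finset.sum_le_sum fun t ht => ?_)
  have hts := Finset.mem_powerset.mp ht
  rw [← Finset.mul_sum, Finset.sum_boole]
  have := abs_card_residues_sub_le t (fun p hp => hs p (hts hp)) x (fun p hp => hx p (hts hp)) M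
  calc _ = |(∏ p ∈ t, β p) * ∏ p ∈ s \ t, α p| *
        |(#{m ∈ range M | ∀ p ∈ t, m % p = x p} : ℝ) - M * ∏ p ∈ t, (p : ℝ)⁻¹| := by
          rw [← abs_mul]; congr 1; ring
    _ ≤ _ := mul_le_of_le_one_right (abs_nonneg _) this

open Finset in
/-- The shifted analogue of the Ramanujan sum, to the squarefree modulus `∏ R`. -/
noncomputable def localRamanujan (x : ℕ → ℕ) (R : Finset ℕ) (m : ℕ) : ℝ :=
  ∏ p ∈ R, ((p : ℝ) * (if m % p = x p then 1 else 0) - 1)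

open Finset in
-- Approximate orthogonality: a prime in only one of the two sets gives a factor of mean zero, and a
-- prime in both gives a square of mean p - 1.
theorem abs_sum_localRamanujan_mul_sub_le (R R' : Finset ℕ) (hR : ∀ p ∈ R, p.Prime)
    (hR' : ∀ p ∈ R', p.Prime) (x : ℕ → ℕ) (hx : ∀ p ∈ R, x p < p) (hx' : ∀ p ∈ R', x p < p)
    (M : ℕ) :
    |∑ m ∈ range M, localRamanujan x R m * localRamanujan x R' m
        - M * (if R = R' then ∏ p ∈ R, ((p : ℝ) - 1) else 0)|
      ≤ (∏ p ∈ R, ((p : ℝ) + 1)) * ∏ p ∈ R', ((p : ℝ) + 1) := by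
  have hU : ∀ p ∈ R ∪ R', p.Prime := fun p hp =>
    (Finset.mem_union.mp hp).elim (hR p) (hR' p)
  have hxU : ∀ p ∈ R ∪ R', x p < p := fun p hp =>
    (Finset.mem_union.mp hp).elim (hx p) (hx' p)
  have ext1 : ∀ f : ℕ → ℝ, ∏ p ∈ R, f p = ∏ p ∈ R ∪ R', if p ∈ R then f p else 1 := by
    intro f
    rw [← Finset.prod_filter]
    refine Finset.prod_congr ?_ fun _ _ => rfl
    ext p; simp only [mem_filter, mem_union]; tauto
  have ext2 : ∀ f : ℕ → ℝ, ∏ p ∈ R', f p = ∏ p ∈ R ∪ R', if p ∈ R' then f p else 1 := by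
    intro f
    rw [← Finset.prod_filter]
    refine Finset.prod_congr ?_ fun _ _ => rfl
    ext p; simp only [mem_filter, mem_union]; tauto
  -- For an indicator e, (p e - 1)² = 1 + (p² - 2p) e, so squares are again of the form α + β e.
  let α : ℕ → ℝ := fun p => if p ∈ R ∧ p ∈ R' then 1 else -1
  let β : ℕ → ℝ := fun p => if p ∈ R ∧ p ∈ R' then (p : ℝ) ^ 2 - 2 * p else p
  have hmain := abs_sum_prod_local_sub_le (R ∪ R') hU x hxU M α β
  have e1 : ∀ m, localRamanujan x R m * localRamanujan x R' m
      = ∏ p ∈ R ∪ R', (α p + β p * (if m % p = x p then 1 else 0)) := by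
    intro m
    unfold localRamanujan
    rw [ext1, ext2, ← Finset.prod_mul_distrib]
    refine Finset.prod_congr rfl fun p hp => ?_
    simp only [α, β]
    by_cases h3 : m % p = x p <;> by_cases h1 : p ∈ R <;> by_cases h2 : p ∈ R' <;>
      simp only [h1, h2, h3, and_self, and_true, and_false, if_true, if_false] <;>
      first
        | exact ((Finset.mem_union.mp hp).elim h1 h2).elim
        | ring
  have e2 : (if R = R' then ∏ p ∈ R, ((p : ℝ) - 1) else 0)
      = ∏ p ∈ R ∪ R', (α p + β p * (p : ℝ)⁻¹) := by
    split_ifs with h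
    · subst h
      rw [Finset.union_self]
      refine Finset.prod_congr rfl fun p hp => ?_
      have : (p : ℝ) ≠ 0 := by exact_mod_cast (hR p hp).ne_zero
      simp only [α, β, hp, and_self, if_true]
      field_simp
      ring
    · symm
      have : ∃ p ∈ R ∪ R', ¬ (p ∈ R ∧ p ∈ R') := by
        by_contra! hc
        apply h
        ext p
        constructor
        · exact fun hp => (hc p (mem_union_left _ hp)).2
        · exact fun hp => (hc p (mem_union_right _ hp)).1
      obtain ⟨p, hp, hn⟩ := this
      refine Finset.prod_eq_zero hp ?_
      have : (p : ℝ) ≠ 0 := by exact_mod_cast (hU p hp).ne_zero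
      simp only [α, β, hn, if_false]
      field_simp
      ring
  simp_rw [e1]
  rw [e2]
  refine hmain.trans ?_
  rw [ext1, ext2, ← Finset.prod_mul_distrib]
  refine Finset.prod_le_prod (fun p _ => by positivity) fun p hp => ?_
  have h2 : (2 : ℝ) ≤ p := by exact_mod_cast (hU p hp).two_le
  have hp' := Finset.mem_union.mp hp
  simp only [α, β]
  by_cases h1 : p ∈ R <;> by_cases h2' : p ∈ R' <;> simp only [h1, h2', and_self, and_true,
    and_false, if_true, if_false]
  · rw [abs_of_nonneg (by nlinarith : (0 : ℝ) ≤ (p : ℝ) ^ 2 - 2 * p)]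
    norm_num; nlinarith
  · rw [abs_of_nonneg (by linarith : (0 : ℝ) ≤ p)]; norm_num; linarith
  · rw [abs_of_nonneg (by linarith : (0 : ℝ) ≤ p)]; norm_num; linarith
  · tauto

open Finset in
/-- Selberg's upper bound sieve for one residue class per prime. -/
theorem selberg_sieve (s : Finset ℕ) (hs : ∀ p ∈ s, p.Prime) (x : ℕ → ℕ)
    (hx : ∀ p ∈ s, x p < p) (M z : ℕ) (S : ℝ)
    (hS : S = ∑ R ∈ s.powerset with ∏ p ∈ R, p ≤ z, ∏ p ∈ R, ((p : ℝ) - 1)⁻¹) :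
    (#{m ∈ range M | ∀ p ∈ s, m % p ≠ x p} : ℝ) * S ^ 2 ≤ M * S + (z : ℝ) ^ 6 := by
  set 𝓡 := s.powerset.filter (fun R => ∏ p ∈ R, p ≤ z) with h𝓡
  have hsub : ∀ R ∈ 𝓡, R ⊆ s := fun R hR => mem_powerset.mp (mem_filter.mp hR).1
  have hpr : ∀ R ∈ 𝓡, ∀ p ∈ R, p.Prime := fun R hR p hp => hs p (hsub R hR hp)
  have hxr : ∀ R ∈ 𝓡, ∀ p ∈ R, x p < p := fun R hR p hp => hx p (hsub R hR hp)
  have hp1 : ∀ R ∈ 𝓡, ∀ p ∈ R, (0 : ℝ) < (p : ℝ) - 1 := fun R hR p hp => by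
    have : (2 : ℝ) ≤ p := by exact_mod_cast (hpr R hR p hp).two_le
    linarith
  -- With these coefficients each local factor is 1/(p - 1) where m avoids x p. So `F` equals S on
  -- the sifted set, and the diagonal of its second moment is M S.
  let a : Finset ℕ → ℝ := fun R => ∏ p ∈ R, (-((p : ℝ) - 1)⁻¹)
  let E : Finset ℕ → ℝ := fun R => ∏ p ∈ R, ((p : ℝ) + 1)
  let F : ℕ → ℝ := fun m => ∑ R ∈ 𝓡, a R * localRamanujan x R m
  have hF : ∀ m, (∀ p ∈ s, m % p ≠ x p) → F m = S := by
    intro m hm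
    rw [hS]
    refine Finset.sum_congr rfl fun R hR => ?_
    simp only [a, localRamanujan]
    rw [← Finset.prod_mul_distrib]
    refine Finset.prod_congr rfl fun p hp => ?_
    rw [if_neg (hm p (hsub R hR hp))]
    ring
  have hlow : (#{m ∈ range M | ∀ p ∈ s, m % p ≠ x p} : ℝ) * S ^ 2 ≤ ∑ m ∈ range M, F m ^ 2 := by
    calc _ = ∑ m ∈ range M with ∀ p ∈ s, m % p ≠ x p, F m ^ 2 := by
          rw [← nsmul_eq_mul, ← Finset.sum_const]
          exact Finset.sum_congr rfl fun m hm => by rw [hF m (mem_filter.mp hm).2]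
      _ ≤ _ := Finset.sum_le_sum_of_subset_of_nonneg (filter_subset _ _)
          fun _ _ _ => sq_nonneg _
  have hexp : ∑ m ∈ range M, F m ^ 2 = ∑ R ∈ 𝓡, ∑ R' ∈ 𝓡, a R * a R' *
      ∑ m ∈ range M, localRamanujan x R m * localRamanujan x R' m := by
    simp only [F, sq, Finset.sum_mul_sum]
    rw [Finset.sum_comm]
    refine Finset.sum_congr rfl fun R _ => ?_
    rw [Finset.sum_comm]
    refine Finset.sum_congr rfl fun R' _ => ?_
    rw [Finset.mul_sum]
    exact Finset.sum_congr rfl fun m _ => by ring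
  have hdiag : ∑ R ∈ 𝓡, ∑ R' ∈ 𝓡, a R * a R' *
      (M * (if R = R' then ∏ p ∈ R, ((p : ℝ) - 1) else 0)) = M * S := by
    rw [hS, Finset.mul_sum]
    refine Finset.sum_congr rfl fun R hR => ?_
    rw [Finset.sum_eq_single R]
    · simp only [if_true, a]
      have : (∏ p ∈ R, (-((p : ℝ) - 1)⁻¹)) * (∏ p ∈ R, (-((p : ℝ) - 1)⁻¹)) *
          ∏ p ∈ R, ((p : ℝ) - 1) = ∏ p ∈ R, ((p : ℝ) - 1)⁻¹ := by
        rw [← Finset.prod_mul_distrib, ← Finset.prod_mul_distrib]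
        refine Finset.prod_congr rfl fun p hp => ?_
        have := (hp1 R hR p hp).ne'
        field_simp
      rw [← this]; ring
    · intro R' _ hne
      rw [if_neg (Ne.symm hne)]; ring
    · exact fun h => absurd hR h
  have hcard : (#𝓡 : ℝ) ≤ z := by
    have : #𝓡 ≤ #(Icc 1 z) := by
      refine Finset.card_le_card_of_injOn (fun R => ∏ p ∈ R, p) ?_ ?_
      · intro R hR
        have hR' : R ∈ 𝓡 := hR
        simp only [coe_Icc, Set.mem_Icc]
        exact ⟨Finset.prod_pos fun p hp => (hpr R hR' p hp).pos, (mem_filter.mp hR').2⟩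
      · exact (prod_primes_injOn s hs).mono fun R hR => (mem_filter.mp hR).1
    rw [Nat.card_Icc] at this
    exact_mod_cast this
  -- A crude bound suffices: (p + 1)/(p - 1) ≤ p² for p ≥ 2, and there are at most z sets R.
  -- Squaring produces the error z^6.
  have hE : ∑ R ∈ 𝓡, |a R| * E R ≤ (z : ℝ) ^ 3 := by
    calc ∑ R ∈ 𝓡, |a R| * E R ≤ ∑ R ∈ 𝓡, (z : ℝ) ^ 2 := by
          refine Finset.sum_le_sum fun R hR => ?_
          calc |a R| * E R = ∏ p ∈ R, (((p : ℝ) - 1)⁻¹ * ((p : ℝ) + 1)) := by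
                simp only [a, E]
                rw [Finset.abs_prod, Finset.prod_mul_distrib]
                congr 1
                refine Finset.prod_congr rfl fun p hp => ?_
                rw [abs_neg, abs_of_pos (inv_pos.mpr (hp1 R hR p hp))]
            _ ≤ ∏ p ∈ R, (p : ℝ) ^ 2 := by
                refine Finset.prod_le_prod (fun p hp => ?_) fun p hp => ?_
                · have := hp1 R hR p hp; positivity
                · have h1 := hp1 R hR p hp
                  have h2 : (2 : ℝ) ≤ p := by exact_mod_cast (hpr R hR p hp).two_le
                  rw [inv_mul_le_iff₀ h1]
                  nlinarith [mul_nonneg (sub_nonneg.mpr h2) (sub_nonneg.mpr h2)]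
            _ = ((∏ p ∈ R, p : ℕ) : ℝ) ^ 2 := by rw [Finset.prod_pow, Nat.cast_prod]
            _ ≤ (z : ℝ) ^ 2 := by
                gcongr
                exact (mem_filter.mp hR).2
      _ = #𝓡 * (z : ℝ) ^ 2 := by rw [Finset.sum_const, nsmul_eq_mul]
      _ ≤ z * (z : ℝ) ^ 2 := by gcongr
      _ = _ := by ring
  have hE0 : 0 ≤ ∑ R ∈ 𝓡, |a R| * E R := Finset.sum_nonneg fun R _ =>
    mul_nonneg (abs_nonneg _) (Finset.prod_nonneg fun p _ => by positivity)
  have hup : ∑ m ∈ range M, F m ^ 2 ≤ M * S + (∑ R ∈ 𝓡, |a R| * E R) ^ 2 := by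
    rw [hexp, ← hdiag, sq, Finset.sum_mul_sum, ← Finset.sum_add_distrib]
    refine Finset.sum_le_sum fun R hR => ?_
    rw [← Finset.sum_add_distrib]
    refine Finset.sum_le_sum fun R' hR' => ?_
    have h := abs_sum_localRamanujan_mul_sub_le R R' (hpr R hR) (hpr R' hR') x (hxr R hR)
      (hxr R' hR') M
    have h' : a R * a R' * (∑ m ∈ range M, localRamanujan x R m * localRamanujan x R' m
        - M * (if R = R' then ∏ p ∈ R, ((p : ℝ) - 1) else 0)) ≤ |a R| * |a R'| * (E R * E R') := by
      refine (le_abs_self _).trans ?_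
      rw [abs_mul, abs_mul]
      gcongr
    linarith
  calc _ ≤ M * S + (∑ R ∈ 𝓡, |a R| * E R) ^ 2 := hlow.trans hup
    _ ≤ M * S + ((z : ℝ) ^ 3) ^ 2 := by gcongr
    _ = _ := by ring

open Finset in
-- The sieve is run at z = y^6, so its error y^36 is at most M S and the sifted set has at most 2M/S
-- elements. Markov's inequality shows that truncation at z keeps S at least half of ∏ (1 - 1/p)⁻¹.
theorem card_sifted_le_of_primesLE (s : Finset ℕ) (y M : ℕ) (hy : 2 ≤ y) (hs : s ⊆ Nat.primesLE y)
    (hM : y ^ 36 ≤ M) (x : ℕ → ℕ) (hx : ∀ p ∈ s, x p < p) :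
    (#{m ∈ range M | ∀ p ∈ s, m % p ≠ x p} : ℝ) ≤ 4 * (M * ∏ p ∈ s, (1 - (p : ℝ)⁻¹)) := by
  have hpr : ∀ p ∈ s, p.Prime := fun p hp => Nat.prime_of_mem_primesLE (hs hp)
  have hy' : (2 : ℝ) ≤ y := by exact_mod_cast hy
  have hp2 : ∀ p ∈ s, (2 : ℝ) ≤ p := fun p hp => by exact_mod_cast (hpr p hp).two_le
  have hlog2 : Real.log 2 ≤ Real.log y := Real.log_le_log (by norm_num) hy'
  have hl2 : 0 < Real.log 2 := Real.log_pos (by norm_num)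
  have hl4 : Real.log 4 = 2 * Real.log 2 := by
    rw [show (4 : ℝ) = 2 ^ 2 by norm_num, Real.log_pow]; norm_num
  obtain ⟨S, hS⟩ : ∃ S : ℝ, S = ∑ R ∈ s.powerset with ∏ p ∈ R, p ≤ y ^ 6,
    ∏ p ∈ R, ((p : ℝ) - 1)⁻¹ := ⟨_, rfl⟩
  have hsieve := selberg_sieve s hpr x hx M (y ^ 6) S hS
  have hmark := half_prod_le_sum_powerset_filter s (fun p => Real.log p)
    (fun p => ((p : ℝ) - 1)⁻¹) (fun p hp => by
      have := hp2 p hp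
      exact inv_nonneg.mpr (by linarith)) (fun p _ => Real.log_natCast_nonneg p)
    (T := 6 * Real.log y) (by linarith) (by
      calc ∑ p ∈ s, Real.log p * ((p : ℝ) - 1)⁻¹ / (1 + ((p : ℝ) - 1)⁻¹)
          = ∑ p ∈ s, Real.log p / p := by
            refine Finset.sum_congr rfl fun p hp => ?_
            have h2 := hp2 p hp
            have h1 : (p : ℝ) - 1 ≠ 0 := by linarith
            have h0 : (p : ℝ) ≠ 0 := by linarith
            have : 1 + ((p : ℝ) - 1)⁻¹ = p * ((p : ℝ) - 1)⁻¹ := by field_simp; ring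
            rw [this]
            field_simp
        _ ≤ ∑ p ∈ Nat.primesLE y, Real.log p / p :=
            Finset.sum_le_sum_of_subset_of_nonneg hs fun p _ _ =>
              div_nonneg (Real.log_natCast_nonneg p) (by positivity)
        _ ≤ Real.log y + Real.log 4 := sum_log_div_primesLE_le y (by omega)
        _ ≤ _ := by linarith)
  have hfil : (s.powerset.filter fun R => ∑ p ∈ R, Real.log (p : ℕ) ≤ 6 * Real.log y)
      = s.powerset.filter fun R => ∏ p ∈ R, p ≤ y ^ 6 := by
    refine Finset.filter_congr fun R hR => ?_
    have hRp : ∀ p ∈ R, p.Prime := fun p hp => hpr p (mem_powerset.mp hR hp)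
    have hpos : 0 < ∏ p ∈ R, p := Finset.prod_pos fun p hp => (hRp p hp).pos
    rw [← log_prod_primes hRp,
      show 6 * Real.log y = Real.log ((y ^ 6 : ℕ) : ℝ) by push_cast [Real.log_pow]; ring,
      Real.log_le_log_iff (by exact_mod_cast hpos) (by positivity)]
    exact Nat.cast_le
  rw [hfil, ← hS] at hmark
  have hprod : ∏ p ∈ s, (1 + ((p : ℝ) - 1)⁻¹) = (∏ p ∈ s, (1 - (p : ℝ)⁻¹))⁻¹ := by
    rw [← Finset.prod_inv_distrib]
    refine Finset.prod_congr rfl fun p hp => ?_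
    have h2 := hp2 p hp
    have h1 : (p : ℝ) - 1 ≠ 0 := by linarith
    have h0 : (p : ℝ) ≠ 0 := by linarith
    have : 1 - (p : ℝ)⁻¹ = (p - 1) / p := by field_simp
    rw [this, inv_div]
    field_simp
    ring
  have hρ : 0 < ∏ p ∈ s, (1 - (p : ℝ)⁻¹) := Finset.prod_pos fun p hp => by
    have : (p : ℝ)⁻¹ < 1 := inv_lt_one_of_one_lt₀ (by linarith [hp2 p hp])
    linarith
  set ρ := ∏ p ∈ s, (1 - (p : ℝ)⁻¹) with hρdef
  rw [hprod] at hmark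
  have hS1 : 1 ≤ S := by
    rw [hS]
    have : (∅ : Finset ℕ) ∈ s.powerset.filter fun R => ∏ p ∈ R, p ≤ y ^ 6 := by
      simp only [mem_filter, empty_mem_powerset, prod_empty, true_and]
      exact Nat.one_le_pow _ _ (by omega)
    calc (1 : ℝ) = ∏ p ∈ (∅ : Finset ℕ), ((p : ℝ) - 1)⁻¹ := by simp
      _ ≤ _ := Finset.single_le_sum (f := fun R : Finset ℕ => ∏ p ∈ R, ((p : ℝ) - 1)⁻¹)
        (fun R hR => Finset.prod_nonneg fun p hp => by
          have := hp2 p (mem_powerset.mp (mem_filter.mp hR).1 hp)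
          exact inv_nonneg.mpr (by linarith)) this
  have hM' : ((y ^ 6 : ℕ) : ℝ) ^ 6 ≤ M := by
    have : (y ^ 6) ^ 6 ≤ M := by rw [← pow_mul]; exact hM
    exact_mod_cast this
  set X := (#{m ∈ range M | ∀ p ∈ s, m % p ≠ x p} : ℝ)
  have hX0 : 0 ≤ X := Nat.cast_nonneg _
  have hM0 : (0 : ℝ) ≤ M := Nat.cast_nonneg _
  have h1 : X * S ^ 2 ≤ 2 * M * S := by nlinarith
  have h2 : X * S ≤ 2 * M := by
    refine le_of_mul_le_mul_right (a := S) ?_ (by linarith)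
    nlinarith
  have h3 : X * (ρ⁻¹ / 2) ≤ 2 * M := (mul_le_mul_of_nonneg_left hmark hX0).trans h2
  have h4 : X * (ρ⁻¹ / 2) * (2 * ρ) ≤ 2 * M * (2 * ρ) := by gcongr
  have h5 : X * (ρ⁻¹ / 2) * (2 * ρ) = X := by field_simp
  rw [h5] at h4
  linarith

open Finset in
-- The interval may be too short to be sifted by all primes up to y. The primes above y₀ are
-- ignored, and Mertens' bounds limit the loss in density to a factor 40 log y / log y₀.
theorem card_sifted_le (s : Finset ℕ) (y₀ y M : ℕ) (hy₀ : 2 ≤ y₀) (hy : y₀ ≤ y)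
    (hs : s ⊆ Nat.primesLE y) (hM : y₀ ^ 36 ≤ M) (x : ℕ → ℕ) (hx : ∀ p ∈ s, x p < p) :
    (#{m ∈ range M | ∀ p ∈ s, m % p ≠ x p} : ℝ)
      ≤ 160 * (Real.log y / Real.log y₀) * (M * ∏ p ∈ s, (1 - (p : ℝ)⁻¹)) := by
  have hpr : ∀ p ∈ s, p.Prime := fun p hp => Nat.prime_of_mem_primesLE (hs hp)
  set s₀ := s.filter (· ≤ y₀) with hs₀
  have hsub : s₀ ⊆ s := filter_subset _ _
  have hs₀' : s₀ ⊆ Nat.primesLE y₀ := fun p hp =>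
    Nat.mem_primesLE.mpr ⟨(mem_filter.mp hp).2, hpr p (hsub hp)⟩
  have h1 := card_sifted_le_of_primesLE s₀ y₀ M hy₀ hs₀' hM x fun p hp => hx p (hsub hp)
  have h2 : (#{m ∈ range M | ∀ p ∈ s, m % p ≠ x p} : ℝ)
      ≤ #{m ∈ range M | ∀ p ∈ s₀, m % p ≠ x p} := by
    refine Nat.cast_le.mpr (card_le_card ?_)
    exact monotone_filter_right _ fun m _ hm p hp => hm p (hsub hp)
  have hfac : ∀ p : ℕ, p.Prime → 0 < 1 - (p : ℝ)⁻¹ ∧ 1 - (p : ℝ)⁻¹ ≤ 1 := by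
    intro p hp
    have : (p : ℝ)⁻¹ < 1 := inv_lt_one_of_one_lt₀ (by exact_mod_cast hp.one_lt)
    have h0 : 0 ≤ (p : ℝ)⁻¹ := by positivity
    constructor <;> linarith
  have hl0 : 0 < Real.log y₀ := Real.log_pos (by exact_mod_cast hy₀)
  have hl : 0 < Real.log y := Real.log_pos (by exact_mod_cast (by omega : 1 < y))
  have hA := mertens_lower y (by omega)
  have hB := mertens_upper y₀ hy₀
  have hpsub : Nat.primesLE y₀ ⊆ Nat.primesLE y := Nat.primesLE_mono hy
  rw [← Finset.prod_sdiff hpsub] at hA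
  have hP0 : 0 < ∏ p ∈ Nat.primesLE y \ Nat.primesLE y₀, (1 - (p : ℝ)⁻¹) :=
    Finset.prod_pos fun p hp => (hfac p (Nat.prime_of_mem_primesLE (mem_sdiff.mp hp).1)).1
  have hratio : 1 ≤ 40 * (Real.log y / Real.log y₀) *
      ∏ p ∈ Nat.primesLE y \ Nat.primesLE y₀, (1 - (p : ℝ)⁻¹) := by
    have := hA.trans (mul_le_mul_of_nonneg_left hB hP0.le)
    rw [mul_one_div, div_le_div_iff₀ (by positivity) hl0] at this
    rw [mul_div_assoc', div_mul_eq_mul_div, le_div_iff₀ hl0]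
    linarith
  have hdiff : ∏ p ∈ Nat.primesLE y \ Nat.primesLE y₀, (1 - (p : ℝ)⁻¹)
      ≤ ∏ p ∈ s \ s₀, (1 - (p : ℝ)⁻¹) := by
    have hss : s \ s₀ ⊆ Nat.primesLE y \ Nat.primesLE y₀ := by
      intro p hp
      rw [mem_sdiff] at hp ⊢
      refine ⟨hs hp.1, fun h => hp.2 (mem_filter.mpr ⟨hp.1, Nat.le_of_mem_primesLE h⟩)⟩
    rw [← Finset.prod_sdiff hss]
    refine mul_le_of_le_one_left (Finset.prod_nonneg fun p hp => ?_)
      (Finset.prod_le_one (fun p hp => ?_) fun p hp => ?_)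
    · exact (hfac p (hpr p (mem_sdiff.mp hp).1)).1.le
    · exact (hfac p (Nat.prime_of_mem_primesLE (mem_sdiff.mp (mem_sdiff.mp hp).1).1)).1.le
    · exact (hfac p (Nat.prime_of_mem_primesLE (mem_sdiff.mp (mem_sdiff.mp hp).1).1)).2
  have hρ0 : 0 ≤ (M : ℝ) * ∏ p ∈ s₀, (1 - (p : ℝ)⁻¹) :=
    mul_nonneg (Nat.cast_nonneg _) (Finset.prod_nonneg fun p hp => (hfac p (hpr p (hsub hp))).1.le)
  have hge : 1 ≤ 40 * (Real.log y / Real.log y₀) * ∏ p ∈ s \ s₀, (1 - (p : ℝ)⁻¹) :=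
    hratio.trans (mul_le_mul_of_nonneg_left hdiff (by positivity))
  rw [← Finset.prod_sdiff hsub]
  calc _ ≤ 4 * (M * ∏ p ∈ s₀, (1 - (p : ℝ)⁻¹)) := h2.trans h1
    _ ≤ (40 * (Real.log y / Real.log y₀) * ∏ p ∈ s \ s₀, (1 - (p : ℝ)⁻¹)) *
        (4 * (M * ∏ p ∈ s₀, (1 - (p : ℝ)⁻¹))) := le_mul_of_one_le_left (by positivity) hge
    _ = _ := by ring

/-! ### Moments of the size of a randomly sifted interval -/

/-- Averaged over a variable y of mean u, the linear term disappears and only the variance remains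
on the right. -/
theorem abs_pow_sub_tangent_le (i : ℕ) {y u B : ℝ} (hy : 0 ≤ y) (hyB : y ≤ B) (hu : 0 ≤ u)
    (huB : u ≤ B) :
    |y ^ (i + 2) - u ^ (i + 2) - (i + 2) * u ^ (i + 1) * (y - u)|
      ≤ (i + 2) ^ 2 * B ^ i * (y - u) ^ 2 := by
  induction i with
  | zero =>
    have : y ^ (0 + 2) - u ^ (0 + 2) - ((0 : ℕ) + 2) * u ^ (0 + 1) * (y - u) = (y - u) ^ 2 := by
      push_cast; ring
    rw [this, abs_of_nonneg (sq_nonneg _)]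
    norm_num
    nlinarith [sq_nonneg (y - u)]
  | succ i ih =>
    have hB : 0 ≤ B := hy.trans hyB
    have e : y ^ (i + 1 + 2) - u ^ (i + 1 + 2) - ((i + 1 : ℕ) + 2) * u ^ (i + 1 + 1) * (y - u)
        = y * (y ^ (i + 2) - u ^ (i + 2) - (i + 2) * u ^ (i + 1) * (y - u))
          + (i + 2) * u ^ (i + 1) * (y - u) ^ 2 := by
      push_cast; ring
    rw [e]
    calc _ ≤ |y * (y ^ (i + 2) - u ^ (i + 2) - (i + 2) * u ^ (i + 1) * (y - u))|
          + |(i + 2) * u ^ (i + 1) * (y - u) ^ 2| := abs_add_le _ _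
      _ = y * |y ^ (i + 2) - u ^ (i + 2) - (i + 2) * u ^ (i + 1) * (y - u)|
          + (i + 2) * u ^ (i + 1) * (y - u) ^ 2 := by
        rw [abs_mul y, abs_of_nonneg hy,
          abs_of_nonneg (by positivity : 0 ≤ ((i : ℝ) + 2) * u ^ (i + 1) * (y - u) ^ 2)]
      _ ≤ B * ((i + 2) ^ 2 * B ^ i * (y - u) ^ 2) + (i + 2) * B ^ (i + 1) * (y - u) ^ 2 := by
        gcongr
      _ = ((i + 2) ^ 2 + (i + 2)) * (B ^ (i + 1) * (y - u) ^ 2) := by ring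
      _ ≤ ((i + 1 : ℕ) + 2) ^ 2 * (B ^ (i + 1) * (y - u) ^ 2) := by
        gcongr
        push_cast
        nlinarith [(Nat.cast_nonneg i : (0 : ℝ) ≤ i)]
      _ = _ := by ring

theorem abs_descFactorial_sub_pow_le (n i : ℕ) :
    |(n.descFactorial (i + 1) : ℝ) - (n : ℝ) ^ (i + 1)| ≤ (i + 1) ^ 2 * (n : ℝ) ^ i := by
  induction i with
  | zero => simp
  | succ i ih =>
    have e : (n.descFactorial (i + 1 + 1) : ℝ) = (n - (i + 1)) * n.descFactorial (i + 1) := by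
      rw [Nat.descFactorial_succ, Nat.cast_mul]
      rcases Nat.lt_or_ge n (i + 1) with h | h
      · rw [Nat.descFactorial_of_lt h]; simp
      · rw [Nat.cast_sub h]; push_cast; ring
    have hle : (n.descFactorial (i + 1) : ℝ) ≤ (n : ℝ) ^ (i + 1) := by
      exact_mod_cast Nat.descFactorial_le_pow n (i + 1)
    rw [e]
    calc |((n : ℝ) - (i + 1)) * n.descFactorial (i + 1) - (n : ℝ) ^ (i + 1 + 1)|
        = |n * ((n.descFactorial (i + 1) : ℝ) - (n : ℝ) ^ (i + 1))
            - (i + 1) * n.descFactorial (i + 1)| := by congr 1; ring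
      _ ≤ |n * ((n.descFactorial (i + 1) : ℝ) - (n : ℝ) ^ (i + 1))|
            + |((i : ℝ) + 1) * n.descFactorial (i + 1)| := abs_sub _ _
      _ = n * |(n.descFactorial (i + 1) : ℝ) - (n : ℝ) ^ (i + 1)|
            + (i + 1) * n.descFactorial (i + 1) := by
          rw [abs_mul, abs_of_nonneg (by positivity : (0 : ℝ) ≤ n),
            abs_of_nonneg (by positivity : (0 : ℝ) ≤ ((i : ℝ) + 1) * n.descFactorial (i + 1))]
      _ ≤ n * ((i + 1) ^ 2 * (n : ℝ) ^ i) + (i + 1) * (n : ℝ) ^ (i + 1) := by gcongr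
      _ = ((i + 1) ^ 2 + (i + 1)) * (n : ℝ) ^ (i + 1) := by ring
      _ ≤ ((i + 1 : ℕ) + 1) ^ 2 * (n : ℝ) ^ (i + 1) := by
          gcongr
          push_cast
          nlinarith [(Nat.cast_nonneg i : (0 : ℝ) ≤ i)]

/-- The density of the integers `n` for which no `n + a`, `a ∈ A`, is divisible by a prime of
`s`. -/
noncomputable def sieveWeight (s A : Finset ℕ) : ℝ :=
  ∏ p ∈ s, (1 - (residueCount p A : ℝ) / p)

open Finset in
/-- The choices of one residue class for each element of `s`. -/
def residueChoices (s : Finset ℕ) : Finset (s → ℕ) :=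
  Fintype.piFinset fun p : s => range p

/-- The average over all choices of one residue class for each element of `s`. -/
noncomputable def residueAvg (s : Finset ℕ) (f : (s → ℕ) → ℝ) : ℝ :=
  (∏ p ∈ s, (p : ℝ)⁻¹) * ∑ ω ∈ residueChoices s, f ω

open Finset in
/-- The integers below `M` avoiding the chosen residue classes. -/
def sifted (s : Finset ℕ) (M : ℕ) (ω : s → ℕ) : Finset ℕ :=
  {m ∈ range M | ∀ p : s, m % p ≠ ω p}

theorem residueAvg_add (s : Finset ℕ) (f g : (s → ℕ) → ℝ) :
    residueAvg s (fun ω => f ω + g ω) = residueAvg s f + residueAvg s g := by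
  simp only [residueAvg, Finset.sum_add_distrib, mul_add]

theorem residueAvg_const_mul (s : Finset ℕ) (c : ℝ) (f : (s → ℕ) → ℝ) :
    residueAvg s (fun ω => c * f ω) = c * residueAvg s f := by
  simp only [residueAvg, ← Finset.mul_sum]; ring

theorem residueAvg_sum {ι : Type*} (s : Finset ℕ) (T : Finset ι) (f : ι → (s → ℕ) → ℝ) :
    residueAvg s (fun ω => ∑ t ∈ T, f t ω) = ∑ t ∈ T, residueAvg s (f t) := by
  simp only [residueAvg, ← Finset.mul_sum]
  rw [Finset.sum_comm]

theorem residueAvg_mono (s : Finset ℕ) {f g : (s → ℕ) → ℝ}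
    (h : ∀ ω ∈ residueChoices s, f ω ≤ g ω) : residueAvg s f ≤ residueAvg s g :=
  mul_le_mul_of_nonneg_left (Finset.sum_le_sum h) (Finset.prod_nonneg fun p _ => by positivity)

theorem abs_residueAvg_le (s : Finset ℕ) (f : (s → ℕ) → ℝ) :
    |residueAvg s f| ≤ residueAvg s fun ω => |f ω| := by
  unfold residueAvg
  rw [abs_mul, abs_of_nonneg (Finset.prod_nonneg fun p _ => by positivity)]
  exact mul_le_mul_of_nonneg_left (Finset.abs_sum_le_sum_abs _ _)
    (Finset.prod_nonneg fun p _ => by positivity)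

open Finset in
-- The choices at different primes are independent, and at p a random class misses A with
-- probability 1 - v_p(A)/p. This turns a sum of local densities into a moment of a random variable.
theorem residueAvg_indicator (s : Finset ℕ) (hs : ∀ p ∈ s, p.Prime) (A : Finset ℕ) :
    residueAvg s (fun ω => if ∀ m ∈ A, ∀ p : s, m % p ≠ ω p then 1 else 0) = sieveWeight s A := by
  have h1 : ∀ ω : s → ℕ, (if ∀ m ∈ A, ∀ p : s, m % p ≠ ω p then (1 : ℝ) else 0)
      = ∏ p : s, if ∀ m ∈ A, m % p ≠ ω p then 1 else 0 := by
    intro ω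
    rw [Finset.prod_ite_zero]
    simp only [Finset.prod_const_one, Finset.mem_univ, true_imp_iff]
    congr 1
    exact propext ⟨fun h p m hm => h m hm p, fun h m hm p => h p m hm⟩
  unfold residueAvg residueChoices sieveWeight
  simp_rw [h1]
  rw [← Finset.prod_univ_sum (fun p : s => range p)
    (fun (p : s) (b : ℕ) => if ∀ m ∈ A, m % p ≠ b then (1 : ℝ) else 0),
    Finset.prod_coe_sort s (fun p => ∑ b ∈ range p, if ∀ m ∈ A, m % p ≠ b then (1 : ℝ) else 0),
    ← Finset.prod_mul_distrib]
  refine Finset.prod_congr rfl fun p hp => ?_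
  have hp0 : 0 < p := (hs p hp).pos
  rw [Finset.sum_boole]
  have hfil : (range p).filter (fun b => ∀ m ∈ A, m % p ≠ b)
      = range p \ A.image (fun d => d % p) := by
    ext b
    simp only [mem_filter, mem_sdiff, mem_image, not_exists, not_and]
  have hsub : A.image (fun d => d % p) ⊆ range p := by
    intro b hb
    obtain ⟨a, -, rfl⟩ := mem_image.mp hb
    exact mem_range.mpr (Nat.mod_lt _ hp0)
  have hcard : residueCount p A ≤ p := by
    have := card_le_card hsub
    rwa [card_range] at this
  have hp' : (p : ℝ) ≠ 0 := by exact_mod_cast hp0.ne'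
  rw [hfil, card_sdiff_of_subset hsub, card_range,
    show #(A.image fun d => d % p) = residueCount p A from rfl, Nat.cast_sub hcard]
  field_simp

theorem residueAvg_const (s : Finset ℕ) (hs : ∀ p ∈ s, p.Prime) (c : ℝ) :
    residueAvg s (fun _ => c) = c := by
  have h := residueAvg_indicator s hs ∅
  have h1 : sieveWeight s ∅ = 1 := by simp [sieveWeight, residueCount]
  rw [h1] at h
  simp only [Finset.notMem_empty, false_imp_iff, implies_true, if_true] at h
  have := residueAvg_const_mul s c (fun _ => 1)
  rw [h] at this
  simpa using this

open Finset in
theorem residueAvg_choose (s : Finset ℕ) (hs : ∀ p ∈ s, p.Prime) (M j : ℕ) :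
    residueAvg s (fun ω => ((#(sifted s M ω)).choose j : ℝ))
      = ∑ A ∈ powersetCard j (range M), sieveWeight s A := by
  have h : ∀ ω, ((#(sifted s M ω)).choose j : ℝ) = ∑ A ∈ powersetCard j (range M),
      if ∀ m ∈ A, ∀ p : s, m % p ≠ ω p then 1 else 0 := by
    intro ω
    rw [Finset.sum_boole, ← card_powersetCard]
    congr 2
    ext A
    simp only [mem_powersetCard, mem_filter, sifted, subset_iff]
    constructor
    · exact fun ⟨h1, h2⟩ => ⟨⟨fun a ha => (h1 ha).1, h2⟩, fun m hm => (h1 hm).2⟩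
    · exact fun ⟨⟨h1, h2⟩, h3⟩ => ⟨fun a ha => ⟨h1 ha, h3 a ha⟩, h2⟩
  simp_rw [h]
  rw [residueAvg_sum]
  exact Finset.sum_congr rfl fun A _ => residueAvg_indicator s hs A

open Finset in
theorem residueAvg_card_sifted (s : Finset ℕ) (hs : ∀ p ∈ s, p.Prime) (M : ℕ) :
    residueAvg s (fun ω => (#(sifted s M ω) : ℝ)) = M * ∏ p ∈ s, (1 - (p : ℝ)⁻¹) := by
  have h := residueAvg_choose s hs M 1
  simp only [Nat.choose_one_right] at h
  rw [h, Finset.powersetCard_one, Finset.sum_map]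
  simp [sieveWeight, residueCount]

open Finset in
-- The variance is at most the mean. For fixed a, the pairs {m, a} have local factors 1 - 2/p +
-- (1/p) 1_{m ≡ a}, of mean (1 - 1/p)². As 1 - 2/p ≥ 0, the error product ∏ (|1 - 2/p| + 1/p)
-- collapses to ∏ (1 - 1/p).
theorem residueAvg_card_sifted_sq_le (s : Finset ℕ) (hs : ∀ p ∈ s, p.Prime) (M : ℕ) :
    residueAvg s (fun ω => (#(sifted s M ω) : ℝ) ^ 2)
      ≤ (M * ∏ p ∈ s, (1 - (p : ℝ)⁻¹)) ^ 2 + M * ∏ p ∈ s, (1 - (p : ℝ)⁻¹) := by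
  have h : ∀ ω, (#(sifted s M ω) : ℝ) ^ 2 = ∑ a ∈ range M, ∑ m ∈ range M,
      if ∀ b ∈ ({m, a} : Finset ℕ), ∀ p : s, b % p ≠ ω p then 1 else 0 := by
    intro ω
    rw [sq, sifted, ← Finset.sum_boole, Finset.sum_mul_sum]
    refine Finset.sum_congr rfl fun a _ => Finset.sum_congr rfl fun m _ => ?_
    rw [ite_zero_mul_ite_zero, one_mul]
    congr 1
    simp only [mem_insert, mem_singleton, forall_eq_or_imp, forall_eq]
    exact propext and_comm
  simp_rw [h]
  rw [residueAvg_sum]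
  simp_rw [residueAvg_sum, residueAvg_indicator s hs]
  have hp2 : ∀ p ∈ s, (2 : ℝ) ≤ p := fun p hp => by exact_mod_cast (hs p hp).two_le
  have hin : ∀ a ∈ range M, ∑ m ∈ range M, sieveWeight s {m, a}
      ≤ M * (∏ p ∈ s, (1 - (p : ℝ)⁻¹)) ^ 2 + ∏ p ∈ s, (1 - (p : ℝ)⁻¹) := by
    intro a _
    have hb := abs_sum_prod_local_sub_le s hs (fun p => a % p)
      (fun p hp => Nat.mod_lt _ (hs p hp).pos) M (fun p => 1 - 2 * (p : ℝ)⁻¹) (fun p => (p : ℝ)⁻¹)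
    have e1 : ∀ m, sieveWeight s {m, a}
        = ∏ p ∈ s, (1 - 2 * (p : ℝ)⁻¹ + (p : ℝ)⁻¹ * (if m % p = a % p then 1 else 0)) := by
      intro m
      unfold sieveWeight
      refine Finset.prod_congr rfl fun p hp => ?_
      unfold residueCount
      rw [image_insert, image_singleton]
      split_ifs with hma
      · rw [hma]; simp; ring
      · rw [card_pair hma]; push_cast; ring
    have e2 : ∏ p ∈ s, (1 - 2 * (p : ℝ)⁻¹ + (p : ℝ)⁻¹ * (p : ℝ)⁻¹)
        = (∏ p ∈ s, (1 - (p : ℝ)⁻¹)) ^ 2 := by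
      rw [← Finset.prod_pow]
      exact Finset.prod_congr rfl fun p _ => by ring
    have e3 : ∏ p ∈ s, (|1 - 2 * (p : ℝ)⁻¹| + |(p : ℝ)⁻¹|) = ∏ p ∈ s, (1 - (p : ℝ)⁻¹) := by
      refine Finset.prod_congr rfl fun p hp => ?_
      have h2 : (p : ℝ)⁻¹ ≤ 2⁻¹ := inv_anti₀ (by norm_num) (hp2 p hp)
      rw [abs_of_nonneg (by linarith), abs_of_nonneg (by positivity)]
      ring
    simp_rw [e1]
    rw [e2, e3] at hb
    linarith [(abs_le.mp hb).2]
  calc _ ≤ ∑ a ∈ range M, ((M : ℝ) * (∏ p ∈ s, (1 - (p : ℝ)⁻¹)) ^ 2 + ∏ p ∈ s, (1 - (p : ℝ)⁻¹)) :=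
        Finset.sum_le_sum hin
    _ = _ := by rw [Finset.sum_const, card_range, nsmul_eq_mul]; ring

open Finset in
-- The left side compares the factorial moment of the survivor count Y with μ^(i+1). Passing to
-- ordinary powers costs O(Y^i), and the tangent inequality at μ bounds the rest by the variance.
-- The pointwise bound Y ≤ K μ is what lets the variance control all higher moments.
theorem sieveWeight_moment (s : Finset ℕ) (hs : ∀ p ∈ s, p.Prime) (M i : ℕ) {K μ : ℝ} (hK : 1 ≤ K)
    (hμ : μ = M * ∏ p ∈ s, (1 - (p : ℝ)⁻¹))
    (hbound : ∀ x : ℕ → ℕ, (∀ p ∈ s, x p < p) →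
      (#{m ∈ range M | ∀ p ∈ s, m % p ≠ x p} : ℝ) ≤ K * μ) :
    |(i + 1).factorial * ∑ A ∈ powersetCard (i + 1) (range M), sieveWeight s A - μ ^ (i + 1)|
      ≤ 2 * (i + 1) ^ 2 * K ^ i * μ ^ i := by
  have hμ0 : 0 ≤ μ := by
    rw [hμ]
    refine mul_nonneg (Nat.cast_nonneg _) (Finset.prod_nonneg fun p hp => ?_)
    have : (p : ℝ)⁻¹ ≤ 1 := inv_le_one_of_one_le₀ (by exact_mod_cast (hs p hp).one_le)
    linarith
  let Y : (s → ℕ) → ℝ := fun ω => (#(sifted s M ω) : ℝ)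
  have hY0 : ∀ ω, 0 ≤ Y ω := fun ω => Nat.cast_nonneg _
  have hYK : ∀ ω ∈ residueChoices s, Y ω ≤ K * μ := by
    intro ω hω
    have hω' := Fintype.mem_piFinset.mp hω
    -- The value 0 outside `s` is a filler and is never inspected.
    have := hbound (fun p => if h : p ∈ s then ω ⟨p, h⟩ else 0) (fun p hp => by
      simp only [hp, dif_pos]
      exact mem_range.mp (hω' ⟨p, hp⟩))
    refine le_trans (le_of_eq ?_) this
    simp only [Y, sifted]
    congr 2
    refine Finset.filter_congr fun m _ => ?_
    constructor
    · intro h p hp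
      simp only [hp, dif_pos]
      exact h ⟨p, hp⟩
    · intro h p
      have := h p.1 p.2
      simp only [p.2, dif_pos] at this
      exact this
  have hKμ : μ ≤ K * μ := le_mul_of_one_le_left hμ0 hK
  have hmean : residueAvg s Y = μ := by rw [hμ]; exact residueAvg_card_sifted s hs M
  have hvar : residueAvg s (fun ω => (Y ω - μ) ^ 2) ≤ μ := by
    have e : ∀ ω, (Y ω - μ) ^ 2 = Y ω ^ 2 + ((-2 * μ) * Y ω + μ ^ 2) := fun ω => by ring
    simp_rw [e]
    rw [residueAvg_add, residueAvg_add, residueAvg_const_mul, residueAvg_const s hs, hmean]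
    have := residueAvg_card_sifted_sq_le s hs M
    rw [← hμ] at this
    have h2 : residueAvg s (fun ω => Y ω ^ 2) ≤ μ ^ 2 + μ := this
    nlinarith
  have hdesc : (i + 1).factorial * ∑ A ∈ powersetCard (i + 1) (range M), sieveWeight s A
      = residueAvg s fun ω => ((#(sifted s M ω)).descFactorial (i + 1) : ℝ) := by
    rw [← residueAvg_choose s hs, ← residueAvg_const_mul]
    simp_rw [Nat.descFactorial_eq_factorial_mul_choose, Nat.cast_mul]
  have h1 : |residueAvg s (fun ω => ((#(sifted s M ω)).descFactorial (i + 1) : ℝ)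
      + (-1) * Y ω ^ (i + 1))| ≤ (i + 1) ^ 2 * (K * μ) ^ i := by
    refine (abs_residueAvg_le s _).trans ?_
    rw [← residueAvg_const s hs ((i + 1) ^ 2 * (K * μ) ^ i)]
    refine residueAvg_mono s fun ω hω => ?_
    have := abs_descFactorial_sub_pow_le (#(sifted s M ω)) i
    rw [sub_eq_add_neg, ← neg_one_mul] at this
    refine this.trans ?_
    gcongr
    exact hYK ω hω
  have h2 : |residueAvg s (fun ω => Y ω ^ (i + 1)) - μ ^ (i + 1)| ≤ (i + 1) ^ 2 * K ^ i * μ ^ i := by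
    -- The first moment is exact; the tangent inequality starts at exponent 2.
    rcases i with _ | i
    · simp [hmean]
    · have e : residueAvg s (fun ω => Y ω ^ (i + 1 + 1)) - μ ^ (i + 1 + 1)
          = residueAvg s (fun ω => Y ω ^ (i + 2) - μ ^ (i + 2)
            - (i + 2) * μ ^ (i + 1) * (Y ω - μ)) := by
        have e' : ∀ ω, Y ω ^ (i + 2) - μ ^ (i + 2) - (i + 2) * μ ^ (i + 1) * (Y ω - μ)
            = Y ω ^ (i + 2) + (-((i + 2) * μ ^ (i + 1)) * Y ω
              + ((i + 2) * μ ^ (i + 1) * μ - μ ^ (i + 2))) := fun ω => by ring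
        simp_rw [e']
        rw [residueAvg_add, residueAvg_add, residueAvg_const_mul, residueAvg_const s hs, hmean]
        ring
      rw [e]
      refine (abs_residueAvg_le s _).trans ?_
      calc _ ≤ residueAvg s (fun ω => ((i + 2) ^ 2 * (K * μ) ^ i) * (Y ω - μ) ^ 2) :=
            residueAvg_mono s fun ω hω =>
              abs_pow_sub_tangent_le i (hY0 ω) (hYK ω hω) hμ0 hKμ
        _ ≤ ((i + 2) ^ 2 * (K * μ) ^ i) * μ := by
            rw [residueAvg_const_mul]
            gcongr
        _ = (i + 2) ^ 2 * K ^ i * μ ^ (i + 1) := by ring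
        _ ≤ (i + 2) ^ 2 * K ^ (i + 1) * μ ^ (i + 1) := by
            gcongr
            omega
        _ = _ := by push_cast; ring
  rw [hdesc]
  rw [residueAvg_add, residueAvg_const_mul] at h1
  have := abs_add_le (residueAvg s (fun ω => ((#(sifted s M ω)).descFactorial (i + 1) : ℝ))
    + (-1) * residueAvg s (fun ω => Y ω ^ (i + 1)))
    (residueAvg s (fun ω => Y ω ^ (i + 1)) - μ ^ (i + 1))
  calc _ ≤ _ := by
        refine le_trans (le_of_eq ?_) this
        congr 1; ring
    _ ≤ (i + 1) ^ 2 * (K * μ) ^ i + (i + 1) ^ 2 * K ^ i * μ ^ i := add_le_add h1 h2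
    _ = _ := by ring

/-! ### Prime factors of q and the sifted density -/

theorem card_primeFactors_le_log (q : ℕ) (hq : q ≠ 0) : q.primeFactors.card ≤ Nat.log 2 q := by
  refine Nat.le_log_of_pow_le (by norm_num) ?_
  calc 2 ^ q.primeFactors.card ≤ ∏ p ∈ q.primeFactors, p :=
        Finset.pow_card_le_prod _ _ _ fun p hp => (Nat.prime_of_mem_primeFactors hp).two_le
    _ ≤ q := Nat.le_of_dvd (Nat.pos_of_ne_zero hq) (Nat.prod_primeFactors_dvd q)

theorem one_sub_sum_le_prod_one_sub {ι : Type*} (s : Finset ι) (a : ι → ℝ)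
    (h0 : ∀ i ∈ s, 0 ≤ a i) (h1 : ∀ i ∈ s, a i ≤ 1) :
    1 - ∑ i ∈ s, a i ≤ ∏ i ∈ s, (1 - a i) := by
  classical
  induction s using Finset.induction_on with
  | empty => simp
  | insert i s hi ih =>
    rw [Finset.sum_insert hi, Finset.prod_insert hi]
    have ih' := ih (fun j hj => h0 j (Finset.mem_insert_of_mem hj))
      (fun j hj => h1 j (Finset.mem_insert_of_mem hj))
    have ha0 := h0 i (Finset.mem_insert_self _ _)
    have ha1 := h1 i (Finset.mem_insert_self _ _)
    have hs : 0 ≤ ∑ j ∈ s, a j :=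
      Finset.sum_nonneg fun j hj => h0 j (Finset.mem_insert_of_mem hj)
    nlinarith [mul_le_mul_of_nonneg_left ih' (sub_nonneg.mpr ha1)]

theorem prod_primeFactors_one_sub_inv (q : ℕ) (hq : q ≠ 0) :
    ∏ p ∈ q.primeFactors, (1 - (p : ℝ)⁻¹) = (Nat.totient q : ℝ) / q := by
  have h := Nat.totient_eq_mul_prod_factors q
  have h' : ((Nat.totient q : ℚ) : ℝ) = (((q : ℚ) * ∏ p ∈ q.primeFactors, (1 - (p : ℚ)⁻¹) : ℚ) : ℝ) :=
    congrArg _ h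
  push_cast at h'
  rw [h', mul_div_cancel_left₀]
  exact_mod_cast hq

/-- The primes up to `y` which do not divide `q`. -/
def coprimePrimesLE (y q : ℕ) : Finset ℕ := (Nat.primesLE y).filter fun p => ¬ p ∣ q

theorem prime_of_mem_coprimePrimesLE {y q p : ℕ} (hp : p ∈ coprimePrimesLE y q) : p.Prime :=
  Nat.prime_of_mem_primesLE (Finset.mem_filter.mp hp).1

theorem one_sub_inv_mem_Ioc {p : ℕ} (hp : p.Prime) : 0 < 1 - (p : ℝ)⁻¹ ∧ 1 - (p : ℝ)⁻¹ ≤ 1 := by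
  have : (p : ℝ)⁻¹ < 1 := inv_lt_one_of_one_lt₀ (by exact_mod_cast hp.one_lt)
  have h0 : 0 ≤ (p : ℝ)⁻¹ := by positivity
  constructor <;> linarith

/-- The proportion of integers free of prime factors `p ≤ y`, `p ∤ q`. -/
noncomputable def siftedDensity (y q : ℕ) : ℝ := ∏ p ∈ coprimePrimesLE y q, (1 - (p : ℝ)⁻¹)

theorem siftedDensity_pos (y q : ℕ) : 0 < siftedDensity y q :=
  Finset.prod_pos fun _ hp => (one_sub_inv_mem_Ioc (prime_of_mem_coprimePrimesLE hp)).1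

theorem siftedDensity_le_one (y q : ℕ) : siftedDensity y q ≤ 1 :=
  Finset.prod_le_one (fun _ hp => (one_sub_inv_mem_Ioc (prime_of_mem_coprimePrimesLE hp)).1.le)
    fun _ hp => (one_sub_inv_mem_Ioc (prime_of_mem_coprimePrimesLE hp)).2

/-- There are at most log₂ q ≤ y/2 primes dividing q, so those above y reduce ∏ (1 - 1/p) by at most
a factor 2. The smaller ones complete the density to the full Mertens product up to y. -/
theorem le_siftedDensity (y q : ℕ) (hy : 2 ≤ y) (hq : q ≠ 0) (hyq : 2 * Nat.log 2 q ≤ y) :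
    (q : ℝ) / Nat.totient q ≤ 80 * Real.log y * siftedDensity y q := by
  have hy0 : (0 : ℝ) < y := by positivity
  have hl : 0 < Real.log y := Real.log_pos (by exact_mod_cast hy)
  have hφ : (0 : ℝ) < Nat.totient q := by exact_mod_cast Nat.totient_pos.mpr (Nat.pos_of_ne_zero hq)
  have hq0 : (0 : ℝ) < q := by exact_mod_cast Nat.pos_of_ne_zero hq
  have hbig : (1 : ℝ) / 2 ≤ ∏ p ∈ q.primeFactors with ¬ p ≤ y, (1 - (p : ℝ)⁻¹) := by
    have hsum : ∑ p ∈ q.primeFactors with ¬ p ≤ y, (p : ℝ)⁻¹ ≤ 1 / 2 := by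
      calc ∑ p ∈ q.primeFactors with ¬ p ≤ y, (p : ℝ)⁻¹
          ≤ ∑ p ∈ q.primeFactors with ¬ p ≤ y, (y : ℝ)⁻¹ := by
            refine Finset.sum_le_sum fun p hp => inv_anti₀ hy0 ?_
            exact_mod_cast (not_le.mp (Finset.mem_filter.mp hp).2).le
        _ = (q.primeFactors.filter fun p => ¬ p ≤ y).card * (y : ℝ)⁻¹ := by
            rw [Finset.sum_const, nsmul_eq_mul]
        _ ≤ (Nat.log 2 q : ℝ) * (y : ℝ)⁻¹ := by
            gcongr
            exact_mod_cast (Finset.card_filter_le _ _).trans (card_primeFactors_le_log q hq)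
        _ ≤ 1 / 2 := by
            rw [← div_eq_mul_inv, div_le_div_iff₀ hy0 (by norm_num)]
            have : (2 : ℝ) * Nat.log 2 q ≤ y := by exact_mod_cast hyq
            linarith
    refine le_trans ?_ (one_sub_sum_le_prod_one_sub _ _ (fun p _ => by positivity) fun p hp => ?_)
    · linarith
    · have := one_sub_inv_mem_Ioc (Nat.prime_of_mem_primeFactors (Finset.mem_filter.mp hp).1)
      linarith
  have hsplit : (∏ p ∈ q.primeFactors with p ≤ y, (1 - (p : ℝ)⁻¹)) *
      (∏ p ∈ q.primeFactors with ¬ p ≤ y, (1 - (p : ℝ)⁻¹)) = (Nat.totient q : ℝ) / q := by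
    rw [Finset.prod_filter_mul_prod_filter_not, prod_primeFactors_one_sub_inv q hq]
  have hM := mertens_lower y hy
  have hsplit2 : (∏ p ∈ q.primeFactors with p ≤ y, (1 - (p : ℝ)⁻¹)) * siftedDensity y q
      = ∏ p ∈ Nat.primesLE y, (1 - (p : ℝ)⁻¹) := by
    rw [← Finset.prod_filter_mul_prod_filter_not (Nat.primesLE y) (fun p => p ∣ q)]
    congr 1
    refine Finset.prod_congr ?_ fun _ _ => rfl
    ext p
    simp only [Finset.mem_filter, Nat.mem_primeFactors, Nat.mem_primesLE]
    tauto
  have hsm0 : 0 ≤ ∏ p ∈ q.primeFactors with p ≤ y, (1 - (p : ℝ)⁻¹) :=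
    Finset.prod_nonneg fun p hp =>
      (one_sub_inv_mem_Ioc (Nat.prime_of_mem_primeFactors (Finset.mem_filter.mp hp).1)).1.le
  have hsm : ∏ p ∈ q.primeFactors with p ≤ y, (1 - (p : ℝ)⁻¹) ≤ 2 * ((Nat.totient q : ℝ) / q) := by
    nlinarith [mul_le_mul_of_nonneg_left hbig hsm0]
  rw [← hsplit2] at hM
  have hρ := siftedDensity_pos y q
  have h1 : 1 / (40 * Real.log y) ≤ 2 * ((Nat.totient q : ℝ) / q) * siftedDensity y q :=
    hM.trans (mul_le_mul_of_nonneg_right hsm hρ.le)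
  rw [div_le_iff₀ (by positivity)] at h1
  rw [div_le_iff₀ hφ]
  have h2 : 2 * ((Nat.totient q : ℝ) / q) * siftedDensity y q * (40 * Real.log y)
      = (80 * Real.log y * siftedDensity y q * Nat.totient q) / q := by ring
  rw [h2, le_div_iff₀ hq0] at h1
  linarith

theorem div_totient_le (y q : ℕ) (hy : 2 ≤ y) (hq : q ≠ 0) (hyq : 2 * Nat.log 2 q ≤ y) :
    (q : ℝ) / Nat.totient q ≤ 80 * Real.log y := by
  have hl : 0 < Real.log y := Real.log_pos (by exact_mod_cast hy)
  exact (le_siftedDensity y q hy hq hyq).trans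
    (mul_le_of_le_one_right (by positivity) (siftedDensity_le_one y q))

/-! ### The singular series of shifts in a progression -/

/-- Both bounds are Bernoulli's inequality: for (1 - 1/p)^j directly, and for (1 + 1/p)^j, which is
at most (1 - 1/p)^{-j}. -/
theorem local_factor_bounds {p j : ℕ} (hp : 2 ≤ p) (hj : j ≤ p) :
    1 - (j : ℝ) ^ 2 * ((p : ℝ) ^ 2)⁻¹ ≤ ((1 - 1 / (p : ℝ)) ^ j)⁻¹ * (1 - (j : ℝ) / p) ∧
      ((1 - 1 / (p : ℝ)) ^ j)⁻¹ * (1 - (j : ℝ) / p) ≤ 1 := by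
  have hp2 : (2 : ℝ) ≤ p := by exact_mod_cast hp
  have hp0 : (0 : ℝ) < p := by linarith
  have hjp : (j : ℝ) / p ≤ 1 := by
    rw [div_le_one hp0]; exact_mod_cast hj
  have hinv : 1 / (p : ℝ) ≤ 1 / 2 := one_div_le_one_div_of_le (by norm_num) hp2
  have hinv0 : 0 < 1 / (p : ℝ) := by positivity
  have hpos : 0 < (1 - 1 / (p : ℝ)) ^ j := pow_pos (by linarith) j
  have hb := one_add_mul_le_pow (a := -(1 / (p : ℝ))) (by linarith) j
  have hb' : 1 - (j : ℝ) / p ≤ (1 - 1 / (p : ℝ)) ^ j := by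
    calc 1 - (j : ℝ) / p = 1 + j * -(1 / (p : ℝ)) := by ring
      _ ≤ _ := hb.trans_eq (by ring)
  constructor
  · have hc := one_add_mul_le_pow (a := 1 / (p : ℝ)) (by linarith) j
    have h1 : (1 - 1 / (p : ℝ)) ^ j * (1 + 1 / (p : ℝ)) ^ j ≤ 1 := by
      rw [← mul_pow]
      refine pow_le_one₀ (mul_nonneg (by linarith) (by linarith)) ?_
      nlinarith
    have h2 : (1 + 1 / (p : ℝ)) ^ j ≤ ((1 - 1 / (p : ℝ)) ^ j)⁻¹ := by
      rw [← one_div, le_div_iff₀ hpos]; linarith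
    calc 1 - (j : ℝ) ^ 2 * ((p : ℝ) ^ 2)⁻¹ = (1 + j * (1 / (p : ℝ))) * (1 - (j : ℝ) / p) := by
          field_simp; ring
      _ ≤ _ := mul_le_mul_of_nonneg_right (hc.trans h2) (by linarith)
  · rw [inv_mul_le_iff₀ hpos]; linarith

/-- The factors differ from 1 by at most j²/p², and Σ 1/n² over n > y is at most 2/(y + 1). Setting
the factors outside P to 1 allows the tail to be multiplied by a finite product. -/
theorem hasProd_local_tail (j y : ℕ) (hjy : j ≤ y) (P : Nat.Primes → Prop)
    (hP : ∀ p : Nat.Primes, P p → y < p) (g : Nat.Primes → ℝ)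
    (hg1 : ∀ p, ¬ P p → g p = 1)
    (hg : ∀ p : Nat.Primes, P p → g p = ((1 - 1 / ((p : ℕ) : ℝ)) ^ j)⁻¹ * (1 - (j : ℝ) / (p : ℕ))) :
    ∃ t : ℝ, HasProd g t ∧ 1 - 2 * (j : ℝ) ^ 2 / (y + 1) ≤ t ∧ t ≤ 1 := by
  classical
  have hbd : ∀ p : Nat.Primes, P p → 1 - (j : ℝ) ^ 2 * (((p : ℕ) : ℝ) ^ 2)⁻¹ ≤ g p ∧ g p ≤ 1 := by
    intro p hp
    rw [hg p hp]
    exact local_factor_bounds p.2.two_le (hjy.trans (hP p hp).le)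
  have hle1 : ∀ p, g p ≤ 1 := fun p => by
    by_cases hp : P p
    · exact (hbd p hp).2
    · exact (hg1 p hp).le
  have hsq : ∀ p : Nat.Primes, P p → (j : ℝ) ^ 2 * (((p : ℕ) : ℝ) ^ 2)⁻¹ ≤ 1 := by
    intro p hp
    have h0 : (0 : ℝ) < (p : ℕ) := by exact_mod_cast p.2.pos
    rw [← div_eq_mul_inv, div_le_one (by positivity)]
    have : (j : ℝ) ≤ (p : ℕ) := by exact_mod_cast hjy.trans (hP p hp).le
    gcongr
  have hge0 : ∀ p, 0 ≤ g p := fun p => by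
    by_cases hp : P p
    · linarith [(hbd p hp).1, hsq p hp]
    · rw [hg1 p hp]; norm_num
  have hsum : Summable fun p : Nat.Primes => g p - 1 := by
    refine Summable.of_norm_bounded (g := fun p : Nat.Primes => (j : ℝ) ^ 2 * (((p : ℕ) : ℝ) ^ 2)⁻¹)
      ?_ fun p => ?_
    · exact ((Real.summable_nat_pow_inv.mpr (by norm_num : 1 < 2)).comp_injective
        Nat.Primes.coe_nat_injective).mul_left _
    · rw [Real.norm_eq_abs, abs_le]
      by_cases hp : P p
      · constructor <;> linarith [hbd p hp, (hbd p hp).1, (hbd p hp).2, hsq p hp,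
          (by positivity : 0 ≤ (j : ℝ) ^ 2 * (((p : ℕ) : ℝ) ^ 2)⁻¹)]
      · rw [hg1 p hp]; constructor <;>
          linarith [(by positivity : 0 ≤ (j : ℝ) ^ 2 * (((p : ℕ) : ℝ) ^ 2)⁻¹)]
  have hmul : Multipliable g := by
    have := Real.multipliable_one_add_of_summable hsum
    simpa using this
  refine ⟨∏' p, g p, hmul.hasProd, ?_, ?_⟩
  · refine ge_of_tendsto' hmul.hasProd fun T => ?_
    have hT : ∏ p ∈ T, g p = ∏ p ∈ T with P p, g p := by
      rw [Finset.prod_filter]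
      refine Finset.prod_congr rfl fun p _ => ?_
      split_ifs with hp
      · rfl
      · exact hg1 p hp
    rw [hT]
    calc 1 - 2 * (j : ℝ) ^ 2 / (y + 1)
        ≤ 1 - ∑ p ∈ T with P p, (j : ℝ) ^ 2 * (((p : ℕ) : ℝ) ^ 2)⁻¹ := by
          have : ∑ p ∈ T with P p, (((p : ℕ) : ℝ) ^ 2)⁻¹ ≤ 2 / (y + 1) := by
            rw [← Finset.sum_image (f := fun n : ℕ => ((n : ℝ) ^ 2)⁻¹)
              (g := fun p : Nat.Primes => (p : ℕ))
              (fun a _ b _ h => Nat.Primes.coe_nat_injective h)]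
            obtain ⟨n, hn⟩ := ((T.filter P).image fun p : Nat.Primes => (p : ℕ)).exists_nat_subset_range
            refine le_trans (Finset.sum_le_sum_of_subset_of_nonneg ?_ fun _ _ _ => by positivity)
              (sum_Ioo_inv_sq_le y n)
            intro a ha
            have h1 := Finset.mem_range.mp (hn ha)
            obtain ⟨p, hp, rfl⟩ := Finset.mem_image.mp ha
            exact Finset.mem_Ioo.mpr ⟨hP p (Finset.mem_filter.mp hp).2, h1⟩
          rw [← Finset.mul_sum]
          have h2 := mul_le_mul_of_nonneg_left this (sq_nonneg (j : ℝ))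
          have h3 : 2 * (j : ℝ) ^ 2 / (y + 1) = (j : ℝ) ^ 2 * (2 / (y + 1)) := by ring
          rw [h3]; linarith
      _ ≤ ∏ p ∈ T with P p, (1 - (j : ℝ) ^ 2 * (((p : ℕ) : ℝ) ^ 2)⁻¹) :=
          one_sub_sum_le_prod_one_sub _ _ (fun _ _ => by positivity)
            fun p hp => hsq p (Finset.mem_filter.mp hp).2
      _ ≤ ∏ p ∈ T with P p, g p := by
          refine Finset.prod_le_prod (fun p hp => ?_) fun p hp => ?_
          · linarith [hsq p (Finset.mem_filter.mp hp).2]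
          · exact (hbd p (Finset.mem_filter.mp hp).2).1
  · exact le_of_tendsto' hmul.hasProd fun T =>
      Finset.prod_le_one (fun p _ => hge0 p) fun p _ => hle1 p

/-- The shift set `{1 + q m : m ∈ A}`. -/
def progressionShifts (q : ℕ) (A : Finset ℕ) : Finset ℕ := A.image fun m => 1 + q * m

theorem progression_injective {q : ℕ} (hq : q ≠ 0) : Function.Injective fun m => 1 + q * m := by
  intro a b h
  exact Nat.eq_of_mul_eq_mul_left (Nat.pos_of_ne_zero hq) (Nat.add_left_cancel h)

theorem card_progressionShifts {q : ℕ} (hq : q ≠ 0) (A : Finset ℕ) :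
    (progressionShifts q A).card = A.card :=
  Finset.card_image_of_injective _ (progression_injective hq)

theorem residueCount_progressionShifts_of_dvd {p q : ℕ} (hpq : p ∣ q) {A : Finset ℕ}
    (hA : A.Nonempty) : residueCount p (progressionShifts q A) = 1 := by
  unfold residueCount progressionShifts
  rw [Finset.image_image, Finset.card_eq_one]
  refine ⟨1 % p, ?_⟩
  obtain ⟨c, rfl⟩ := hpq
  have : ((fun d => d % p) ∘ fun m => 1 + p * c * m) = fun _ => 1 % p := by
    funext m
    simp only [Function.comp]
    rw [mul_assoc, Nat.add_mul_mod_self_left]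
  rw [this, Finset.image_const hA]

theorem residueCount_progressionShifts {p q : ℕ} (hp : p.Prime) (hpq : ¬ p ∣ q) (A : Finset ℕ) :
    residueCount p (progressionShifts q A) = residueCount p A := by
  unfold residueCount progressionShifts
  rw [Finset.image_image]
  have hcop : Nat.gcd p q = 1 := (Nat.Prime.coprime_iff_not_dvd hp).mpr hpq
  have hmod : ∀ a b, (1 + q * a) % p = (1 + q * b) % p ↔ a % p = b % p := by
    intro a b
    constructor
    · intro h
      have h1 : q * a ≡ q * b [MOD p] := Nat.ModEq.add_left_cancel' 1 h
      exact Nat.ModEq.cancel_left_of_coprime hcop h1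
    · intro h
      exact Nat.ModEq.add_left 1 (Nat.ModEq.mul_left q h)
  have e : A.image ((fun d => d % p) ∘ fun m => 1 + q * m)
      = (A.image fun d => d % p).image fun r => (1 + q * r) % p := by
    rw [Finset.image_image]
    refine Finset.image_congr fun a _ => ?_
    exact (hmod _ _).mpr (Nat.mod_mod a p).symm
  rw [e]
  refine Finset.card_image_of_injOn fun r hr r' hr' h => ?_
  obtain ⟨a, -, rfl⟩ := Finset.mem_image.mp hr
  obtain ⟨b, -, rfl⟩ := Finset.mem_image.mp hr'
  simpa using (hmod _ _).mp h

theorem residueCount_of_subset_range {p M : ℕ} (hpM : M ≤ p) {A : Finset ℕ}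
    (hA : A ⊆ Finset.range M) : residueCount p A = A.card := by
  unfold residueCount
  refine Finset.card_image_of_injOn fun a ha b hb h => ?_
  have h1 := Finset.mem_range.mp (hA ha)
  have h2 := Finset.mem_range.mp (hA hb)
  rwa [Nat.mod_eq_of_lt (by omega), Nat.mod_eq_of_lt (by omega)] at h

/-- For p ∣ q all shifts lie in one class, which leaves (1 - 1/p)^{-i}. For p ∤ q multiplication by
q permutes the classes, so A itself may be counted: up to y this gives the sieve weight, and above y
≥ M the elements of A are distinct modulo p. -/
theorem singularSeries_progressionShifts {q y M i : ℕ} (hq : q ≠ 0) (hMy : M ≤ y) (hiy : i + 1 ≤ y)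
    {A : Finset ℕ} (hA : A ⊆ Finset.range M) (hcard : A.card = i + 1) :
    ∃ t : ℝ, 1 - 2 * ((i + 1 : ℕ) : ℝ) ^ 2 / (y + 1) ≤ t ∧ t ≤ 1 ∧
      singularSeries (progressionShifts q A) 1
        = ((q : ℝ) / Nat.totient q) ^ i * (siftedDensity y q ^ (i + 1))⁻¹ *
          sieveWeight (coprimePrimesLE y q) A * t := by
  have hAne : A.Nonempty := Finset.card_pos.mp (by omega)
  set 𝒟 := progressionShifts q A with h𝒟
  let f : Nat.Primes → ℝ := fun p => ((1 - 1 / ((p : ℕ) : ℝ)) ^ 𝒟.card)⁻¹ *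
        (1 - (residueCount (p : ℕ) 𝒟 : ℝ) / ((p : ℕ) : ℝ))
  let f' : ℕ → ℝ := fun p => ((1 - 1 / (p : ℝ)) ^ 𝒟.card)⁻¹ *
        (1 - (residueCount p 𝒟 : ℝ) / (p : ℝ))
  have hcd : 𝒟.card = i + 1 := by rw [h𝒟, card_progressionShifts hq, hcard]
  have hss : singularSeries 𝒟 1 = ∏' p, f p := by
    unfold singularSeries
    simp only [Nat.totient_one, Nat.cast_one, div_one, one_pow, inv_one, one_mul]
    refine tprod_congr fun p => ?_
    rw [if_neg]
    intro h
    exact p.2.one_lt.ne' (Nat.dvd_one.mp h)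
  let F : Finset ℕ := q.primeFactors ∪ coprimePrimesLE y q
  have hF : ∀ p ∈ F, p.Prime := fun p hp => (Finset.mem_union.mp hp).elim
    Nat.prime_of_mem_primeFactors prime_of_mem_coprimePrimesLE
  have hFnot : ∀ p : ℕ, p.Prime → p ∉ F → y < p ∧ ¬ p ∣ q := by
    intro p hp hpF
    simp only [F, Finset.mem_union, Nat.mem_primeFactors, coprimePrimesLE, Finset.mem_filter,
      Nat.mem_primesLE, not_or] at hpF
    have h1 : ¬ p ∣ q := fun h => hpF.1 ⟨hp, h, hq⟩
    exact ⟨by by_contra hc; exact hpF.2 ⟨⟨not_lt.mp hc, hp⟩, h1⟩, h1⟩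
  let FS : Finset Nat.Primes := F.subtype Nat.Prime
  have hmemFS : ∀ p : Nat.Primes, p ∈ FS ↔ (p : ℕ) ∈ F := fun p => Finset.mem_subtype
  obtain ⟨t, ht, ht0, ht1⟩ := hasProd_local_tail (i + 1) y hiy (fun p => p ∉ FS)
    (fun p hp => (hFnot p p.2 (fun h => hp ((hmemFS p).mpr h))).1)
    (fun p => if p ∈ FS then 1 else f p) (fun p hp => by simp only [not_not] at hp; simp [hp])
    (fun p hp => by
      have h := hFnot p p.2 (fun h => hp ((hmemFS p).mpr h))
      simp only [hp, if_false, f]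
      rw [hcd, h𝒟, residueCount_progressionShifts p.2 h.2,
        residueCount_of_subset_range (hMy.trans h.1.le) hA, hcard])
  have hfin : HasProd (fun p => if p ∈ FS then f p else 1) (∏ p ∈ FS, f p) := by
    have := hasProd_prod_of_ne_finset_one (f := fun p => if p ∈ FS then f p else 1) (s := FS)
      (fun p hp => by simp [hp]) (L := SummationFilter.unconditional _)
    have e : ∏ p ∈ FS, (if p ∈ FS then f p else 1) = ∏ p ∈ FS, f p :=
      Finset.prod_congr rfl fun p hp => by simp [hp]
    rwa [e] at this
  have hall : HasProd f ((∏ p ∈ FS, f p) * t) := by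
    have := hfin.mul ht
    convert this using 1
    funext p
    split_ifs <;> simp
  refine ⟨t, ht0, ht1, ?_⟩
  rw [hss, hall.tprod_eq]
  congr 1
  have e1 : ∏ p ∈ FS, f p = ∏ p ∈ F, f' p := Finset.prod_subtype_of_mem f' hF
  have hdisj : Disjoint q.primeFactors (coprimePrimesLE y q) := by
    rw [Finset.disjoint_left]
    intro p hp hp'
    exact (Finset.mem_filter.mp hp').2 (Nat.dvd_of_mem_primeFactors hp)
  rw [e1, Finset.prod_union hdisj]
  have e2 : ∏ p ∈ q.primeFactors, f' p = ((q : ℝ) / Nat.totient q) ^ i := by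
    rw [← inv_div, ← prod_primeFactors_one_sub_inv q hq, ← Finset.prod_inv_distrib,
      ← Finset.prod_pow]
    refine Finset.prod_congr rfl fun p hp => ?_
    have hp' := Nat.prime_of_mem_primeFactors hp
    have h0 := (one_sub_inv_mem_Ioc hp').1.ne'
    simp only [f']
    rw [hcd, h𝒟, residueCount_progressionShifts_of_dvd (Nat.dvd_of_mem_primeFactors hp) hAne,
      Nat.cast_one, one_div, pow_succ, mul_inv, mul_assoc, inv_mul_cancel₀ h0, mul_one, inv_pow]
  have e3 : ∏ p ∈ coprimePrimesLE y q, f' p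
      = (siftedDensity y q ^ (i + 1))⁻¹ * sieveWeight (coprimePrimesLE y q) A := by
    unfold siftedDensity sieveWeight
    rw [← Finset.prod_pow, ← Finset.prod_inv_distrib, ← Finset.prod_mul_distrib]
    refine Finset.prod_congr rfl fun p hp => ?_
    simp only [f']
    rw [hcd, h𝒟, residueCount_progressionShifts (prime_of_mem_coprimePrimesLE hp)
      (Finset.mem_filter.mp hp).2, one_div]
  rw [e2, e3, mul_assoc]

open Finset in
-- The factor ρ^{-(i+1)} cancels against μ^(i+1) = (Mρ)^(i+1), so the main term no longer involves
-- y. The two errors are the moment error, of order 1/μ, and the tail of the singular series, of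
-- order 1/y.
theorem sum_singularSeries {q y M i : ℕ} (hq : q ≠ 0) (hMy : M ≤ y) (hiy : i + 1 ≤ y)
    {K : ℝ} (hK : 1 ≤ K) (hM : 0 < M)
    (hbound : ∀ x : ℕ → ℕ, (∀ p ∈ coprimePrimesLE y q, x p < p) →
      (#{m ∈ range M | ∀ p ∈ coprimePrimesLE y q, m % p ≠ x p} : ℝ)
        ≤ K * (M * siftedDensity y q)) :
    |(i + 1).factorial * ∑ A ∈ powersetCard (i + 1) (range M),
        singularSeries (progressionShifts q A) 1 - ((q : ℝ) / Nat.totient q) ^ i * M ^ (i + 1)|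
      ≤ ((q : ℝ) / Nat.totient q) ^ i * M ^ (i + 1) *
        (2 * (i + 1) ^ 2 * K ^ i / (M * siftedDensity y q) +
          2 * (i + 1) ^ 2 / (y + 1) * (1 + 2 * (i + 1) ^ 2 * K ^ i / (M * siftedDensity y q))) := by
  set ρ := siftedDensity y q with hρ
  set s := coprimePrimesLE y q with hs
  have hρ0 : 0 < ρ := siftedDensity_pos y q
  have hM0 : (0 : ℝ) < M := by exact_mod_cast hM
  have hspr : ∀ p ∈ s, p.Prime := fun p hp => prime_of_mem_coprimePrimesLE hp
  set C : ℝ := 2 * (i + 1) ^ 2 * K ^ i with hC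
  set ε : ℝ := 2 * (i + 1) ^ 2 / (y + 1) with hε
  set μ : ℝ := M * ρ with hμ
  have hμ0 : 0 < μ := by positivity
  set G : ℝ := ((q : ℝ) / Nat.totient q) ^ i * (ρ ^ (i + 1))⁻¹ with hG
  have hG0 : 0 ≤ G := by positivity
  have hmom := sieveWeight_moment s hspr M i hK (hμ.trans rfl) hbound
  rw [← hC] at hmom
  have hw0 : ∀ A ∈ powersetCard (i + 1) (range M), 0 ≤ sieveWeight s A := by
    intro A _
    refine Finset.prod_nonneg fun p hp => ?_
    have hp0 := (hspr p hp).pos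
    have : residueCount p A ≤ p := by
      unfold residueCount
      calc _ ≤ #(range p) := card_le_card fun b hb => by
            obtain ⟨a, -, rfl⟩ := mem_image.mp hb
            exact mem_range.mpr (Nat.mod_lt _ hp0)
        _ = p := card_range p
    rw [sub_nonneg, div_le_one (by exact_mod_cast hp0)]
    exact_mod_cast this
  set W : ℝ := (i + 1).factorial * ∑ A ∈ powersetCard (i + 1) (range M), sieveWeight s A with hW
  have hdiff : |(i + 1).factorial * ∑ A ∈ powersetCard (i + 1) (range M),
      singularSeries (progressionShifts q A) 1 - G * W| ≤ G * (ε * W) := by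
    rw [hW, ← mul_assoc G, mul_comm G, mul_assoc, ← mul_sub, mul_sum, ← sum_sub_distrib, abs_mul,
      abs_of_nonneg (by positivity : (0 : ℝ) ≤ ((i + 1).factorial : ℝ))]
    rw [show G * (ε * ((i + 1).factorial * ∑ A ∈ powersetCard (i + 1) (range M), sieveWeight s A))
      = (i + 1).factorial * ∑ A ∈ powersetCard (i + 1) (range M), G * ε * sieveWeight s A by
        rw [← mul_sum]; ring]
    gcongr
    refine (abs_sum_le_sum_abs _ _).trans (sum_le_sum fun A hA => ?_)
    have hA' := mem_powersetCard.mp hA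
    obtain ⟨t, ht0, ht1, he⟩ := singularSeries_progressionShifts hq hMy hiy hA'.1 hA'.2
    rw [he, ← hρ, ← hs, ← hG]
    have hεt : 1 - t ≤ ε := by
      rw [hε]; push_cast at ht0; linarith
    have hGw : 0 ≤ G * sieveWeight s A := mul_nonneg hG0 (hw0 A hA)
    rw [show G * sieveWeight s A * t - G * sieveWeight s A = -(G * sieveWeight s A * (1 - t)) by ring,
      abs_neg, abs_of_nonneg (mul_nonneg hGw (by linarith))]
    nlinarith
  have hGμ : G * μ ^ (i + 1) = ((q : ℝ) / Nat.totient q) ^ i * M ^ (i + 1) := by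
    rw [hG, hμ, mul_pow]
    field_simp
  have hμi : μ ^ i = μ ^ (i + 1) / μ := by rw [pow_succ, mul_div_cancel_right₀ _ hμ0.ne']
  have hWle : W ≤ μ ^ (i + 1) * (1 + C / μ) := by
    have := (abs_le.mp hmom).2
    rw [hμi] at this
    have e : μ ^ (i + 1) * (1 + C / μ) = μ ^ (i + 1) + C * (μ ^ (i + 1) / μ) := by ring
    rw [e]; linarith
  have hε0 : 0 ≤ ε := by positivity
  rw [← hGμ]
  calc _ ≤ |(i + 1).factorial * ∑ A ∈ powersetCard (i + 1) (range M),
      singularSeries (progressionShifts q A) 1 - G * W| + |G * W - G * μ ^ (i + 1)| :=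
        abs_sub_le _ _ _
    _ ≤ G * (ε * W) + G * (C * μ ^ i) := by
        refine add_le_add hdiff ?_
        rw [← mul_sub, abs_mul, abs_of_nonneg hG0]
        gcongr
    _ ≤ G * (ε * (μ ^ (i + 1) * (1 + C / μ))) + G * (C * (μ ^ (i + 1) / μ)) := by
        rw [← hμi]; gcongr
    _ = _ := by ring

/-! ### Stirling numbers, and residue classes as shifted progressions -/

theorem pow_eq_sum_stirlingSecond_mul_descFactorial (x k : ℕ) :
    x ^ k = ∑ j ∈ Finset.range (k + 1), Nat.stirlingSecond k j * x.descFactorial j := by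
  induction k with
  | zero => simp
  | succ k ih =>
    have hx : ∀ j, x * x.descFactorial j = x.descFactorial (j + 1) + j * x.descFactorial j := by
      intro j
      rw [Nat.descFactorial_succ]
      -- For x < j the subtraction x - j is truncated, but both falling factorials vanish.
      rcases Nat.lt_or_ge x j with h | h
      · rw [Nat.descFactorial_of_lt h]; simp
      · rw [← add_mul, Nat.sub_add_cancel h]
    have hshift : ∑ j ∈ Finset.range (k + 1), (j + 1) * Nat.stirlingSecond k (j + 1) *
        x.descFactorial (j + 1) = ∑ j ∈ Finset.range (k + 1), j * Nat.stirlingSecond k j *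
        x.descFactorial j := by
      have h1 := Finset.sum_range_succ' (fun j => j * Nat.stirlingSecond k j *
        x.descFactorial j) (k + 1)
      have h2 := Finset.sum_range_succ (fun j => j * Nat.stirlingSecond k j *
        x.descFactorial j) (k + 1)
      rw [Nat.stirlingSecond_eq_zero_of_lt (Nat.lt_succ_self k)] at h2
      simp only [zero_mul, mul_zero, add_zero] at h1 h2
      rw [← h1, h2]
    rw [pow_succ, ih, Finset.sum_range_succ' _ (k + 1), Nat.stirlingSecond_succ_zero]
    have e : ∀ j, Nat.stirlingSecond (k + 1) (j + 1) * x.descFactorial (j + 1)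
        = (j + 1) * Nat.stirlingSecond k (j + 1) * x.descFactorial (j + 1)
          + Nat.stirlingSecond k j * x.descFactorial (j + 1) := fun j => by
      rw [Nat.stirlingSecond_succ_succ, add_mul]
    simp only [e, Finset.sum_add_distrib, zero_mul, add_zero]
    rw [hshift, Finset.sum_mul, ← Finset.sum_add_distrib]
    refine Finset.sum_congr rfl fun j _ => ?_
    rw [mul_assoc, mul_comm _ x, hx]
    ring

theorem pow_eq_sum_Icc_stirlingSecond (x k : ℕ) (hk : 1 ≤ k) :
    x ^ k = ∑ j ∈ Finset.Icc 1 k, Nat.stirlingSecond k j * x.descFactorial j := by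
  obtain ⟨k, rfl⟩ := Nat.exists_eq_succ_of_ne_zero (by omega : k ≠ 0)
  rw [pow_eq_sum_stirlingSecond_mul_descFactorial, Finset.sum_range_succ',
    Nat.stirlingSecond_succ_zero, zero_mul, add_zero, Finset.range_eq_Ico,
    Finset.sum_Ico_add' (fun j => Nat.stirlingSecond (k + 1) j * x.descFactorial j) 0 (k + 1) 1]
  rfl

open Finset in
/-- The `m < M` for which `n + 1 + q m` is prime. -/
def primeSteps (q M n : ℕ) : Finset ℕ := {m ∈ range M | (n + (1 + q * m)).Prime}

open Finset in
/-- The `n ≤ q` for which all `n + 1 + q m`, `m ∈ A`, are prime. -/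
def primeBases (q : ℕ) (A : Finset ℕ) : Finset ℕ := {n ∈ Icc 1 q | ∀ m ∈ A, (n + (1 + q * m)).Prime}

open Finset in
theorem sum_descFactorial_primeSteps (q M j : ℕ) :
    ∑ n ∈ Icc 1 q, (#(primeSteps q M n)).descFactorial j
      = j.factorial * ∑ A ∈ powersetCard j (range M), #(primeBases q A) := by
  have h : ∀ n, (#(primeSteps q M n)).choose j = ∑ A ∈ powersetCard j (range M),
      if ∀ m ∈ A, (n + (1 + q * m)).Prime then 1 else 0 := by
    intro n
    rw [← card_powersetCard, ← card_filter]
    congr 1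
    ext A
    simp only [mem_powersetCard, mem_filter, primeSteps, subset_iff]
    constructor
    · exact fun ⟨h1, h2⟩ => ⟨⟨fun a ha => (h1 ha).1, h2⟩, fun m hm => (h1 hm).2⟩
    · exact fun ⟨⟨h1, h2⟩, h3⟩ => ⟨fun a ha => ⟨h1 ha, h3 a ha⟩, h2⟩
  simp_rw [Nat.descFactorial_eq_factorial_mul_choose, h]
  rw [← Finset.mul_sum, Finset.sum_comm]
  congr 1
  refine Finset.sum_congr rfl fun A _ => ?_
  rw [primeBases, card_filter]

open Finset in
theorem sum_range_eq_sum_Icc_mod (q : ℕ) (h : ℕ → ℝ) :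
    ∑ a ∈ range q, h a = ∑ n ∈ Icc 1 q, h ((n + 1) % q) := by
  have e : (Icc 1 q).image (fun n => (n + 1) % q) = range q := by
    have := Nat.image_Ico_mod 2 q
    rw [← this]
    ext a
    simp only [mem_image, mem_Icc, mem_Ico]
    constructor
    · rintro ⟨n, hn, rfl⟩
      exact ⟨n + 1, by omega, rfl⟩
    · rintro ⟨n, hn, rfl⟩
      exact ⟨n - 1, by omega, by rw [Nat.sub_add_cancel (by omega)]⟩
  have hinj : Set.InjOn (fun n => (n + 1) % q) (Icc 1 q) := by
    refine Finset.injOn_of_card_image_eq ?_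
    rw [e]; simp
  rw [← e, Finset.sum_image hinj]

open Finset in
theorem primeCountAP_le_card_primeSteps {N q M n : ℕ} (hN : N ≤ q * M + 1) (hn : n ∈ Icc 1 q) :
    primeCountAP N q ((n + 1) % q) ≤ #(primeSteps q M n) := by
  rw [mem_Icc] at hn
  have hsub : (Icc 1 N).filter (fun p => p.Prime ∧ p ≡ (n + 1) % q [MOD q])
      ⊆ (primeSteps q M n).image fun m => n + (1 + q * m) := by
    intro p hp
    simp only [mem_filter, mem_Icc] at hp
    obtain ⟨⟨-, hpN⟩, hpp, hmod⟩ := hp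
    have hmod' : p ≡ n + 1 [MOD q] := hmod.trans (Nat.mod_modEq _ _)
    have h2 := hpp.two_le
    -- As n + 1 lies in [2, q + 1], it is the least integer ≥ 2 in its class, so no prime of the
    -- class lies below it.
    have hge : n + 1 ≤ p := by
      by_contra hlt
      have hd : q ∣ n + 1 - p := (Nat.modEq_iff_dvd' (by omega)).mp hmod'
      have := Nat.le_of_dvd (by omega) hd
      omega
    obtain ⟨m, hm⟩ := (Nat.modEq_iff_dvd' hge).mp hmod'.symm
    have hpe : n + (1 + q * m) = p := by omega
    refine mem_image.mpr ⟨m, ?_, hpe⟩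
    simp only [primeSteps, mem_filter, mem_range, hpe]
    refine ⟨?_, hpp⟩
    have : q * m < q * M := by omega
    exact Nat.lt_of_mul_lt_mul_left this
  exact (card_le_card hsub).trans card_image_le

open Finset in
theorem card_primeSteps_le_primeCountAP {N q M n : ℕ} (hN : q * M + 1 ≤ N) (hn : n ∈ Icc 1 q) :
    #(primeSteps q M n) ≤ primeCountAP N q ((n + 1) % q) := by
  rw [mem_Icc] at hn
  refine card_le_card_of_injOn (fun m => n + (1 + q * m)) ?_ ?_
  · intro m hm
    have hm' : m ∈ primeSteps q M n := hm
    simp only [primeSteps, mem_filter, mem_range] at hm'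
    have : q * (m + 1) ≤ q * M := Nat.mul_le_mul_left q hm'.1
    rw [mul_add] at this
    simp only [coe_filter, Set.mem_ofPred_eq, mem_Icc]
    refine ⟨⟨by omega, by omega⟩, hm'.2, ?_⟩
    refine Nat.ModEq.trans ?_ (Nat.mod_modEq _ _).symm
    rw [← add_assoc]
    unfold Nat.ModEq
    rw [Nat.add_mul_mod_self_left]
  · intro a _ b _ h
    simp only [Nat.add_left_cancel_iff] at h
    exact Nat.eq_of_mul_eq_mul_left (by omega) h

open Finset in
-- The gcd of n + 1 and q divides every term, so a prime term equals it and divides q. Terms with m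
-- > 0 exceed q, hence only n + 1 itself can be prime.
theorem primeSteps_subset_of_not_coprime {q M n : ℕ} (hn : n ∈ Icc 1 q)
    (hc : ¬ Nat.Coprime (n + 1) q) :
    primeSteps q M n ⊆ if n + 1 ∈ q.primeFactors then {0} else ∅ := by
  rw [mem_Icc] at hn
  intro m hm
  simp only [primeSteps, mem_filter, mem_range] at hm
  have hp := hm.2
  have hg : Nat.gcd (n + 1) q ∣ n + (1 + q * m) := by
    rw [← add_assoc]
    exact dvd_add (Nat.gcd_dvd_left _ _) ((Nat.gcd_dvd_right _ _).mul_right m)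
  have hgp := ((Nat.dvd_prime hp).mp hg).resolve_left hc
  have hpq : n + (1 + q * m) ∣ q := hgp ▸ Nat.gcd_dvd_right (n + 1) q
  have hle := Nat.le_of_dvd (by omega) hpq
  have hm0 : m = 0 := by
    by_contra h
    have : q * 1 ≤ q * m := Nat.mul_le_mul_left q (Nat.pos_of_ne_zero h)
    omega
  subst hm0
  simp only [mul_zero, add_zero] at hp hpq
  rw [if_pos (Nat.mem_primeFactors.mpr ⟨hp, hpq, by omega⟩)]
  exact mem_singleton_self 0

open Finset in
theorem totient_mul_primeMoment (k N q : ℕ) (hq : q ≠ 0) :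
    (Nat.totient q : ℝ) * primeMoment k N q = ∑ n ∈ Icc 1 q with Nat.Coprime (n + 1) q,
      (primeCountAP N q ((n + 1) % q) : ℝ) ^ k := by
  have hφ : (Nat.totient q : ℝ) ≠ 0 := by
    exact_mod_cast (Nat.totient_pos.mpr (Nat.pos_of_ne_zero hq)).ne'
  unfold primeMoment
  rw [← mul_assoc, mul_one_div_cancel hφ, one_mul, sum_filter, sum_range_eq_sum_Icc_mod, sum_filter]
  refine sum_congr rfl fun n _ => ?_
  have : Nat.Coprime ((n + 1) % q) q ↔ Nat.Coprime (n + 1) q := by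
    unfold Nat.Coprime
    rw [← Nat.gcd_rec, Nat.gcd_comm]
  simp only [this]

open Finset in
theorem totient_mul_primeMoment_le {k N q M : ℕ} (hq : q ≠ 0) (hN : N ≤ q * M + 1) :
    (Nat.totient q : ℝ) * primeMoment k N q ≤ ∑ n ∈ Icc 1 q, (#(primeSteps q M n) : ℝ) ^ k := by
  rw [totient_mul_primeMoment k N q hq]
  refine (sum_le_sum fun n hn => ?_).trans
    (sum_le_sum_of_subset_of_nonneg (filter_subset _ _) fun _ _ _ => by positivity)
  gcongr
  exact primeCountAP_le_card_primeSteps hN (mem_filter.mp hn).1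

open Finset in
theorem le_totient_mul_primeMoment {k N q M : ℕ} (hk : k ≠ 0) (hq : q ≠ 0) (hN : q * M + 1 ≤ N) :
    ∑ n ∈ Icc 1 q, (#(primeSteps q M n) : ℝ) ^ k
      ≤ (Nat.totient q : ℝ) * primeMoment k N q + Nat.log 2 q := by
  rw [totient_mul_primeMoment k N q hq,
    ← sum_filter_add_sum_filter_not (Icc 1 q) (fun n => Nat.Coprime (n + 1) q)]
  refine add_le_add (sum_le_sum fun n hn => ?_) ?_
  · gcongr
    exact card_primeSteps_le_primeCountAP hN (mem_filter.mp hn).1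
  · calc ∑ n ∈ Icc 1 q with ¬ Nat.Coprime (n + 1) q, (#(primeSteps q M n) : ℝ) ^ k
        ≤ ∑ n ∈ Icc 1 q with ¬ Nat.Coprime (n + 1) q,
            if n + 1 ∈ q.primeFactors then (1 : ℝ) else 0 := by
          refine sum_le_sum fun n hn => ?_
          have h := card_le_card (primeSteps_subset_of_not_coprime (M := M) (mem_filter.mp hn).1
            (mem_filter.mp hn).2)
          split_ifs at h ⊢
          · rw [card_singleton] at h
            exact pow_le_one₀ (Nat.cast_nonneg _) (by exact_mod_cast h)
          · rw [card_empty, Nat.le_zero] at h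
            rw [h]; simp [hk]
      _ ≤ (q.primeFactors.card : ℝ) := by
          rw [sum_boole]
          refine Nat.cast_le.mpr (card_le_card_of_injOn (fun n => n + 1) ?_ ?_)
          · intro n hn
            exact (mem_filter.mp (mem_coe.mp hn)).2
          · intro a _ b _ h
            exact Nat.add_right_cancel h
      _ ≤ _ := by exact_mod_cast card_primeFactors_le_log q hq

/-! ### From primes to von Mangoldt weights and the conjecture -/

open ArithmeticFunction in
/-- The von Mangoldt weighted count of the `n ≤ q` with all `n + 1 + q m`, `m ∈ A`, prime. -/
noncomputable def mangoldtCount (q : ℕ) (A : Finset ℕ) : ℝ :=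
  ∑ n ∈ Finset.Icc 1 q, ∏ m ∈ A, vonMangoldt (n + (1 + q * m))

open ArithmeticFunction Finset in
-- For n > U every prime involved exceeds U, so its weight is at least log U; the n ≤ U are counted
-- trivially.
theorem card_primeBases_mul_log_pow_le (q : ℕ) (A : Finset ℕ) {U : ℝ} (hU : 1 ≤ U) :
    (#(primeBases q A) : ℝ) * Real.log U ^ #A ≤ U * Real.log U ^ #A + mangoldtCount q A := by
  have hlog : 0 ≤ Real.log U := Real.log_nonneg hU
  have h1 : (#{n ∈ primeBases q A | ((n : ℕ) : ℝ) ≤ U} : ℝ) ≤ U := by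
    have : #{n ∈ primeBases q A | ((n : ℕ) : ℝ) ≤ U} ≤ #(Icc 1 ⌊U⌋₊) := by
      refine card_le_card fun n hn => ?_
      simp only [primeBases, mem_filter, mem_Icc] at hn ⊢
      exact ⟨hn.1.1.1, Nat.le_floor hn.2⟩
    rw [Nat.card_Icc] at this
    refine le_trans ?_ (Nat.floor_le (by linarith : 0 ≤ U))
    exact_mod_cast this
  have h2 : (#{n ∈ primeBases q A | ¬ ((n : ℕ) : ℝ) ≤ U} : ℝ) * Real.log U ^ #A ≤ mangoldtCount q A := by
    unfold mangoldtCount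
    rw [← nsmul_eq_mul, ← sum_const]
    refine (sum_le_sum fun n hn => ?_).trans (sum_le_sum_of_subset_of_nonneg
      ((filter_subset _ _).trans (filter_subset _ _)) fun n _ _ =>
        prod_nonneg fun m _ => vonMangoldt_nonneg)
    rw [mem_filter, primeBases, mem_filter] at hn
    rw [← prod_const]
    refine prod_le_prod (fun _ _ => hlog) fun m hm => ?_
    rw [vonMangoldt_apply_prime (hn.1.2 m hm)]
    refine Real.log_le_log (by linarith) ?_
    have := not_le.mp hn.2
    push_cast
    nlinarith [(by positivity : (0 : ℝ) ≤ (q : ℝ) * m)]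
  have h3 := card_filter_add_card_filter_not (s := primeBases q A) (fun n => ((n : ℕ) : ℝ) ≤ U)
  rw [← h3]
  push_cast
  rw [add_mul]
  refine add_le_add (mul_le_mul_of_nonneg_right h1 (by positivity)) h2

open ArithmeticFunction Finset in
-- If some entry is not prime, its weight is kept and the other factors are bounded by log V. For
-- fixed m these entries are distinct integers up to V, so their weights add up to at most ψ(V) -
-- θ(V).
theorem mangoldtCount_le (q M : ℕ) (A : Finset ℕ) (hA : A ⊆ range M) {i : ℕ} (hi : #A = i + 1)
    {V : ℕ} (hV : q + (1 + q * M) ≤ V) :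
    mangoldtCount q A ≤ #(primeBases q A) * Real.log V ^ (i + 1)
      + (i + 1) * (Chebyshev.psi V - Chebyshev.theta V) * Real.log V ^ i := by
  have hV1 : 1 ≤ V := by omega
  have hle : ∀ n ∈ Icc 1 q, ∀ m ∈ A, n + (1 + q * m) ≤ V := by
    intro n hn m hm
    have h1 := (mem_Icc.mp hn).2
    have h2 : q * m ≤ q * M := Nat.mul_le_mul_left q (mem_range.mp (hA hm)).le
    omega
  have hΛ : ∀ n ∈ Icc 1 q, ∀ m ∈ A, vonMangoldt (n + (1 + q * m)) ≤ Real.log V := by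
    intro n hn m hm
    refine vonMangoldt_le_log.trans (Real.log_le_log ?_ ?_)
    · have : 0 < n + (1 + q * m) := by omega
      exact_mod_cast this
    · exact_mod_cast hle n hn m hm
  have hlog : 0 ≤ Real.log V := Real.log_natCast_nonneg V
  have hpt : ∀ n ∈ Icc 1 q, ∏ m ∈ A, vonMangoldt (n + (1 + q * m))
      ≤ (if ∀ m ∈ A, (n + (1 + q * m)).Prime then Real.log V ^ (i + 1) else 0)
        + ∑ m ∈ A, (if (n + (1 + q * m)).Prime then 0 else vonMangoldt (n + (1 + q * m)))
            * Real.log V ^ i := by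
    intro n hn
    have hs0 : ∀ m ∈ A, 0 ≤ (if (n + (1 + q * m)).Prime then 0 else vonMangoldt (n + (1 + q * m)))
            * Real.log V ^ i := fun m _ => by
      refine mul_nonneg ?_ (by positivity)
      split_ifs
      · exact le_rfl
      · exact vonMangoldt_nonneg
    split_ifs with h
    · refine le_trans ?_ (le_add_of_nonneg_right (sum_nonneg hs0))
      rw [← hi, ← prod_const]
      exact prod_le_prod (fun _ _ => vonMangoldt_nonneg) fun m hm => hΛ n hn m hm
    · push Not at h
      obtain ⟨m, hm, hnp⟩ := h
      rw [zero_add]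
      refine le_trans ?_ (single_le_sum hs0 hm)
      rw [if_neg hnp, ← mul_prod_erase A _ hm]
      refine mul_le_mul_of_nonneg_left ?_ vonMangoldt_nonneg
      have hc : #(A.erase m) = i := by rw [card_erase_of_mem hm, hi]; rfl
      rw [← hc, ← prod_const]
      exact prod_le_prod (fun _ _ => vonMangoldt_nonneg)
        fun m' hm' => hΛ n hn m' (mem_of_mem_erase hm')
  have hnon : ∀ m ∈ A, ∑ n ∈ Icc 1 q,
      (if (n + (1 + q * m)).Prime then 0 else vonMangoldt (n + (1 + q * m)))
        ≤ Chebyshev.psi V - Chebyshev.theta V := by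
    intro m hm
    rw [Chebyshev.psi_sub_theta_eq_sum_not_prime, Nat.floor_natCast, sum_filter]
    rw [← sum_image (f := fun k => if k.Prime then 0 else vonMangoldt k)
      (g := fun n => n + (1 + q * m)) (fun a _ b _ h => Nat.add_right_cancel h)]
    refine (sum_le_sum_of_subset_of_nonneg (t := Ioc 0 V) ?_ ?_).trans
      (sum_le_sum fun k _ => ?_)
    · intro k hk
      obtain ⟨n, hn, rfl⟩ := mem_image.mp hk
      exact mem_Ioc.mpr ⟨by omega, hle n hn m hm⟩
    · intro k _ _
      split_ifs
      · exact le_rfl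
      · exact vonMangoldt_nonneg
    · split_ifs <;> simp_all
  unfold mangoldtCount
  refine (sum_le_sum hpt).trans ?_
  rw [sum_add_distrib]
  refine add_le_add (le_of_eq ?_) ?_
  · rw [primeBases, ← sum_filter, sum_const, nsmul_eq_mul]
  · rw [sum_comm]
    simp_rw [← sum_mul]
    refine mul_le_mul_of_nonneg_right ?_ (by positivity)
    calc _ ≤ ∑ m ∈ A, (Chebyshev.psi V - Chebyshev.theta V) := sum_le_sum hnon
      _ = _ := by rw [sum_const, nsmul_eq_mul, hi]; push_cast; ring

open Finset in
-- The conjecture is used with modulus 1 and summation length q, so the coprimality condition is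
-- void and q enters only through the shifts. The summand 1 in 1 + qm keeps the shift for m = 0
-- positive, as the hypothesis demands.
theorem abs_mangoldtCount_sub_le {δ C : ℝ} {k : ℕ}
    (hHL : ∀ q N D : ℕ, 1 ≤ q → 1 ≤ N → 1 ≤ D →
        ∀ 𝒟 : Finset ℕ, 𝒟 ⊆ Finset.Icc 1 D → 𝒟.card = k → (∀ d ∈ 𝒟, q ∣ d) →
          |(∑ n ∈ coprimesUpTo N q, ∏ d ∈ 𝒟, ArithmeticFunction.vonMangoldt (n + d))
              - singularSeries 𝒟 q * ((coprimesUpTo N q).card : ℝ)|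
            ≤ C * ((N : ℝ) + (D : ℝ)) ^ (1 - δ))
    {q M : ℕ} (hq : q ≠ 0) {A : Finset ℕ} (hA : A ⊆ range M) (hk : #A = k) :
    |mangoldtCount q A - q * singularSeries (progressionShifts q A) 1|
      ≤ C * ((q : ℝ) + (1 + q * M)) ^ (1 - δ) := by
  have h := hHL 1 q (1 + q * M) le_rfl (Nat.pos_of_ne_zero hq) (by omega) (progressionShifts q A)
    (by
      intro d hd
      obtain ⟨m, hm, rfl⟩ := mem_image.mp hd
      have := Nat.mul_le_mul_left q (mem_range.mp (hA hm)).le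
      exact mem_Icc.mpr ⟨by omega, by omega⟩)
    (by rw [card_progressionShifts hq, hk]) (fun d _ => one_dvd d)
  have e : coprimesUpTo q 1 = Icc 1 q := by
    unfold coprimesUpTo
    exact filter_true_of_mem fun n _ => Nat.coprime_one_right n
  rw [e, Nat.card_Icc, Nat.add_sub_cancel] at h
  have e2 : ∑ n ∈ Icc 1 q, ∏ d ∈ progressionShifts q A, ArithmeticFunction.vonMangoldt (n + d)
      = mangoldtCount q A := by
    unfold mangoldtCount progressionShifts
    refine sum_congr rfl fun n _ => ?_
    rw [prod_image fun a _ b _ h => progression_injective hq h]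
  rw [e2, mul_comm] at h
  push_cast at h
  exact h

/-! ### The window for φ(q) and the sifting level -/

open Filter Asymptotics Topology

/-- The filter `N → ∞` on pairs `(N, q)` with `c₁ N / log N ≤ φ(q) ≤ c₂ N / log N`. -/
def totientWindow (c₁ c₂ : ℝ) : Filter (ℕ × ℕ) :=
  comap Prod.fst atTop ⊓ 𝓟 {x | 1 ≤ x.2 ∧
    c₁ * ((x.1 : ℝ) / Real.log x.1) ≤ Nat.totient x.2 ∧
    (Nat.totient x.2 : ℝ) ≤ c₂ * ((x.1 : ℝ) / Real.log x.1)}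

section Basic

variable {c₁ c₂ : ℝ}

theorem totientWindow_tendsto_fst : Tendsto Prod.fst (totientWindow c₁ c₂) atTop :=
  tendsto_comap.mono_left inf_le_left

theorem totientWindow_eventually_mem : ∀ᶠ x in totientWindow c₁ c₂, 1 ≤ x.2 ∧
    c₁ * ((x.1 : ℝ) / Real.log x.1) ≤ Nat.totient x.2 ∧
    (Nat.totient x.2 : ℝ) ≤ c₂ * ((x.1 : ℝ) / Real.log x.1) :=
  mem_inf_of_right (mem_principal_self _)

theorem totientWindow_tendsto_cast :
    Tendsto (fun x : ℕ × ℕ => (x.1 : ℝ)) (totientWindow c₁ c₂) atTop :=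
  tendsto_natCast_atTop_atTop.comp totientWindow_tendsto_fst

theorem totientWindow_tendsto_log :
    Tendsto (fun x : ℕ × ℕ => Real.log x.1) (totientWindow c₁ c₂) atTop :=
  Real.tendsto_log_atTop.comp totientWindow_tendsto_cast

theorem totientWindow_tendsto_loglog :
    Tendsto (fun x : ℕ × ℕ => Real.log (Real.log x.1)) (totientWindow c₁ c₂) atTop :=
  Real.tendsto_log_atTop.comp totientWindow_tendsto_log

theorem tendsto_div_log_atTop : Tendsto (fun t : ℝ => t / Real.log t) atTop atTop := by
  have h : Tendsto (fun t : ℝ => Real.exp t / t ^ 1) atTop atTop :=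
    Real.tendsto_exp_div_pow_atTop 1
  refine (h.comp Real.tendsto_log_atTop).congr' ?_
  filter_upwards [eventually_gt_atTop 0] with t ht
  simp [Real.exp_log ht]

theorem tendsto_log_div_atTop : Tendsto (fun t : ℝ => Real.log t / t) atTop (𝓝 0) := by
  refine (tendsto_inv_atTop_zero.comp tendsto_div_log_atTop).congr fun t => ?_
  simp

/-- The relative error `log log N / log N`. -/
noncomputable def relError (x : ℕ × ℕ) : ℝ := Real.log (Real.log x.1) / Real.log x.1

theorem relError_tendsto : Tendsto relError (totientWindow c₁ c₂) (𝓝 0) :=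
  tendsto_log_div_atTop.comp totientWindow_tendsto_log

/-- The window controls φ(q) rather than q; this crude bound suffices to deduce log q ≪ log N. -/
theorem le_totient_sq_eventually :
    ∀ᶠ q : ℕ in atTop, (q : ℝ) ≤ (Nat.totient q : ℝ) ^ 2 := by
  have h1 : ∀ᶠ t : ℝ in atTop, 160 * (Real.log t / Real.log 2 + 1) ≤ t ^ (1 / 2 : ℝ) := by
    have ho := (isLittleO_log_rpow_atTop (by norm_num : (0 : ℝ) < 1 / 2)).bound
      (by norm_num : (0 : ℝ) < 1 / 480)
    have hr := (tendsto_rpow_atTop (by norm_num : (0 : ℝ) < 1 / 2)).eventually_ge_atTop 480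
    filter_upwards [ho, hr, eventually_ge_atTop 1] with t h1 h2 h3
    rw [Real.norm_of_nonneg (Real.log_nonneg h3), Real.norm_of_nonneg (by linarith)] at h1
    have hl2 : 0.69 < Real.log 2 := by have := Real.log_two_gt_d9; linarith
    have : Real.log t / Real.log 2 ≤ 2 * Real.log t := by
      rw [div_le_iff₀ (by linarith)]
      nlinarith [Real.log_nonneg h3]
    linarith
  filter_upwards [tendsto_natCast_atTop_atTop.eventually h1, eventually_ge_atTop 1] with q hq hq1
  have hq0 : q ≠ 0 := by omega
  have hφ : (0 : ℝ) < Nat.totient q := by exact_mod_cast Nat.totient_pos.mpr hq1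
  have h2 := div_totient_le (2 * Nat.log 2 q + 2) q (by omega) hq0 (by omega)
  have h3 : Real.log ((2 * Nat.log 2 q + 2 : ℕ) : ℝ) ≤ ((2 * Nat.log 2 q + 2 : ℕ) : ℝ) :=
    Real.log_le_self (Nat.cast_nonneg _)
  have h4 : (Nat.log 2 q : ℝ) ≤ Real.log q / Real.log 2 := by
    have := Real.natLog_le_logb q 2
    simpa [Real.logb] using this
  push_cast at h3
  have h5 : (q : ℝ) / Nat.totient q ≤ (q : ℝ) ^ (1 / 2 : ℝ) := by
    push_cast at h2
    linarith
  rw [← Real.sqrt_eq_rpow, div_le_iff₀ hφ] at h5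
  have hs : (0 : ℝ) < Real.sqrt q := Real.sqrt_pos.mpr (by exact_mod_cast hq1)
  have h6 : Real.sqrt q ≤ Nat.totient q := by
    refine le_of_mul_le_mul_left ?_ hs
    rw [Real.mul_self_sqrt (Nat.cast_nonneg _)]
    exact h5
  calc (q : ℝ) = Real.sqrt q ^ 2 := (Real.sq_sqrt (Nat.cast_nonneg _)).symm
    _ ≤ _ := by gcongr

theorem tendsto_snd_totientWindow (hc₁ : 0 < c₁) :
    Tendsto Prod.snd (totientWindow c₁ c₂) atTop := by
  have h : Tendsto (fun x : ℕ × ℕ => (x.2 : ℝ)) (totientWindow c₁ c₂) atTop := by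
    refine tendsto_atTop_mono' _ ?_
      ((tendsto_div_log_atTop.comp totientWindow_tendsto_cast).const_mul_atTop hc₁)
    filter_upwards [totientWindow_eventually_mem] with x hx
    exact hx.2.1.trans (by exact_mod_cast Nat.totient_le x.2)
  exact tendsto_natCast_atTop_iff.mp h

theorem natLog_le_eventually (hc₁ : 0 < c₁) :
    ∀ᶠ x in totientWindow c₁ c₂, (Nat.log 2 x.2 : ℝ) ≤ 3 * Real.log x.1 := by
  filter_upwards [(tendsto_snd_totientWindow hc₁).eventually le_totient_sq_eventually,
    totientWindow_eventually_mem, totientWindow_tendsto_log.eventually_ge_atTop c₂,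
    totientWindow_tendsto_log.eventually_gt_atTop 0,
    totientWindow_tendsto_cast.eventually_gt_atTop 0] with x h1 h2 h3 h4 h5
  have hq : (0 : ℝ) < x.2 := by exact_mod_cast h2.1
  have hN : (Nat.totient x.2 : ℝ) ≤ x.1 := by
    refine h2.2.2.trans ?_
    rw [mul_div_assoc', div_le_iff₀ h4, mul_comm]
    gcongr
  have hqN : Real.log x.2 ≤ 2 * Real.log x.1 := by
    have : (x.2 : ℝ) ≤ (x.1 : ℝ) ^ 2 := h1.trans (by gcongr)
    have := Real.log_le_log hq this
    rw [Real.log_pow] at this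
    exact_mod_cast this
  have h6 : (Nat.log 2 x.2 : ℝ) ≤ Real.log x.2 / Real.log 2 := by
    have := Real.natLog_le_logb x.2 2
    simpa [Real.logb] using this
  have hl2 : 0.69 < Real.log 2 := by have := Real.log_two_gt_d9; linarith
  refine h6.trans ?_
  rw [div_le_iff₀ (by linarith)]
  nlinarith

/-- The sifting level `⌊(log N)²⌋`. -/
noncomputable def siftLevel (x : ℕ × ℕ) : ℕ := ⌊Real.log x.1 ^ 2⌋₊

/-- Squaring log N makes the level exceed both 2 log₂ q and the length M, which are O(log N), and
makes 1/y negligible. Its logarithm is still O(log log N). -/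
theorem siftLevel_eventually : ∀ᶠ x in totientWindow c₁ c₂, 2 ≤ siftLevel x ∧
    6 * Real.log x.1 ≤ siftLevel x ∧ Real.log (siftLevel x) ≤ 2 * Real.log (Real.log x.1) ∧
    Real.log x.1 ^ 2 ≤ siftLevel x + 1 := by
  filter_upwards [totientWindow_tendsto_log.eventually_ge_atTop 7] with x hx
  have h1 : Real.log x.1 ^ 2 < siftLevel x + 1 := Nat.lt_floor_add_one _
  have h2 : (siftLevel x : ℝ) ≤ Real.log x.1 ^ 2 := Nat.floor_le (by positivity)
  have h3 : 6 * Real.log x.1 ≤ siftLevel x := by nlinarith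
  have h4 : (2 : ℝ) ≤ siftLevel x := by linarith
  refine ⟨by exact_mod_cast h4, h3, ?_, h1.le⟩
  calc Real.log (siftLevel x) ≤ Real.log (Real.log x.1 ^ 2) := Real.log_le_log (by linarith) h2
    _ = _ := by rw [Real.log_pow]; norm_num

theorem div_totient_eventually (hc₁ : 0 < c₁) : ∀ᶠ x in totientWindow c₁ c₂,
    (x.2 : ℝ) / Nat.totient x.2 ≤ 160 * Real.log (Real.log x.1) * siftedDensity (siftLevel x) x.2 ∧
    (x.2 : ℝ) / Nat.totient x.2 ≤ 160 * Real.log (Real.log x.1) := by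
  filter_upwards [siftLevel_eventually, natLog_le_eventually hc₁, totientWindow_eventually_mem,
    totientWindow_tendsto_loglog.eventually_ge_atTop 0]
    with x hs hlog hx hll
  have h := le_siftedDensity (siftLevel x) x.2 hs.1 (by omega) (by
    have : (2 : ℝ) * Nat.log 2 x.2 ≤ siftLevel x := by linarith [hs.2.1]
    exact_mod_cast this)
  have hρ := siftedDensity_pos (siftLevel x) x.2
  have h1 : (x.2 : ℝ) / Nat.totient x.2
      ≤ 160 * Real.log (Real.log x.1) * siftedDensity (siftLevel x) x.2 := by
    refine h.trans (mul_le_mul_of_nonneg_right ?_ hρ.le)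
    linarith [hs.2.2.1]
  exact ⟨h1, h1.trans (mul_le_of_le_one_right (by positivity) (siftedDensity_le_one _ _))⟩

end Basic

/-! ### Calculus of functions of the form 1 + O(η) -/

section OneAddBigO

variable {α : Type*} {l : Filter α} {η f g : α → ℝ}

theorem isBigO_mul_sub_one (hη : Tendsto η l (𝓝 0)) (hf : (fun x => f x - 1) =O[l] η)
    (hg : (fun x => g x - 1) =O[l] η) : (fun x => f x * g x - 1) =O[l] η := by
  have h1 : (fun x => (f x - 1) * (g x - 1)) =O[l] η := by
    have := hf.mul (hg.trans (hη.isBigO_one ℝ))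
    simpa using this
  refine ((h1.add hf).add hg).congr_left fun x => ?_
  ring

theorem isBigO_pow_sub_one (hη : Tendsto η l (𝓝 0)) (hf : (fun x => f x - 1) =O[l] η) (j : ℕ) :
    (fun x => f x ^ j - 1) =O[l] η := by
  induction j with
  | zero => simpa using isBigO_zero η l
  | succ j ih => simpa only [pow_succ] using isBigO_mul_sub_one hη ih hf

theorem tendsto_one_of_isBigO_sub_one (hη : Tendsto η l (𝓝 0))
    (hf : (fun x => f x - 1) =O[l] η) : Tendsto f l (𝓝 1) := by
  have := (hf.trans_tendsto hη).add_const 1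
  simpa using this

theorem isBigO_inv_sub_one (hη : Tendsto η l (𝓝 0)) (hf : (fun x => f x - 1) =O[l] η) :
    (fun x => (f x)⁻¹ - 1) =O[l] η := by
  have ht := tendsto_one_of_isBigO_sub_one hη hf
  have h1 : (fun x => (f x)⁻¹) =O[l] (fun _ => (1 : ℝ)) := (ht.inv₀ one_ne_zero).isBigO_one ℝ
  have h2 : (fun x => (f x)⁻¹ * (f x - 1)) =O[l] η := by simpa using h1.mul hf
  refine h2.neg_left.congr' ?_ EventuallyEq.rfl
  filter_upwards [ht.eventually_ne one_ne_zero] with x hx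
  field_simp
  ring

theorem isBigO_sub_one_of_le_of_le {a b : α → ℝ} (ha : (fun x => a x - 1) =O[l] η)
    (hb : (fun x => b x - 1) =O[l] η) (haf : ∀ᶠ x in l, a x ≤ f x) (hfb : ∀ᶠ x in l, f x ≤ b x) :
    (fun x => f x - 1) =O[l] η := by
  refine IsBigO.trans ?_ (ha.abs_left.add hb.abs_left)
  refine IsBigO.of_bound 1 ?_
  filter_upwards [haf, hfb] with x h1 h2
  rw [one_mul, Real.norm_eq_abs, Real.norm_eq_abs,
    abs_of_nonneg (add_nonneg (abs_nonneg (a x - 1)) (abs_nonneg (b x - 1))), abs_le]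
  have h3 := neg_abs_le (a x - 1)
  have h4 := le_abs_self (b x - 1)
  have h5 := abs_nonneg (a x - 1)
  have h6 := abs_nonneg (b x - 1)
  constructor <;> linarith

theorem isBigO_add_sub_one (hf : (fun x => f x - 1) =O[l] η) (hg : g =O[l] η) :
    (fun x => f x + g x - 1) =O[l] η :=
  (hf.add hg).congr_left fun x => by ring

end OneAddBigO

/-! ### Sizes in the window and the averaged singular series -/

section Window

variable {c₁ c₂ : ℝ} {M : ℕ × ℕ → ℕ}

theorem div_le_relError (hc₁ : 0 < c₁) : ∀ᶠ x in totientWindow c₁ c₂,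
    (x.2 : ℝ) / x.1 ≤ 160 * c₂ * relError x := by
  filter_upwards [div_totient_eventually hc₁, totientWindow_eventually_mem,
    totientWindow_tendsto_log.eventually_gt_atTop 0,
    totientWindow_tendsto_cast.eventually_gt_atTop 0,
    totientWindow_tendsto_loglog.eventually_ge_atTop 0] with x h1 h2 hL hN hll
  have hφ : (0 : ℝ) < Nat.totient x.2 := by exact_mod_cast Nat.totient_pos.mpr h2.1
  have h3 := h1.2
  rw [div_le_iff₀ hφ] at h3
  rw [div_le_iff₀ hN]
  calc (x.2 : ℝ) ≤ 160 * Real.log (Real.log x.1) * Nat.totient x.2 := h3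
    _ ≤ 160 * Real.log (Real.log x.1) * (c₂ * (x.1 / Real.log x.1)) := by
        gcongr; exact h2.2.2
    _ = _ := by unfold relError; ring

/-- The tolerance q + 1 in `hM` admits both ⌊(N-1)/q⌋ and its successor as M. Relative to N it is
O(q/N), and q ≪ φ(q) log log N. -/
theorem progression_length_isBigO (hc₁ : 0 < c₁) (hc₂ : 0 < c₂)
    (hM : ∀ᶠ x in totientWindow c₁ c₂, |(x.2 : ℝ) * M x - x.1| ≤ x.2 + 1) :
    (fun x : ℕ × ℕ => (x.2 : ℝ) * M x / x.1 - 1) =O[totientWindow c₁ c₂] relError := by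
  refine IsBigO.of_bound (320 * c₂) ?_
  filter_upwards [hM, div_le_relError hc₁, totientWindow_eventually_mem,
    totientWindow_tendsto_cast.eventually_gt_atTop 0] with x h1 h2 h3 hN
  have hq : (1 : ℝ) ≤ x.2 := by exact_mod_cast h3.1
  have e : (x.2 : ℝ) * M x / x.1 - 1 = (x.2 * M x - x.1) / x.1 := by field_simp
  rw [e, norm_div, Real.norm_eq_abs, Real.norm_of_nonneg hN.le]
  calc _ ≤ ((x.2 : ℝ) + 1) / x.1 := by gcongr
    _ ≤ 2 * ((x.2 : ℝ) / x.1) := by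
        rw [mul_div_assoc']; gcongr; linarith
    _ ≤ 2 * (160 * c₂ * relError x) := by gcongr
    _ = 320 * c₂ * relError x := by ring
    _ ≤ 320 * c₂ * ‖relError x‖ := by gcongr; exact Real.le_norm_self _

theorem progression_length_bounds (hc₁ : 0 < c₁) (hc₂ : 0 < c₂)
    (hM : ∀ᶠ x in totientWindow c₁ c₂, |(x.2 : ℝ) * M x - x.1| ≤ x.2 + 1) :
    ∀ᶠ x in totientWindow c₁ c₂, (x.1 : ℝ) / 2 ≤ x.2 * M x ∧ (x.2 : ℝ) * M x ≤ 2 * x.1 := by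
  have ht := tendsto_one_of_isBigO_sub_one relError_tendsto
    (progression_length_isBigO hc₁ hc₂ hM)
  filter_upwards [ht.eventually_const_le (by norm_num : (1 / 2 : ℝ) < 1),
    ht.eventually_le_const (by norm_num : (1 : ℝ) < 2),
    totientWindow_tendsto_cast.eventually_gt_atTop 0] with x h1 h2 hN
  rw [le_div_iff₀ hN] at h1
  rw [div_le_iff₀ hN] at h2
  constructor <;> linarith

theorem steps_le (hc₁ : 0 < c₁) (hc₂ : 0 < c₂)
    (hM : ∀ᶠ x in totientWindow c₁ c₂, |(x.2 : ℝ) * M x - x.1| ≤ x.2 + 1) :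
    ∀ᶠ x in totientWindow c₁ c₂, (M x : ℝ) ≤ 2 / c₁ * Real.log x.1 := by
  filter_upwards [progression_length_bounds hc₁ hc₂ hM, totientWindow_eventually_mem,
    totientWindow_tendsto_log.eventually_gt_atTop 0,
    totientWindow_tendsto_cast.eventually_gt_atTop 0] with x h1 h2 hL hN
  have hq : c₁ * ((x.1 : ℝ) / Real.log x.1) ≤ x.2 :=
    h2.2.1.trans (by exact_mod_cast Nat.totient_le x.2)
  have h3 : c₁ * ((x.1 : ℝ) / Real.log x.1) * M x ≤ 2 * x.1 :=
    (mul_le_mul_of_nonneg_right hq (Nat.cast_nonneg _)).trans h1.2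
  have h4 : c₁ * ((x.1 : ℝ) / Real.log x.1) * M x = (x.1 / Real.log x.1) * (c₁ * M x) := by ring
  have h5 : (2 : ℝ) * x.1 = (x.1 / Real.log x.1) * (2 * Real.log x.1) := by field_simp
  rw [h4, h5] at h3
  have h6 := le_of_mul_le_mul_left h3 (by positivity)
  rw [div_mul_eq_mul_div, le_div_iff₀ hc₁]
  linarith

/-- This lower bound for the mean μ = Mρ is a source of the log log N in the theorem. It combines q
M ≥ N/2, q ≤ 160 ρ φ(q) log log N and φ(q) ≤ c₂ N / log N. -/
theorem le_steps_mul_siftedDensity (hc₁ : 0 < c₁) (hc₂ : 0 < c₂)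
    (hM : ∀ᶠ x in totientWindow c₁ c₂, |(x.2 : ℝ) * M x - x.1| ≤ x.2 + 1) :
    ∀ᶠ x in totientWindow c₁ c₂,
      Real.log x.1 ≤ 320 * c₂ * Real.log (Real.log x.1) *
        (M x * siftedDensity (siftLevel x) x.2) := by
  filter_upwards [progression_length_bounds hc₁ hc₂ hM, totientWindow_eventually_mem,
    div_totient_eventually hc₁,
    totientWindow_tendsto_log.eventually_gt_atTop 0,
    totientWindow_tendsto_loglog.eventually_ge_atTop 0,
    totientWindow_tendsto_cast.eventually_gt_atTop 0] with x h1 h2 h3 hL hll hN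
  have hφ : (0 : ℝ) < Nat.totient x.2 := by exact_mod_cast Nat.totient_pos.mpr h2.1
  have hρ := siftedDensity_pos (siftLevel x) x.2
  set ρ := siftedDensity (siftLevel x) x.2
  have h4 := h3.1
  rw [div_le_iff₀ hφ] at h4
  have h5 : (x.1 : ℝ) / 2 ≤ 160 * Real.log (Real.log x.1) * ρ *
      (c₂ * ((x.1 : ℝ) / Real.log x.1)) * M x := by
    refine h1.1.trans (mul_le_mul_of_nonneg_right (h4.trans ?_) (Nat.cast_nonneg _))
    gcongr
    exact h2.2.2
  have h6 : ((x.1 : ℝ) / (2 * Real.log x.1)) * Real.log x.1 ≤ ((x.1 : ℝ) / (2 * Real.log x.1)) *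
      (320 * c₂ * Real.log (Real.log x.1) * (M x * ρ)) := by
    calc ((x.1 : ℝ) / (2 * Real.log x.1)) * Real.log x.1 = (x.1 : ℝ) / 2 := by field_simp
      _ ≤ _ := h5
      _ = _ := by field_simp; ring
  exact le_of_mul_le_mul_left h6 (by positivity)

theorem le_steps (hc₁ : 0 < c₁) (hc₂ : 0 < c₂)
    (hM : ∀ᶠ x in totientWindow c₁ c₂, |(x.2 : ℝ) * M x - x.1| ≤ x.2 + 1) :
    ∀ᶠ x in totientWindow c₁ c₂,
      Real.log x.1 ≤ 320 * c₂ * Real.log (Real.log x.1) * M x := by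
  filter_upwards [le_steps_mul_siftedDensity hc₁ hc₂ hM,
    totientWindow_tendsto_loglog.eventually_ge_atTop 0] with x h hll
  refine h.trans ?_
  gcongr
  exact mul_le_of_le_one_right (Nat.cast_nonneg _) (siftedDensity_le_one _ _)

theorem steps_le_siftLevel (hc₁ : 0 < c₁) (hc₂ : 0 < c₂)
    (hM : ∀ᶠ x in totientWindow c₁ c₂, |(x.2 : ℝ) * M x - x.1| ≤ x.2 + 1) :
    ∀ᶠ x in totientWindow c₁ c₂, M x ≤ siftLevel x := by
  filter_upwards [steps_le hc₁ hc₂ hM, siftLevel_eventually,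
    totientWindow_tendsto_log.eventually_ge_atTop (2 / c₁ + 1),
    totientWindow_tendsto_log.eventually_ge_atTop 1] with x h1 h2 h3 h4
  have : (M x : ℝ) ≤ siftLevel x := by nlinarith [h2.2.2.2]
  exact_mod_cast this

/-- This is applied with t = log N. Since M may be as small as a constant times t / log t, the sieve
must stop at z with z^36 well below t. Taking z = ⌊t^(1/72)⌋ gives z^36 ≤ √t, and z ≥ t^(1/144)
keeps log z comparable to log t. -/
theorem exists_sieve_level {c : ℝ} (hc : 0 < c) : ∀ᶠ t : ℝ in atTop, ∃ z : ℕ, 2 ≤ z ∧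
    Real.log t ≤ 144 * Real.log z ∧ c * Real.log t * (z : ℝ) ^ 36 ≤ t := by
  have ho := (isLittleO_log_rpow_atTop (by norm_num : (0 : ℝ) < 1 / 2)).bound (inv_pos.mpr hc)
  filter_upwards [ho, (tendsto_rpow_atTop (by norm_num : (0 : ℝ) < 1 / 144)).eventually_ge_atTop 3,
    eventually_ge_atTop 1] with t h1 h2 h3
  have ht0 : 0 < t := by linarith
  set s := t ^ (1 / 144 : ℝ) with hs
  have hs2 : t ^ (1 / 72 : ℝ) = s ^ 2 := by
    rw [hs, ← Real.rpow_natCast, ← Real.rpow_mul ht0.le]; norm_num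
  have hfl : t ^ (1 / 72 : ℝ) < (⌊t ^ (1 / 72 : ℝ)⌋₊ : ℝ) + 1 := Nat.lt_floor_add_one _
  have hge : s ≤ (⌊t ^ (1 / 72 : ℝ)⌋₊ : ℝ) := by rw [hs2] at hfl ⊢; nlinarith
  refine ⟨⌊t ^ (1 / 72 : ℝ)⌋₊, ?_, ?_, ?_⟩
  · have : (2 : ℝ) ≤ (⌊t ^ (1 / 72 : ℝ)⌋₊ : ℝ) := by linarith
    exact_mod_cast this
  · have := Real.log_le_log (by linarith) hge
    rw [hs, Real.log_rpow ht0] at this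
    linarith
  · have hle : (⌊t ^ (1 / 72 : ℝ)⌋₊ : ℝ) ≤ t ^ (1 / 72 : ℝ) := Nat.floor_le (by positivity)
    have hpow : (⌊t ^ (1 / 72 : ℝ)⌋₊ : ℝ) ^ 36 ≤ t ^ (1 / 2 : ℝ) := by
      calc _ ≤ (t ^ (1 / 72 : ℝ)) ^ 36 := by gcongr
        _ = _ := by rw [← Real.rpow_natCast, ← Real.rpow_mul ht0.le]; norm_num
    rw [Real.norm_of_nonneg (Real.log_nonneg h3), Real.norm_of_nonneg (by positivity)] at h1
    calc c * Real.log t * (⌊t ^ (1 / 72 : ℝ)⌋₊ : ℝ) ^ 36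
        ≤ c * (c⁻¹ * t ^ (1 / 2 : ℝ)) * t ^ (1 / 2 : ℝ) := by gcongr
      _ = t ^ (1 / 2 : ℝ) * t ^ (1 / 2 : ℝ) := by field_simp
      _ = t := by rw [← Real.rpow_add ht0]; norm_num

open Finset in
theorem card_sifted_le_eventually (hc₁ : 0 < c₁) (hc₂ : 0 < c₂)
    (hM : ∀ᶠ x in totientWindow c₁ c₂, |(x.2 : ℝ) * M x - x.1| ≤ x.2 + 1) :
    ∀ᶠ x in totientWindow c₁ c₂, ∀ r : ℕ → ℕ,
      (∀ p ∈ coprimePrimesLE (siftLevel x) x.2, r p < p) →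
      (#{m ∈ range (M x) | ∀ p ∈ coprimePrimesLE (siftLevel x) x.2, m % p ≠ r p} : ℝ)
        ≤ 46080 * (M x * siftedDensity (siftLevel x) x.2) := by
  filter_upwards [totientWindow_tendsto_log.eventually
      (exists_sieve_level (by positivity : 0 < 320 * c₂)), siftLevel_eventually,
    steps_le_siftLevel hc₁ hc₂ hM, le_steps hc₁ hc₂ hM,
    totientWindow_tendsto_loglog.eventually_gt_atTop 0] with x hz hy hMy hMl hll r hr
  obtain ⟨z, hz2, hzlog, hzpow⟩ := hz
  have hzM : z ^ 36 ≤ M x := by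
    have h1 := hzpow.trans hMl
    have h2 := le_of_mul_le_mul_left h1 (by positivity)
    exact_mod_cast h2
  have hzy : z ≤ siftLevel x := (Nat.le_self_pow (by norm_num) z).trans (hzM.trans hMy)
  have hlogz : 0 < Real.log z := Real.log_pos (by exact_mod_cast hz2)
  refine (card_sifted_le _ z (siftLevel x) (M x) hz2 hzy (filter_subset _ _) hzM r hr).trans ?_
  -- The logarithm of the level is at most 2 log log N ≤ 2 · 144 log z, and 160 · 288 = 46080.
  have hratio : Real.log (siftLevel x) / Real.log z ≤ 288 := by
    rw [div_le_iff₀ hlogz]; linarith [hy.2.2.1]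
  have h0 : 0 ≤ (M x : ℝ) * siftedDensity (siftLevel x) x.2 :=
    mul_nonneg (Nat.cast_nonneg _) (siftedDensity_pos _ _).le
  change 160 * _ * ((M x : ℝ) * siftedDensity (siftLevel x) x.2) ≤ _
  refine mul_le_mul_of_nonneg_right ?_ h0
  linarith

open Finset in
theorem sum_singularSeries_isBigO (hc₁ : 0 < c₁) (hc₂ : 0 < c₂) (i : ℕ)
    (hM : ∀ᶠ x in totientWindow c₁ c₂, |(x.2 : ℝ) * M x - x.1| ≤ x.2 + 1) :
    (fun x : ℕ × ℕ => ((i + 1).factorial * ∑ A ∈ powersetCard (i + 1) (range (M x)),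
      singularSeries (progressionShifts x.2 A) 1) /
        (((x.2 : ℝ) / Nat.totient x.2) ^ i * M x ^ (i + 1)) - 1)
      =O[totientWindow c₁ c₂] relError := by
  set c : ℝ := 2 * (i + 1) ^ 2 with hc
  set C : ℝ := c * 46080 ^ i with hC
  have hc0 : 0 < c := by positivity
  have hC0 : 0 < C := by positivity
  refine IsBigO.of_bound (C * (320 * c₂) + c * (1 + C * (320 * c₂))) ?_
  filter_upwards [card_sifted_le_eventually hc₁ hc₂ hM, steps_le_siftLevel hc₁ hc₂ hM,
    le_steps_mul_siftedDensity hc₁ hc₂ hM, le_steps hc₁ hc₂ hM, siftLevel_eventually,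
    totientWindow_eventually_mem, totientWindow_tendsto_log.eventually_ge_atTop (i + 1 : ℝ),
    totientWindow_tendsto_log.eventually_ge_atTop 1,
    totientWindow_tendsto_loglog.eventually_ge_atTop 1,
    relError_tendsto.eventually_le_const (by norm_num : (0 : ℝ) < 1)]
    with x hbd hMy hμ hMl hy hx hi hL hll hη1
  have hL0 : 0 < Real.log x.1 := by linarith
  have hφ : (0 : ℝ) < Nat.totient x.2 := by exact_mod_cast Nat.totient_pos.mpr hx.1
  have hq : (0 : ℝ) < x.2 := by exact_mod_cast hx.1
  have hM0 : 0 < M x := by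
    rcases Nat.eq_zero_or_pos (M x) with h | h
    · rw [h] at hMl; simp at hMl; linarith
    · exact h
  have hM0' : (0 : ℝ) < M x := by exact_mod_cast hM0
  have hiy : i + 1 ≤ siftLevel x := by
    have : ((i + 1 : ℕ) : ℝ) ≤ siftLevel x := by push_cast; linarith [hy.2.1]
    exact_mod_cast this
  have hmain := sum_singularSeries (by omega : x.2 ≠ 0) hMy hiy (by norm_num : (1 : ℝ) ≤ 46080)
    hM0 hbd
  rw [← hc, ← hC] at hmain
  have hG : (0 : ℝ) < ((x.2 : ℝ) / Nat.totient x.2) ^ i * M x ^ (i + 1) := by positivity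
  set G := ((x.2 : ℝ) / Nat.totient x.2) ^ i * M x ^ (i + 1) with hGdef
  set μ := (M x : ℝ) * siftedDensity (siftLevel x) x.2 with hμdef
  have hμ0 : 0 < μ := mul_pos hM0' (siftedDensity_pos _ _)
  have hη0 : 0 ≤ relError x := div_nonneg (by linarith) hL0.le
  have hμη : 1 / μ ≤ 320 * c₂ * relError x := by
    rw [div_le_iff₀ hμ0]
    unfold relError
    rw [mul_div_assoc', div_mul_eq_mul_div, le_div_iff₀ hL0]
    linarith
  have hyη : 1 / ((siftLevel x : ℝ) + 1) ≤ relError x := by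
    rw [div_le_iff₀ (by positivity)]
    unfold relError
    rw [div_mul_eq_mul_div, le_div_iff₀ hL0]
    nlinarith [hy.2.2.2, mul_le_mul_of_nonneg_right hll (by positivity : (0 : ℝ) ≤ siftLevel x + 1)]
  have e : ∀ S : ℝ, S / G - 1 = (S - G) / G := fun S => by field_simp
  rw [e, norm_div, Real.norm_eq_abs, Real.norm_of_nonneg hG.le, div_le_iff₀ hG,
    Real.norm_of_nonneg hη0]
  refine hmain.trans ?_
  rw [mul_comm]
  gcongr
  have h1 : C / μ ≤ C * (320 * c₂) * relError x := by
    calc C / μ = C * (1 / μ) := div_eq_mul_one_div C μ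
      _ ≤ C * (320 * c₂ * relError x) := mul_le_mul_of_nonneg_left hμη hC0.le
      _ = _ := by ring
  have h2 : c / ((siftLevel x : ℝ) + 1) ≤ c * relError x := by
    rw [div_eq_mul_one_div]; gcongr
  have h3 : C / μ ≤ C * (320 * c₂) :=
    h1.trans (mul_le_of_le_one_right (by positivity) hη1)
  calc _ ≤ C * (320 * c₂) * relError x + c * relError x * (1 + C * (320 * c₂)) := by
        gcongr
    _ = _ := by ring

/-! ### Asymptotics of the weighted count -/

/-- The size `φ(q) (N / φ(q))^{i+1}` of the von Mangoldt weighted count. -/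
noncomputable def mangoldtMain (i : ℕ) (x : ℕ × ℕ) : ℝ :=
  Nat.totient x.2 * ((x.1 : ℝ) / Nat.totient x.2) ^ (i + 1)

/-- The error terms below are first compared with N (log N)^i, which this bounds by a constant times
the main term. -/
theorem le_mangoldtMain (hc₁ : 0 < c₁) (hc₂ : 0 < c₂) (i : ℕ) : ∀ᶠ x in totientWindow c₁ c₂,
    0 < mangoldtMain i x ∧
      (x.1 : ℝ) * Real.log x.1 ^ i ≤ c₂ ^ (i + 1) / c₁ * mangoldtMain i x := by
  filter_upwards [totientWindow_eventually_mem, totientWindow_tendsto_log.eventually_gt_atTop 0,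
    totientWindow_tendsto_cast.eventually_gt_atTop 0] with x hx hL hN
  have hφ : (0 : ℝ) < Nat.totient x.2 := by exact_mod_cast Nat.totient_pos.mpr hx.1
  have hpos : 0 < mangoldtMain i x := by unfold mangoldtMain; positivity
  refine ⟨hpos, ?_⟩
  have h1 : Real.log x.1 / c₂ ≤ (x.1 : ℝ) / Nat.totient x.2 := by
    rw [div_le_div_iff₀ hc₂ hφ]
    have := mul_le_mul_of_nonneg_left hx.2.2 hL.le
    have e : Real.log x.1 * (c₂ * ((x.1 : ℝ) / Real.log x.1)) = x.1 * c₂ := by field_simp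
    linarith
  calc (x.1 : ℝ) * Real.log x.1 ^ i
      = c₂ ^ (i + 1) / c₁ * ((c₁ * ((x.1 : ℝ) / Real.log x.1)) * (Real.log x.1 / c₂) ^ (i + 1)) := by
        rw [div_pow]
        field_simp
        ring
    _ ≤ c₂ ^ (i + 1) / c₁ * mangoldtMain i x := by
        unfold mangoldtMain
        gcongr
        exact hx.2.1

theorem log_pow_le_rpow_eventually (a : ℕ) {δ : ℝ} (hδ : 0 < δ) :
    ∀ᶠ x in totientWindow c₁ c₂, Real.log x.1 ^ a ≤ (x.1 : ℝ) ^ δ := by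
  have h : ∀ᶠ t : ℝ in atTop, Real.log t ^ a ≤ t ^ δ := by
    have ho := (isLittleO_log_rpow_rpow_atTop (s := δ) (a : ℝ) hδ).bound one_pos
    filter_upwards [ho, eventually_ge_atTop 1] with t h1 h2
    rw [Real.norm_of_nonneg (Real.rpow_nonneg (Real.log_nonneg h2) _),
      Real.norm_of_nonneg (by positivity), one_mul, Real.rpow_natCast] at h1
    exact h1
  exact totientWindow_tendsto_cast.eventually h

theorem range_top_le (hc₁ : 0 < c₁) (hc₂ : 0 < c₂)
    (hM : ∀ᶠ x in totientWindow c₁ c₂, |(x.2 : ℝ) * M x - x.1| ≤ x.2 + 1) :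
    ∀ᶠ x in totientWindow c₁ c₂, (x.2 : ℝ) + (1 + x.2 * M x) ≤ 4 * x.1 := by
  have ht : Tendsto (fun x => 160 * c₂ * relError x) (totientWindow c₁ c₂) (𝓝 0) := by
    simpa using relError_tendsto.const_mul (160 * c₂)
  filter_upwards [progression_length_bounds hc₁ hc₂ hM, div_le_relError (c₂ := c₂) hc₁,
    ht.eventually_le_const one_pos,
    totientWindow_tendsto_cast.eventually_ge_atTop 1] with x h1 h2 h3 h4
  have := h2.trans h3
  rw [div_le_one (by linarith)] at this
  linarith [h1.2]

open Finset in
theorem factorial_mul_card_powersetCard_le (m j : ℕ) :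
    (j.factorial : ℝ) * #(powersetCard j (range m)) ≤ (m : ℝ) ^ j := by
  rw [card_powersetCard, card_range]
  have := Nat.descFactorial_le_pow m j
  rw [Nat.descFactorial_eq_factorial_mul_choose] at this
  exact_mod_cast this

open Finset in
/-- The von Mangoldt weighted count of ordered `j`-tuples of distinct steps. -/
noncomputable def mangoldtTotal (j m q : ℕ) : ℝ :=
  j.factorial * ∑ A ∈ powersetCard j (range m), mangoldtCount q A

open Finset in
theorem abs_mangoldtTotal_sub_le {j m q : ℕ} {E : ℝ}
    (h : ∀ A ∈ powersetCard j (range m),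
      |mangoldtCount q A - q * singularSeries (progressionShifts q A) 1| ≤ E) (hE : 0 ≤ E) :
    |mangoldtTotal j m q - q * (j.factorial * ∑ A ∈ powersetCard j (range m),
      singularSeries (progressionShifts q A) 1)| ≤ (m : ℝ) ^ j * E := by
  have e : mangoldtTotal j m q - q * (j.factorial * ∑ A ∈ powersetCard j (range m),
      singularSeries (progressionShifts q A) 1) = j.factorial * ∑ A ∈ powersetCard j (range m),
        (mangoldtCount q A - q * singularSeries (progressionShifts q A) 1) := by
    unfold mangoldtTotal
    rw [sum_sub_distrib, ← mul_sum]; ring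
  rw [e, abs_mul, Nat.abs_cast]
  calc _ ≤ (j.factorial : ℝ) * ∑ A ∈ powersetCard j (range m), E := by
        gcongr
        exact (abs_sum_le_sum_abs _ _).trans (sum_le_sum h)
    _ = (j.factorial : ℝ) * #(powersetCard j (range m)) * E := by
        rw [sum_const, nsmul_eq_mul]; ring
    _ ≤ _ := mul_le_mul_of_nonneg_right (factorial_mul_card_powersetCard_le m j) hE

open Finset in
-- The main term is q (q/φ(q))^i M^(i+1), and q M ≈ N turns it into φ(q) (N/φ(q))^(i+1). At most
-- M^(i+1) ≪ (log N)^(i+1) tuples carry an error O(N^(1-δ)) each, so the power saving absorbs all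
-- logarithms.
theorem mangoldtTotal_isBigO (hc₁ : 0 < c₁) (hc₂ : 0 < c₂) (i : ℕ) {δ C : ℝ} (hδ : 0 < δ)
    (hδ1 : δ < 1)
    (hHL : ∀ q N D : ℕ, 1 ≤ q → 1 ≤ N → 1 ≤ D →
        ∀ 𝒟 : Finset ℕ, 𝒟 ⊆ Finset.Icc 1 D → 𝒟.card = i + 1 → (∀ d ∈ 𝒟, q ∣ d) →
          |(∑ n ∈ coprimesUpTo N q, ∏ d ∈ 𝒟, ArithmeticFunction.vonMangoldt (n + d))
              - singularSeries 𝒟 q * ((coprimesUpTo N q).card : ℝ)|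
            ≤ C * ((N : ℝ) + (D : ℝ)) ^ (1 - δ))
    (hM : ∀ᶠ x in totientWindow c₁ c₂, |(x.2 : ℝ) * M x - x.1| ≤ x.2 + 1) :
    (fun x : ℕ × ℕ => mangoldtTotal (i + 1) (M x) x.2 / mangoldtMain i x - 1)
      =O[totientWindow c₁ c₂] relError := by
  have h1 := isBigO_mul_sub_one relError_tendsto (sum_singularSeries_isBigO hc₁ hc₂ i hM)
    (isBigO_pow_sub_one relError_tendsto (progression_length_isBigO hc₁ hc₂ hM) (i + 1))
  have h2 : (fun x : ℕ × ℕ => (mangoldtTotal (i + 1) (M x) x.2 -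
      x.2 * ((i + 1).factorial * ∑ A ∈ powersetCard (i + 1) (range (M x)),
      singularSeries (progressionShifts x.2 A) 1)) / mangoldtMain i x)
      =O[totientWindow c₁ c₂] relError := by
    refine IsBigO.of_bound ((2 / c₁) ^ (i + 1) * (|C| * 4) * (c₂ ^ (i + 1) / c₁)) ?_
    filter_upwards [range_top_le hc₁ hc₂ hM, steps_le hc₁ hc₂ hM, le_mangoldtMain hc₁ hc₂ i,
      log_pow_le_rpow_eventually 2 hδ, totientWindow_eventually_mem,
      totientWindow_tendsto_cast.eventually_ge_atTop 1,
      totientWindow_tendsto_log.eventually_gt_atTop 0,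
      totientWindow_tendsto_loglog.eventually_ge_atTop 1] with x hV hMx hB hLN hx hN hL hll
    have hN0 : (0 : ℝ) < x.1 := by linarith
    have hE : ∀ A ∈ powersetCard (i + 1) (range (M x)),
        |mangoldtCount x.2 A - x.2 * singularSeries (progressionShifts x.2 A) 1|
          ≤ |C| * 4 * (x.1 : ℝ) ^ (1 - δ) := by
      intro A hA
      rw [mem_powersetCard] at hA
      refine (abs_mangoldtCount_sub_le hHL (by omega) hA.1 hA.2).trans ?_
      calc C * ((x.2 : ℝ) + (1 + x.2 * M x)) ^ (1 - δ)
          ≤ |C| * (4 * (x.1 : ℝ)) ^ (1 - δ) := by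
            gcongr
            exact le_abs_self C
        _ = |C| * ((4 : ℝ) ^ (1 - δ) * (x.1 : ℝ) ^ (1 - δ)) := by
            rw [Real.mul_rpow (by norm_num) hN0.le]
        _ ≤ |C| * ((4 : ℝ) ^ (1 : ℝ) * (x.1 : ℝ) ^ (1 - δ)) := by
            gcongr
            · norm_num
            · linarith
        _ = _ := by rw [Real.rpow_one]; ring
    have hT := abs_mangoldtTotal_sub_le hE (by positivity)
    -- One logarithm is the excess of M^(i+1) over (log N)^i; the other is the denominator of
    -- `relError`.
    have hNδ : (x.1 : ℝ) ^ (1 - δ) * Real.log x.1 ≤ relError x * x.1 := by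
      unfold relError
      rw [div_mul_eq_mul_div, le_div_iff₀ hL]
      calc (x.1 : ℝ) ^ (1 - δ) * Real.log x.1 * Real.log x.1
          = (x.1 : ℝ) ^ (1 - δ) * Real.log x.1 ^ 2 := by ring
        _ ≤ (x.1 : ℝ) ^ (1 - δ) * (x.1 : ℝ) ^ δ := by gcongr
        _ = x.1 := by rw [← Real.rpow_add hN0]; norm_num
        _ ≤ Real.log (Real.log x.1) * x.1 := le_mul_of_one_le_left hN0.le hll
    have hη0 : 0 ≤ relError x := div_nonneg (by linarith) hL.le
    rw [norm_div, Real.norm_eq_abs, Real.norm_of_nonneg hB.1.le, Real.norm_of_nonneg hη0,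
      div_le_iff₀ hB.1]
    calc _ ≤ (M x : ℝ) ^ (i + 1) * (|C| * 4 * (x.1 : ℝ) ^ (1 - δ)) := hT
      _ ≤ (2 / c₁ * Real.log x.1) ^ (i + 1) * (|C| * 4 * (x.1 : ℝ) ^ (1 - δ)) := by gcongr
      _ = (2 / c₁) ^ (i + 1) * (|C| * 4) * (((x.1 : ℝ) ^ (1 - δ) * Real.log x.1) *
            Real.log x.1 ^ i) := by rw [mul_pow]; ring
      _ ≤ (2 / c₁) ^ (i + 1) * (|C| * 4) * ((relError x * x.1) * Real.log x.1 ^ i) := by gcongr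
      _ = (2 / c₁) ^ (i + 1) * (|C| * 4) * relError x * (x.1 * Real.log x.1 ^ i) := by ring
      _ ≤ (2 / c₁) ^ (i + 1) * (|C| * 4) * relError x *
            (c₂ ^ (i + 1) / c₁ * mangoldtMain i x) :=
          mul_le_mul_of_nonneg_left hB.2 (by positivity)
      _ = _ := by ring
  refine (isBigO_add_sub_one h1 h2).congr' ?_ EventuallyEq.rfl
  filter_upwards [totientWindow_eventually_mem, totientWindow_tendsto_cast.eventually_gt_atTop 0,
    le_steps hc₁ hc₂ hM, totientWindow_tendsto_log.eventually_gt_atTop 0] with x hx hN hMl hL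
  have hφ : (0 : ℝ) < Nat.totient x.2 := by exact_mod_cast Nat.totient_pos.mpr hx.1
  have hq : (0 : ℝ) < x.2 := by exact_mod_cast hx.1
  have hM0 : (M x : ℝ) ≠ 0 := by
    intro h
    rw [h, mul_zero] at hMl
    linarith
  congr 1
  rw [sub_div]
  have e : ∀ S : ℝ, S / (((x.2 : ℝ) / Nat.totient x.2) ^ i * M x ^ (i + 1)) *
      ((x.2 : ℝ) * M x / x.1) ^ (i + 1) = x.2 * S / mangoldtMain i x := by
    intro S
    unfold mangoldtMain
    simp only [div_pow, mul_pow]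
    field_simp
    ring
  rw [e]
  ring

/-! ### Removal of the von Mangoldt weights -/

open Finset in
/-- The number of ordered `j`-tuples of distinct primes counted by `primeSteps`. -/
noncomputable def primeTotal (j m q : ℕ) : ℝ :=
  ∑ n ∈ Icc 1 q, ((#(primeSteps q m n)).descFactorial j : ℝ)

open Finset in
theorem primeTotal_eq (j m q : ℕ) :
    primeTotal j m q = j.factorial * ∑ A ∈ powersetCard j (range m), (#(primeBases q A) : ℝ) := by
  unfold primeTotal
  exact_mod_cast sum_descFactorial_primeSteps q m j

open Finset in
theorem primeTotal_mul_log_pow_le (j m q : ℕ) {U : ℝ} (hU : 1 ≤ U) :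
    primeTotal j m q * Real.log U ^ j ≤ (m : ℝ) ^ j * U * Real.log U ^ j + mangoldtTotal j m q := by
  have hlog : 0 ≤ Real.log U := Real.log_nonneg hU
  have h : ∑ A ∈ powersetCard j (range m), (#(primeBases q A) : ℝ) * Real.log U ^ j
      ≤ ∑ A ∈ powersetCard j (range m), (U * Real.log U ^ j + mangoldtCount q A) := by
    refine sum_le_sum fun A hA => ?_
    have := card_primeBases_mul_log_pow_le q A hU
    rwa [(mem_powersetCard.mp hA).2] at this
  rw [← sum_mul, sum_add_distrib, sum_const, nsmul_eq_mul] at h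
  have h2 := mul_le_mul_of_nonneg_right (factorial_mul_card_powersetCard_le m j)
    (by positivity : 0 ≤ U * Real.log U ^ j)
  have h3 := mul_le_mul_of_nonneg_left h (Nat.cast_nonneg j.factorial : (0 : ℝ) ≤ _)
  rw [primeTotal_eq, mangoldtTotal]
  linarith

open Finset in
theorem mangoldtTotal_le (i m q : ℕ) {V : ℕ} (hV : q + (1 + q * m) ≤ V) :
    mangoldtTotal (i + 1) m q ≤ primeTotal (i + 1) m q * Real.log V ^ (i + 1)
      + (m : ℝ) ^ (i + 1) * ((i + 1) * (Chebyshev.psi V - Chebyshev.theta V) * Real.log V ^ i) := by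
  have hlog : 0 ≤ Real.log V := Real.log_natCast_nonneg V
  have hE : 0 ≤ ((i : ℝ) + 1) * (Chebyshev.psi V - Chebyshev.theta V) * Real.log V ^ i := by
    have := Chebyshev.theta_le_psi V
    have : 0 ≤ Chebyshev.psi V - Chebyshev.theta V := by linarith
    positivity
  have h : ∑ A ∈ powersetCard (i + 1) (range m), mangoldtCount q A
      ≤ ∑ A ∈ powersetCard (i + 1) (range m), ((#(primeBases q A) : ℝ) * Real.log V ^ (i + 1)
        + (i + 1) * (Chebyshev.psi V - Chebyshev.theta V) * Real.log V ^ i) :=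
    sum_le_sum fun A hA => mangoldtCount_le q m A (mem_powersetCard.mp hA).1
      (mem_powersetCard.mp hA).2 hV
  rw [sum_add_distrib, ← sum_mul, sum_const, nsmul_eq_mul] at h
  have h2 := mul_le_mul_of_nonneg_right (factorial_mul_card_powersetCard_le m (i + 1)) hE
  have h3 := mul_le_mul_of_nonneg_left h (Nat.cast_nonneg (i + 1).factorial : (0 : ℝ) ≤ _)
  rw [primeTotal_eq, mangoldtTotal]
  linarith

/-- From below, each weight is replaced by log 4N and prime powers are discarded; from above, by log
U and the n ≤ U are discarded. Both logarithms are log N up to the permitted relative error. -/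
theorem primeTotal_isBigO (hc₁ : 0 < c₁) (hc₂ : 0 < c₂) (i : ℕ)
    (hW : (fun x : ℕ × ℕ => mangoldtTotal (i + 1) (M x) x.2 / mangoldtMain i x - 1)
      =O[totientWindow c₁ c₂] relError)
    (hM : ∀ᶠ x in totientWindow c₁ c₂, |(x.2 : ℝ) * M x - x.1| ≤ x.2 + 1) :
    (fun x : ℕ × ℕ => primeTotal (i + 1) (M x) x.2 * Real.log x.1 ^ (i + 1) / mangoldtMain i x - 1)
      =O[totientWindow c₁ c₂] relError := by
  -- The exponent i + 3 makes M^(i+1) U (log N)^(i+1) of order at most N (log N)^(i-1), one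
  -- logarithm below the main term. It costs only (i + 3) log log N in log U.
  let U : ℕ × ℕ → ℝ := fun x => x.1 / Real.log x.1 ^ (i + 3)
  have hUlog : ∀ᶠ x in totientWindow c₁ c₂,
      Real.log (U x) = Real.log x.1 - (i + 3) * Real.log (Real.log x.1) := by
    filter_upwards [totientWindow_tendsto_cast.eventually_gt_atTop 0,
      totientWindow_tendsto_log.eventually_gt_atTop 0] with x hN hL
    simp only [U]
    rw [Real.log_div hN.ne' (by positivity), Real.log_pow]
    push_cast
    ring
  have hU1 : (fun x => Real.log (U x) / Real.log x.1 - 1) =O[totientWindow c₁ c₂] relError := by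
    refine IsBigO.of_bound (i + 3) ?_
    filter_upwards [hUlog, totientWindow_tendsto_log.eventually_gt_atTop 0] with x h hL
    have e : Real.log (U x) / Real.log x.1 - 1 = -((i + 3) * relError x) := by
      rw [h]; unfold relError; field_simp; ring
    rw [e, norm_neg, norm_mul, Real.norm_of_nonneg (by positivity)]
  have hUpos : ∀ᶠ x in totientWindow c₁ c₂, 0 < Real.log (U x) := by
    filter_upwards [(tendsto_one_of_isBigO_sub_one relError_tendsto hU1).eventually_const_lt
      (by norm_num : (0 : ℝ) < 1), totientWindow_tendsto_log.eventually_gt_atTop 0] with x h1 h2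
    exact (div_pos_iff_of_pos_right h2).mp h1
  have hV1 : (fun x : ℕ × ℕ => Real.log (4 * x.1 : ℕ) / Real.log x.1 - 1)
      =O[totientWindow c₁ c₂] relError := by
    refine IsBigO.of_bound (Real.log 4) ?_
    filter_upwards [totientWindow_tendsto_log.eventually_gt_atTop 0,
      totientWindow_tendsto_cast.eventually_gt_atTop 0,
      totientWindow_tendsto_loglog.eventually_ge_atTop 1] with x hL hN hll
    have h4 : 0 ≤ Real.log 4 := Real.log_nonneg (by norm_num)
    have e : Real.log (4 * x.1 : ℕ) / Real.log x.1 - 1 = Real.log 4 * (1 / Real.log x.1) := by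
      push_cast
      rw [Real.log_mul (by norm_num) hN.ne']
      field_simp
      ring
    rw [e, norm_mul, Real.norm_of_nonneg h4]
    gcongr
    rw [Real.norm_of_nonneg (by positivity)]
    refine le_trans ?_ (Real.le_norm_self _)
    unfold relError
    gcongr
  -- Saving one full logarithm over N (log N)^i is enough, since eventually log log N ≥ 1.
  have hsmall : ∀ (f : ℕ × ℕ → ℝ) (K : ℝ), (∀ᶠ x in totientWindow c₁ c₂, 0 ≤ f x ∧
      f x * Real.log x.1 ≤ K * (x.1 * Real.log x.1 ^ i)) →
      (fun x => f x / mangoldtMain i x) =O[totientWindow c₁ c₂] relError := by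
    intro f K hf
    refine IsBigO.of_bound (|K| * (c₂ ^ (i + 1) / c₁)) ?_
    filter_upwards [hf, le_mangoldtMain hc₁ hc₂ i, totientWindow_tendsto_log.eventually_gt_atTop 0,
      totientWindow_tendsto_cast.eventually_gt_atTop 0,
      totientWindow_tendsto_loglog.eventually_ge_atTop 1] with x hfx hB hL hN hll
    rw [norm_div, Real.norm_of_nonneg hfx.1, Real.norm_of_nonneg hB.1.le, div_le_iff₀ hB.1]
    have h1 : f x ≤ |K| * (x.1 * Real.log x.1 ^ i) * (1 / Real.log x.1) := by
      rw [mul_one_div, le_div_iff₀ hL]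
      refine hfx.2.trans ?_
      gcongr
      exact le_abs_self K
    have h2 : 1 / Real.log x.1 ≤ ‖relError x‖ := by
      refine le_trans ?_ (Real.le_norm_self _)
      unfold relError
      gcongr
    calc f x ≤ |K| * (x.1 * Real.log x.1 ^ i) * (1 / Real.log x.1) := h1
      _ ≤ |K| * (c₂ ^ (i + 1) / c₁ * mangoldtMain i x) * ‖relError x‖ :=
          mul_le_mul (mul_le_mul_of_nonneg_left hB.2 (abs_nonneg K)) h2 (by positivity)
            (mul_nonneg (abs_nonneg K) (mul_nonneg (by positivity) hB.1.le))
      _ = _ := by ring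
  have hupErr : (fun x : ℕ × ℕ => ((M x : ℝ) ^ (i + 1) * U x * Real.log x.1 ^ (i + 1)) /
      mangoldtMain i x) =O[totientWindow c₁ c₂] relError := by
    refine hsmall _ ((2 / c₁) ^ (i + 1)) ?_
    filter_upwards [steps_le hc₁ hc₂ hM, totientWindow_tendsto_log.eventually_gt_atTop 0,
      totientWindow_tendsto_cast.eventually_gt_atTop 0] with x hMx hL hN
    refine ⟨by positivity, ?_⟩
    calc (M x : ℝ) ^ (i + 1) * U x * Real.log x.1 ^ (i + 1) * Real.log x.1
        ≤ (2 / c₁ * Real.log x.1) ^ (i + 1) * U x * Real.log x.1 ^ (i + 1) * Real.log x.1 := by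
          have : 0 ≤ U x := by positivity
          gcongr
      _ = _ := by
          simp only [U]
          rw [mul_pow]
          field_simp
          ring
  have hup := isBigO_add_sub_one
    (isBigO_mul_sub_one relError_tendsto hW
      (isBigO_inv_sub_one relError_tendsto (isBigO_pow_sub_one relError_tendsto hU1 (i + 1)))) hupErr
  have hlowErr : (fun x : ℕ × ℕ => ((M x : ℝ) ^ (i + 1) * ((i + 1) *
      (Chebyshev.psi (4 * x.1 : ℕ) - Chebyshev.theta (4 * x.1 : ℕ)) *
        Real.log (4 * x.1 : ℕ) ^ i)) / mangoldtMain i x) =O[totientWindow c₁ c₂] relError := by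
    refine hsmall _ ((2 / c₁) ^ (i + 1) * (i + 1) * 4 * 2 ^ (i + 1)) ?_
    filter_upwards [steps_le hc₁ hc₂ hM, totientWindow_tendsto_log.eventually_ge_atTop (Real.log 4),
      totientWindow_tendsto_log.eventually_gt_atTop 0,
      -- Of the 2i + 3 logarithms in the prime power error, i stay and i + 3 are absorbed by √N, the
      -- other √N being the size of ψ - θ.
      log_pow_le_rpow_eventually (i + 3) (by norm_num : (0 : ℝ) < 1 / 2),
      totientWindow_tendsto_cast.eventually_ge_atTop 1] with x hMx hL4 hL hLN hN
    have hψ0 : 0 ≤ Chebyshev.psi (4 * x.1 : ℕ) - Chebyshev.theta (4 * x.1 : ℕ) :=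
      sub_nonneg.mpr (Chebyshev.theta_le_psi _)
    have hlogV : Real.log (4 * x.1 : ℕ) ≤ 2 * Real.log x.1 := by
      push_cast
      rw [Real.log_mul (by norm_num) (by linarith)]
      linarith
    have hlogV0 : 0 ≤ Real.log (4 * x.1 : ℕ) := Real.log_natCast_nonneg _
    have hψ : Chebyshev.psi (4 * x.1 : ℕ) - Chebyshev.theta (4 * x.1 : ℕ)
        ≤ 4 * (x.1 : ℝ) ^ (1 / 2 : ℝ) * (2 * Real.log x.1) := by
      refine (Chebyshev.psi_sub_theta_le (by push_cast; linarith)).trans ?_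
      have hs : Real.sqrt (4 * x.1 : ℕ) = 2 * (x.1 : ℝ) ^ (1 / 2 : ℝ) := by
        push_cast
        rw [Real.sqrt_mul (by norm_num), ← Real.sqrt_eq_rpow,
          show (4 : ℝ) = 2 ^ 2 by norm_num, Real.sqrt_sq (by norm_num)]
      rw [hs]
      calc 2 * (2 * (x.1 : ℝ) ^ (1 / 2 : ℝ)) * Real.log (4 * x.1 : ℕ)
          ≤ 2 * (2 * (x.1 : ℝ) ^ (1 / 2 : ℝ)) * (2 * Real.log x.1) := by gcongr
        _ = _ := by ring
    refine ⟨by positivity, ?_⟩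
    calc _ ≤ (2 / c₁ * Real.log x.1) ^ (i + 1) * ((i + 1) *
          (4 * (x.1 : ℝ) ^ (1 / 2 : ℝ) * (2 * Real.log x.1)) * (2 * Real.log x.1) ^ i) *
            Real.log x.1 := by gcongr
      _ = (2 / c₁) ^ (i + 1) * (i + 1) * 4 * 2 ^ (i + 1) * ((x.1 : ℝ) ^ (1 / 2 : ℝ) *
            Real.log x.1 ^ (i + 3) * Real.log x.1 ^ i) := by ring
      _ ≤ (2 / c₁) ^ (i + 1) * (i + 1) * 4 * 2 ^ (i + 1) * ((x.1 : ℝ) ^ (1 / 2 : ℝ) *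
            (x.1 : ℝ) ^ (1 / 2 : ℝ) * Real.log x.1 ^ i) := by gcongr
      _ = _ := by
          rw [← Real.rpow_add (by linarith : (0 : ℝ) < x.1)]
          norm_num
  have hlow := isBigO_mul_sub_one relError_tendsto
    (isBigO_add_sub_one hW hlowErr.neg_left)
    (isBigO_inv_sub_one relError_tendsto (isBigO_pow_sub_one relError_tendsto hV1 (i + 1)))
  refine isBigO_sub_one_of_le_of_le hlow hup ?_ ?_
  · filter_upwards [range_top_le hc₁ hc₂ hM, le_mangoldtMain hc₁ hc₂ i,
      totientWindow_tendsto_log.eventually_gt_atTop 0,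
      totientWindow_tendsto_cast.eventually_gt_atTop 1] with x hV hB hL hN
    have hV' : x.2 + (1 + x.2 * M x) ≤ 4 * x.1 := by exact_mod_cast hV
    have h := mangoldtTotal_le i (M x) x.2 hV'
    have hlogV : 0 < Real.log (4 * x.1 : ℕ) := Real.log_pos (by push_cast; linarith)
    rw [← div_eq_mul_inv, div_le_iff₀ (by positivity), ← sub_eq_add_neg, ← sub_div,
      div_le_iff₀ hB.1]
    calc _ ≤ primeTotal (i + 1) (M x) x.2 * Real.log (4 * x.1 : ℕ) ^ (i + 1) := by linarith
      _ = _ := by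
          have := hB.1.ne'
          rw [div_pow]
          field_simp
  · filter_upwards [hUpos, le_mangoldtMain hc₁ hc₂ i,
      totientWindow_tendsto_log.eventually_gt_atTop 0,
      totientWindow_tendsto_cast.eventually_gt_atTop 0] with x hU hB hL hN
    have hU0 : 0 < U x := by positivity
    have hU1 : 1 ≤ U x := by
      by_contra hc
      exact absurd hU (not_lt.mpr (Real.log_nonpos hU0.le (not_le.mp hc).le))
    have h := primeTotal_mul_log_pow_le (i + 1) (M x) x.2 hU1
    have hB0 := hB.1
    have hP : primeTotal (i + 1) (M x) x.2 ≤ (M x : ℝ) ^ (i + 1) * U x +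
        mangoldtTotal (i + 1) (M x) x.2 / Real.log (U x) ^ (i + 1) := by
      have e : (M x : ℝ) ^ (i + 1) * U x +
        mangoldtTotal (i + 1) (M x) x.2 / Real.log (U x) ^ (i + 1)
          = ((M x : ℝ) ^ (i + 1) * U x * Real.log (U x) ^ (i + 1) +
            mangoldtTotal (i + 1) (M x) x.2) / Real.log (U x) ^ (i + 1) := by
        field_simp
      rw [e, le_div_iff₀ (by positivity)]
      exact h
    rw [div_le_iff₀ hB0]
    calc _ ≤ ((M x : ℝ) ^ (i + 1) * U x +
          mangoldtTotal (i + 1) (M x) x.2 / Real.log (U x) ^ (i + 1)) * Real.log x.1 ^ (i + 1) := by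
          gcongr
      _ = _ := by
          rw [div_pow]
          field_simp
          ring

/-! ### Assembly of the moment -/

open Finset in
theorem sum_pow_card_primeSteps {k : ℕ} (hk : 1 ≤ k) (m q : ℕ) :
    ∑ n ∈ Icc 1 q, (#(primeSteps q m n) : ℝ) ^ k
      = ∑ j ∈ Icc 1 k, (Nat.stirlingSecond k j : ℝ) * primeTotal j m q := by
  unfold primeTotal
  simp_rw [Finset.mul_sum]
  rw [Finset.sum_comm]
  refine Finset.sum_congr rfl fun n _ => ?_
  exact_mod_cast pow_eq_sum_Icc_stirlingSecond (#(primeSteps q m n)) k hk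

/-- All terms are nonnegative, so an error relative to one of them is also relative to the sum. The
term j = 1, where S(k,1) = 1, bounds the sum away from 0, which absorbs additive errors. -/
theorem stirlingMainTerm_ge (hc₂ : 0 < c₂) {k : ℕ} (hk : 1 ≤ k) :
    ∀ᶠ x in totientWindow c₁ c₂, 1 / c₂ ≤ stirlingMainTerm k x.1 x.2 ∧
      ∀ j ∈ Finset.Icc 1 k, (Nat.stirlingSecond k j : ℝ) *
        ((x.1 : ℝ) / (Nat.totient x.2 * Real.log x.1)) ^ j ≤ stirlingMainTerm k x.1 x.2 := by
  filter_upwards [totientWindow_eventually_mem, totientWindow_tendsto_log.eventually_gt_atTop 0,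
    totientWindow_tendsto_cast.eventually_gt_atTop 0] with x hx hL hN
  have hφ : (0 : ℝ) < Nat.totient x.2 := by exact_mod_cast Nat.totient_pos.mpr hx.1
  have hterm : ∀ j ∈ Finset.Icc 1 k, (Nat.stirlingSecond k j : ℝ) *
        ((x.1 : ℝ) / (Nat.totient x.2 * Real.log x.1)) ^ j ≤ stirlingMainTerm k x.1 x.2 :=
    fun j hj => Finset.single_le_sum (f := fun j => (Nat.stirlingSecond k j : ℝ) *
        ((x.1 : ℝ) / (Nat.totient x.2 * Real.log x.1)) ^ j) (fun j _ => by positivity) hj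
  refine ⟨?_, hterm⟩
  have h1 := hterm 1 (Finset.mem_Icc.mpr ⟨le_rfl, hk⟩)
  obtain ⟨k, rfl⟩ := Nat.exists_eq_succ_of_ne_zero (by omega : k ≠ 0)
  rw [Nat.succ_eq_add_one, Nat.stirlingSecond_one_right, Nat.cast_one, one_mul, pow_one] at h1
  refine le_trans ?_ h1
  rw [div_le_div_iff₀ hc₂ (by positivity)]
  have := mul_le_mul_of_nonneg_right hx.2.2 hL.le
  have e : c₂ * ((x.1 : ℝ) / Real.log x.1) * Real.log x.1 = x.1 * c₂ := by field_simp
  linarith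

open Finset in
theorem sum_pow_card_primeSteps_isBigO (hHL : UniformHardyLittlewood) (hc₁ : 0 < c₁) (hc₂ : 0 < c₂)
    {k : ℕ} (hk : 1 ≤ k)
    (hM : ∀ᶠ x in totientWindow c₁ c₂, |(x.2 : ℝ) * M x - x.1| ≤ x.2 + 1) :
    (fun x : ℕ × ℕ => (∑ n ∈ Icc 1 x.2, (#(primeSteps x.2 (M x) n) : ℝ) ^ k) / Nat.totient x.2
      - stirlingMainTerm k x.1 x.2) =O[totientWindow c₁ c₂]
        fun x => relError x * stirlingMainTerm k x.1 x.2 := by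
  obtain ⟨δ, hδ, hδ2, hHL⟩ := hHL
  have hterm : ∀ j ∈ Icc 1 k, (fun x : ℕ × ℕ => (Nat.stirlingSecond k j : ℝ) *
      primeTotal j (M x) x.2 / Nat.totient x.2 - (Nat.stirlingSecond k j : ℝ) *
        ((x.1 : ℝ) / (Nat.totient x.2 * Real.log x.1)) ^ j) =O[totientWindow c₁ c₂]
        fun x => relError x * stirlingMainTerm k x.1 x.2 := by
    intro j hj
    obtain ⟨i, rfl⟩ : ∃ i, j = i + 1 := ⟨j - 1, by have := (mem_Icc.mp hj).1; omega⟩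
    obtain ⟨C, hC⟩ := hHL (i + 1) (by omega)
    have hp := primeTotal_isBigO hc₁ hc₂ i
      (mangoldtTotal_isBigO hc₁ hc₂ i hδ (by linarith) hC hM) hM
    have hmain : (fun x : ℕ × ℕ => (Nat.stirlingSecond k (i + 1) : ℝ) *
        ((x.1 : ℝ) / (Nat.totient x.2 * Real.log x.1)) ^ (i + 1)) =O[totientWindow c₁ c₂]
        fun x => stirlingMainTerm k x.1 x.2 := by
      refine IsBigO.of_bound 1 ?_
      filter_upwards [stirlingMainTerm_ge hc₂ hk, totientWindow_tendsto_log.eventually_gt_atTop 0]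
        with x hx hL
      rw [one_mul, Real.norm_of_nonneg (by positivity)]
      exact (hx.2 _ hj).trans (Real.le_norm_self _)
    refine (hp.mul hmain).congr' ?_ EventuallyEq.rfl
    filter_upwards [totientWindow_eventually_mem, totientWindow_tendsto_log.eventually_gt_atTop 0,
      totientWindow_tendsto_cast.eventually_gt_atTop 0] with x hx hL hN
    have hφ : (0 : ℝ) < Nat.totient x.2 := by exact_mod_cast Nat.totient_pos.mpr hx.1
    unfold mangoldtMain
    rw [div_pow, div_pow, mul_pow]
    field_simp
  refine (IsBigO.sum hterm).congr_left fun x => ?_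
  rw [Finset.sum_apply, sum_pow_card_primeSteps hk, sum_sub_distrib, stirlingMainTerm, sum_div]

open Finset in
-- With M = ⌊(N-1)/q⌋ all terms stay at most N, and with M + 1 they cover every prime up to N, so
-- the two sums bracket the moment. Classes not coprime to q add at most log₂ q to the lower sum,
-- which is negligible after division by φ(q).
theorem primeMoment_isBigO (hHL : UniformHardyLittlewood) (hc₁ : 0 < c₁) (hc₂ : 0 < c₂)
    {k : ℕ} (hk : 1 ≤ k) :
    (fun x : ℕ × ℕ => primeMoment k x.1 x.2 - stirlingMainTerm k x.1 x.2)
      =O[totientWindow c₁ c₂] fun x => relError x * stirlingMainTerm k x.1 x.2 := by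
  have hdiv : ∀ᶠ x in totientWindow c₁ c₂, x.2 * ((x.1 - 1) / x.2) + 1 ≤ x.1 ∧
      x.1 ≤ x.2 * ((x.1 - 1) / x.2 + 1) := by
    filter_upwards [totientWindow_eventually_mem,
      totientWindow_tendsto_fst.eventually_ge_atTop 1] with x hx hN
    have h1 := Nat.div_add_mod (x.1 - 1) x.2
    have h2 := Nat.mod_lt (x.1 - 1) (by omega : 0 < x.2)
    rw [mul_add]
    constructor <;> omega
  have hlo : ∀ᶠ x in totientWindow c₁ c₂,
      |(x.2 : ℝ) * ((x.1 - 1) / x.2 : ℕ) - x.1| ≤ x.2 + 1 := by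
    filter_upwards [hdiv] with x hx
    have h1 : (x.2 : ℝ) * ((x.1 - 1) / x.2 : ℕ) + 1 ≤ x.1 := by exact_mod_cast hx.1
    have h2 : (x.1 : ℝ) ≤ x.2 * (((x.1 - 1) / x.2 : ℕ) + 1) := by exact_mod_cast hx.2
    have h3 : (0 : ℝ) ≤ x.2 := Nat.cast_nonneg _
    rw [abs_le]
    constructor <;> nlinarith
  have hhi : ∀ᶠ x in totientWindow c₁ c₂,
      |(x.2 : ℝ) * ((x.1 - 1) / x.2 + 1 : ℕ) - x.1| ≤ x.2 + 1 := by
    filter_upwards [hdiv] with x hx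
    have h1 : (x.2 : ℝ) * ((x.1 - 1) / x.2 : ℕ) + 1 ≤ x.1 := by exact_mod_cast hx.1
    have h2 : (x.1 : ℝ) ≤ x.2 * (((x.1 - 1) / x.2 : ℕ) + 1) := by exact_mod_cast hx.2
    have h3 : (0 : ℝ) ≤ x.2 := Nat.cast_nonneg _
    push_cast
    rw [abs_le]
    constructor <;> nlinarith
  have hA := sum_pow_card_primeSteps_isBigO hHL hc₁ hc₂ hk hlo
  have hB := sum_pow_card_primeSteps_isBigO hHL hc₁ hc₂ hk hhi
  have hE : (fun x : ℕ × ℕ => (Nat.log 2 x.2 : ℝ) / Nat.totient x.2) =O[totientWindow c₁ c₂]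
      fun x => relError x * stirlingMainTerm k x.1 x.2 := by
    refine IsBigO.of_bound (3 / c₁ * c₂) ?_
    filter_upwards [natLog_le_eventually hc₁, totientWindow_eventually_mem,
      stirlingMainTerm_ge hc₂ hk, log_pow_le_rpow_eventually 3 one_pos,
      totientWindow_tendsto_log.eventually_gt_atTop 0,
      totientWindow_tendsto_cast.eventually_gt_atTop 0,
      totientWindow_tendsto_loglog.eventually_ge_atTop 1] with x hlog hx hmain hLN hL hN hll
    have hφ : (0 : ℝ) < Nat.totient x.2 := by exact_mod_cast Nat.totient_pos.mpr hx.1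
    rw [Real.rpow_one] at hLN
    have hη0 : 0 ≤ relError x := div_nonneg (by linarith) hL.le
    have h1 : 1 / Real.log x.1 ≤ relError x := by unfold relError; gcongr
    have hm0 : 1 ≤ c₂ * stirlingMainTerm k x.1 x.2 := by
      have := mul_le_mul_of_nonneg_left hmain.1 hc₂.le
      rwa [mul_one_div_cancel hc₂.ne'] at this
    rw [Real.norm_of_nonneg (by positivity)]
    calc (Nat.log 2 x.2 : ℝ) / Nat.totient x.2
        ≤ 3 * Real.log x.1 / (c₁ * ((x.1 : ℝ) / Real.log x.1)) := by
          gcongr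
          exact hx.2.1
      _ = 3 / c₁ * (1 / Real.log x.1) * (Real.log x.1 ^ 3 / x.1) := by field_simp
      _ ≤ 3 / c₁ * relError x * 1 := by
          gcongr
          exact (div_le_one hN).mpr hLN
      _ ≤ 3 / c₁ * relError x * (c₂ * stirlingMainTerm k x.1 x.2) := by gcongr
      _ = 3 / c₁ * c₂ * (relError x * stirlingMainTerm k x.1 x.2) := by ring
      _ ≤ _ := by gcongr; exact Real.le_norm_self _
  refine IsBigO.trans ?_ ((hA.norm_left.add hB.norm_left).add hE)
  refine IsBigO.of_bound 1 ?_
  filter_upwards [hdiv, totientWindow_eventually_mem] with x hd hx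
  have hq0 : x.2 ≠ 0 := by omega
  have hφ : (0 : ℝ) < Nat.totient x.2 := by exact_mod_cast Nat.totient_pos.mpr hx.1
  have hup := totient_mul_primeMoment_le (k := k) hq0 (hd.2.trans (Nat.le_succ _))
  have hdn := le_totient_mul_primeMoment (k := k) (by omega) hq0 hd.1
  rw [mul_comm, ← le_div_iff₀ hφ] at hup
  rw [← div_le_div_iff_of_pos_right hφ, add_div, mul_div_cancel_left₀ _ hφ.ne'] at hdn
  have hE0 : 0 ≤ (Nat.log 2 x.2 : ℝ) / Nat.totient x.2 := by positivity
  simp only [Real.norm_eq_abs, one_mul]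
  set a := (∑ n ∈ Icc 1 x.2, (#(primeSteps x.2 ((x.1 - 1) / x.2) n) : ℝ) ^ k) / Nat.totient x.2
  set b := (∑ n ∈ Icc 1 x.2, (#(primeSteps x.2 ((x.1 - 1) / x.2 + 1) n) : ℝ) ^ k) /
    Nat.totient x.2
  set m := stirlingMainTerm k x.1 x.2
  have h1 := neg_abs_le (a - m)
  have h2 := le_abs_self (b - m)
  have h3 := abs_nonneg (a - m)
  have h4 := abs_nonneg (b - m)
  refine le_trans ?_ (le_abs_self _)
  rw [abs_le]
  constructor <;> linarith

end Window

theorem theorem1p4 (hHL : UniformHardyLittlewood) (k : ℕ) (hk : 1 ≤ k)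
    (c₁ c₂ : ℝ) (hc₁ : 0 < c₁) (hc₂ : 0 < c₂) :
    ∃ (C : ℝ) (N₀ : ℕ), ∀ N q : ℕ, N₀ ≤ N → 1 ≤ q →
      c₁ * ((N : ℝ) / Real.log (N : ℝ)) ≤ (Nat.totient q : ℝ) →
      (Nat.totient q : ℝ) ≤ c₂ * ((N : ℝ) / Real.log (N : ℝ)) →
      |primeMoment k N q - stirlingMainTerm k N q|
        ≤ C * (Real.log (Real.log (N : ℝ)) / Real.log (N : ℝ)) * stirlingMainTerm k N q := by
  obtain ⟨C, hC⟩ := (primeMoment_isBigO hHL hc₁ hc₂ hk).bound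
  have hpos : ∀ᶠ x in totientWindow c₁ c₂, 0 ≤ relError x * stirlingMainTerm k x.1 x.2 := by
    filter_upwards [stirlingMainTerm_ge hc₂ hk, totientWindow_tendsto_log.eventually_ge_atTop 0,
      totientWindow_tendsto_loglog.eventually_ge_atTop 0] with x h1 h2 h3
    exact mul_nonneg (div_nonneg h3 h2) ((by positivity : 0 ≤ 1 / c₂).trans h1.1)
  have h := hC.and hpos
  -- Eventually along the window means for all N ≥ N₀ and every admissible q at once, which is the
  -- required uniformity.
  rw [totientWindow, eventually_inf_principal, eventually_comap] at h
  obtain ⟨N₀, hN₀⟩ := eventually_atTop.mp h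
  refine ⟨C, N₀, fun N q hN hq h1 h2 => ?_⟩
  obtain ⟨h3, h4⟩ := hN₀ N hN (N, q) rfl ⟨hq, h1, h2⟩
  rw [Real.norm_eq_abs, Real.norm_of_nonneg h4, ← mul_assoc] at h3
  exact h3
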